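/- Let $w_1,\dots,w_n$ ($n\ge 1$) be positive real weights. A prefix-free code for them is a sequence of $n$ binary codewords (the empty codeword being allowed when $n=1$), none of which is a prefix of another; it is optimal if $\sum_i \ell_i w_i$ is minimal among all prefix-free codes, where $\ell_i$ is the length of the $i$th codeword. The tree of a code is the rooted binary tree formed by its codewords (its nodes are the prefixes of the codewords). A tree is perfect if each of its nodes has two or zero children and all its leaves have the same depth. The skeleton tree of a tree is obtained by shrinking every maximal perfect subtree (a node with all its descendants) to its root. An optimal skeleton tree for $w_1,\dots,w_n$ is a skeleton tree with the least number of nodes among the skeleton trees of the trees of all optimal prefix-free codes for $w_1,\dots,w_n$. Theorem. There is an algorithm that, given $n\ge1$ and positive weights $w_1,\dots,w_n$, constructs an optimal skeleton tree for these weights, together with an optimal prefix-free code whose tree has this skeleton tree, in $O(n^2\log n)$ time (for $n=1$, in $O(1)$ time). Here the time is counted on a word RAM with words of $O(\log n)$ bits (of $O(1)$ bits for $n=1$), on which the weights are real numbers that can be copied, added and compared at unit cost. -/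

import Mathlib

/-! Prefix-free binary codes, their trees, skeleton trees, and a word RAM with unit-cost steps. -/

namespace OptSkeleton

/-! ### Codes -/

/-- A sequence of `n` binary codewords is prefix-free if no codeword is a prefix of another one. -/
def IsPrefixFree {n : ℕ} (c : Fin n → List Bool) : Prop :=
  ∀ i j, i ≠ j → ¬ c i <+: c j

/-- The weighted length `∑ ℓ_i w_i`. -/
def codeCost {n : ℕ} (w : Fin n → ℝ) (c : Fin n → List Bool) : ℝ :=
  ∑ i, ((c i).length : ℝ) * w i

/-- `c` is an optimal prefix-free code for the weights `w`. -/
def IsOptimalCode {n : ℕ} (w : Fin n → ℝ) (c : Fin n → List Bool) : Prop :=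
  IsPrefixFree c ∧ ∀ c' : Fin n → List Bool, IsPrefixFree c' → codeCost w c ≤ codeCost w c'

/-! ### Trees

A rooted binary tree is given by the set of its nodes; a node is named by the path that leads to it
from the root (`false` is the left edge, marked with zero, and `true` the right edge, marked with
one). The root is `[]`, and the depth of `v` is `v.length`. -/

/-- The tree of a code: its nodes are the prefixes of the codewords. -/
def codeTree {n : ℕ} (c : Fin n → List Bool) : Set (List Bool) :=
  {v | ∃ i, v <+: c i}

/-- `v` is a leaf of `T`. -/
def IsLeaf (T : Set (List Bool)) (v : List Bool) : Prop :=
  v ∈ T ∧ ∀ x : Bool, v ++ [x] ∉ T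

/-- The subtree of `T` rooted at the node `u` (that is, `u` with all its descendants) is perfect:
each of its nodes has two or zero children, and all its leaves have the same depth. -/
def IsPerfectAt (T : Set (List Bool)) (u : List Bool) : Prop :=
  u ∈ T ∧
  (∀ v ∈ T, u <+: v → (∀ x : Bool, v ++ [x] ∈ T) ∨ (∀ x : Bool, v ++ [x] ∉ T)) ∧
  (∀ v v', IsLeaf T v → IsLeaf T v' → u <+: v → u <+: v' → v.length = v'.length)

/-- The subtree rooted at `u` is a maximal perfect subtree: it is perfect and not a subtree of
another perfect subtree. -/
def IsMaximalPerfectAt (T : Set (List Bool)) (u : List Bool) : Prop :=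
  IsPerfectAt T u ∧ ∀ u', IsPerfectAt T u' → u' <+: u → u' = u

/-- The skeleton tree of `T`: every maximal perfect subtree is shrunk, i.e. all its nodes except
its root are removed. -/
def skeleton (T : Set (List Bool)) : Set (List Bool) :=
  {v | v ∈ T ∧ ∀ u, IsMaximalPerfectAt T u → u <+: v → v = u}

/-- The code `c` is optimal for `w`, and the skeleton tree of its tree has the least number of
nodes among the skeleton trees of the trees of all optimal codes for `w`; that is, the skeleton
tree of `codeTree c` is an optimal skeleton tree for `w`. -/
def InducesOptimalSkeleton {n : ℕ} (w : Fin n → ℝ) (c : Fin n → List Bool) : Prop :=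
  IsOptimalCode w c ∧
  ∀ c' : Fin n → List Bool, IsOptimalCode w c' →
    (skeleton (codeTree c)).ncard ≤ (skeleton (codeTree c')).ncard

/-! ### The machine

A word RAM with `b`-bit words. It has word variables, arrays of words, and arrays of weights
(real numbers). Words admit the four arithmetic operations, comparison and use as array
indices; weights can only be copied, added and compared. Every operation, memory access, test and
command costs one time unit. A program is a fixed command, in which only finitely many variables
and arrays occur. -/

/-- Memory contents: word variables, word arrays (array name, index) and weight arrays. -/
structure State where
  var : ℕ → ℕ
  arr : ℕ → ℕ → ℕ
  wt : ℕ → ℕ → ℝ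

/-- Arithmetic operations on words; `sub` is truncated at zero and `div` rounds down. -/
inductive Op
  | add
  | sub
  | mul
  | div

def Op.app : Op → ℕ → ℕ → ℕ
  | .add, x, y => x + y
  | .sub, x, y => x - y
  | .mul, x, y => x * y
  | .div, x, y => x / y

/-- Word expressions. -/
inductive WordExpr
  | const (k : ℕ)
  | var (x : ℕ)
  | arr (a : ℕ) (i : WordExpr)
  | op (o : Op) (e f : WordExpr)

def WordExpr.val (s : State) : WordExpr → ℕ
  | .const k => k
  | .var x => s.var x
  | .arr a i => s.arr a (i.val s)
  | .op o e f => o.app (e.val s) (f.val s)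

def WordExpr.cost : WordExpr → ℕ
  | .const _ => 1
  | .var _ => 1
  | .arr _ i => i.cost + 1
  | .op _ e f => e.cost + f.cost + 1

/-- All values that occur in the evaluation of the expression are `b`-bit words. -/
def WordExpr.Fits (b : ℕ) (s : State) : WordExpr → Prop
  | .const k => k < 2 ^ b
  | .var x => s.var x < 2 ^ b
  | .arr a i => i.Fits b s ∧ s.arr a (i.val s) < 2 ^ b
  | .op o e f => e.Fits b s ∧ f.Fits b s ∧ o.app (e.val s) (f.val s) < 2 ^ b

/-- Weight expressions. -/
inductive WtExpr
  | cell (a : ℕ) (i : WordExpr)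
  | add (e f : WtExpr)

def WtExpr.val (s : State) : WtExpr → ℝ
  | .cell a i => s.wt a (i.val s)
  | .add e f => e.val s + f.val s

def WtExpr.cost : WtExpr → ℕ
  | .cell _ i => i.cost + 1
  | .add e f => e.cost + f.cost + 1

def WtExpr.Fits (b : ℕ) (s : State) : WtExpr → Prop
  | .cell _ i => i.Fits b s
  | .add e f => e.Fits b s ∧ f.Fits b s

/-- Tests. -/
inductive Test
  | le (e f : WordExpr)
  | wtLe (e f : WtExpr)
  | not (p : Test)
  | and (p q : Test)

def Test.Holds (s : State) : Test → Prop
  | .le e f => e.val s ≤ f.val s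
  | .wtLe e f => e.val s ≤ f.val s
  | .not p => ¬ p.Holds s
  | .and p q => p.Holds s ∧ q.Holds s

def Test.cost : Test → ℕ
  | .le e f => e.cost + f.cost + 1
  | .wtLe e f => e.cost + f.cost + 1
  | .not p => p.cost + 1
  | .and p q => p.cost + q.cost + 1

def Test.Fits (b : ℕ) (s : State) : Test → Prop
  | .le e f => e.Fits b s ∧ f.Fits b s
  | .wtLe e f => e.Fits b s ∧ f.Fits b s
  | .not p => p.Fits b s
  | .and p q => p.Fits b s ∧ q.Fits b s

/-- Commands. -/
inductive Cmd
  | skip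
  | setVar (x : ℕ) (e : WordExpr)
  | setArr (a : ℕ) (i e : WordExpr)
  | setWt (a : ℕ) (i : WordExpr) (e : WtExpr)
  | seq (c d : Cmd)
  | ite (p : Test) (c d : Cmd)
  | loop (p : Test) (c : Cmd)

/-- Assignment to a word variable. -/
def State.putVar (s : State) (x v : ℕ) : State :=
  { s with var := Function.update s.var x v }

/-- Assignment to a cell of a word array. -/
def State.putArr (s : State) (a i v : ℕ) : State :=
  { s with arr := Function.update s.arr a (Function.update (s.arr a) i v) }

/-- Assignment to a cell of a weight array. -/
noncomputable def State.putWt (s : State) (a i : ℕ) (v : ℝ) : State :=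
  { s with wt := Function.update s.wt a (Function.update (s.wt a) i v) }

/-- `Run b c s t s'`: with `b`-bit words, the command `c`, started in the memory state `s`, halts
after `t` time units in the state `s'`. There is no rule for a value that is not a `b`-bit word, so
a computation in which one occurs does not halt in this sense. -/
inductive Run (b : ℕ) : Cmd → State → ℕ → State → Prop
  | skip (s : State) : Run b .skip s 1 s
  | setVar (s : State) (x : ℕ) (e : WordExpr) (he : e.Fits b s) :
      Run b (.setVar x e) s (e.cost + 1) (s.putVar x (e.val s))
  | setArr (s : State) (a : ℕ) (i e : WordExpr) (hi : i.Fits b s) (he : e.Fits b s) :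
      Run b (.setArr a i e) s (i.cost + e.cost + 1) (s.putArr a (i.val s) (e.val s))
  | setWt (s : State) (a : ℕ) (i : WordExpr) (e : WtExpr) (hi : i.Fits b s) (he : e.Fits b s) :
      Run b (.setWt a i e) s (i.cost + e.cost + 1) (s.putWt a (i.val s) (e.val s))
  | seq {c d : Cmd} {s s' s'' : State} {t t' : ℕ}
      (h : Run b c s t s') (h' : Run b d s' t' s'') :
      Run b (.seq c d) s (t + t' + 1) s''
  | iteTrue {p : Test} {c d : Cmd} {s s' : State} {t : ℕ} (hf : p.Fits b s) (hp : p.Holds s)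
      (h : Run b c s t s') :
      Run b (.ite p c d) s (p.cost + t + 1) s'
  | iteFalse {p : Test} {c d : Cmd} {s s' : State} {t : ℕ} (hf : p.Fits b s) (hp : ¬ p.Holds s)
      (h : Run b d s t s') :
      Run b (.ite p c d) s (p.cost + t + 1) s'
  | loopDone {p : Test} {c : Cmd} {s : State} (hf : p.Fits b s) (hp : ¬ p.Holds s) :
      Run b (.loop p c) s (p.cost + 1) s
  | loopStep {p : Test} {c : Cmd} {s s' s'' : State} {t t' : ℕ} (hf : p.Fits b s) (hp : p.Holds s)
      (h : Run b c s t s') (h' : Run b (.loop p c) s' t' s'') :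
      Run b (.loop p c) s (p.cost + t + t' + 1) s''

/-! ### Input and output -/

/-- The input: variable `0` holds `n`, and weight array `0` holds the weights in its cells
`0, …, n - 1`. All other memory is zero. -/
noncomputable def inputState {n : ℕ} (w : Fin n → ℝ) : State where
  var := fun x => if x = 0 then n else 0
  arr := fun _ _ => 0
  wt := fun a i => if h : a = 0 ∧ i < n then w ⟨i, h.2⟩ else 0

/-- The memory stores the tree `T` as a linked structure: different nodes have different nonzero
addresses, the address of the root is in variable `0`, and the cell of word array `0` (of
word array `1`) at the address of a node holds the address of the left (right) child of this
node, or zero if there is none. -/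
def StoresTree (s : State) (T : Set (List Bool)) : Prop :=
  ∃ addr : List Bool → ℕ,
    Set.InjOn addr T ∧ (∀ v ∈ T, addr v ≠ 0) ∧ [] ∈ T ∧ s.var 0 = addr [] ∧
    ∀ v ∈ T, ∀ x : Bool,
      (v ++ [x] ∈ T → s.arr x.toNat (addr v) = addr (v ++ [x])) ∧
      (v ++ [x] ∉ T → s.arr x.toNat (addr v) = 0)

/-- The memory stores the code `c`: cell `i` of word array `2` holds the length of the codeword of
the symbol `i` (which is at most `n`), and the cells `i n, i n + 1, …` of word array `3` hold the
bits of this codeword. -/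
def StoresCode {n : ℕ} (s : State) (c : Fin n → List Bool) : Prop :=
  ∀ i : Fin n, s.arr 2 i = (c i).length ∧ (c i).length ≤ n ∧
    ∀ (j : ℕ) (hj : j < (c i).length), s.arr 3 (i * n + j) = ((c i)[j]).toNat

end OptSkeleton

/-! ### A program logic for the word RAM -/

namespace OptSkeleton

/-! A node with a single child can be contracted, so optimal codes have full trees. The leaves of
the skeleton of a full tree are its maximal perfect subtrees, and a full tree with `k` leaves has
`2k - 1` nodes (`skeleton_nodes`, `ncard_nodes`). Hence the pair of the cost and the number of
maximal perfect subtrees has to be minimized lexicographically.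

The cost is the sum, over all levels `d`, of the weights of the symbols whose codewords are longer
than `d`. If `x` symbols lie below a level, its contribution is at least the sum `W x` of the `x`
smallest weights, with equality if small weights get long codewords. So only the state `(x, N)` of a
level matters: `x` symbols are left and `N` nodes are available. A `Plan` either descends, which
doubles `N` and costs `W x`, or uses `2 ^ β` nodes of the level as the leaves of one perfect
subtree, which counts one. Every full code yields a plan that is not more expensive and has as many
blocks as the tree has maximal perfect subtrees (`exists_plan`). The optimal plans for all `N ≤ x ≤
n` follow by dynamic programming: there are `O(n²)` states with `O(log n)` choices each
(`TableOk.write`, `tableProg_halts`). All other phases take quadratic time.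

Conversely, a block of `2 ^ β` leaves at depth `d` has its root at depth `d - β`. Plans preserve the
Kraft sum, so the depths of the roots satisfy Kraft's equality, and a full tree with leaves at these
depths can be grown breadth first (`Reached`, `TreeInv`). Hanging perfect trees below its leaves
gives a code with the cost of the plan. Blocks could merge into larger perfect subtrees, but then
the new tree would yield a plan with fewer blocks and no larger cost. So for an optimal plan the
grown tree is exactly the skeleton (`skel_expand`, `inducesOptimalSkeleton`).

On the machine side, `Halts` combines termination, time, a bound `V` on the memory contents and the
set of modified locations. With `V = 4 (n + 1) ^ 2` and expressions of bounded size, all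
intermediate values are polynomial in `n` and fit into words of `O(log n)` bits. -/

theorem State.var_putVar (s : State) (x v y : ℕ) :
    (s.putVar x v).var y = if y = x then v else s.var y := by
  simp [State.putVar, Function.update_apply]

theorem State.arr_putVar (s : State) (x v : ℕ) : (s.putVar x v).arr = s.arr := rfl

theorem State.wt_putVar (s : State) (x v : ℕ) : (s.putVar x v).wt = s.wt := rfl

theorem State.var_putArr (s : State) (a i v : ℕ) : (s.putArr a i v).var = s.var := rfl

theorem State.arr_putArr (s : State) (a i v a' : ℕ) :
    (s.putArr a i v).arr a' = if a' = a then Function.update (s.arr a) i v else s.arr a' := by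
  simp [State.putArr, Function.update_apply]

theorem State.wt_putArr (s : State) (a i v : ℕ) : (s.putArr a i v).wt = s.wt := rfl

theorem State.var_putWt (s : State) (a i : ℕ) (v : ℝ) : (s.putWt a i v).var = s.var := rfl

theorem State.arr_putWt (s : State) (a i : ℕ) (v : ℝ) : (s.putWt a i v).arr = s.arr := rfl

theorem State.wt_putWt (s : State) (a i : ℕ) (v : ℝ) (a' : ℕ) :
    (s.putWt a i v).wt a' = if a' = a then Function.update (s.wt a) i v else s.wt a' := by
  simp [State.putWt, Function.update_apply]

/-- All words in memory are at most `V`. -/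
def State.Bounded (V : ℕ) (s : State) : Prop :=
  (∀ x, s.var x ≤ V) ∧ ∀ a i, s.arr a i ≤ V

theorem State.Bounded.putVar {V : ℕ} {s : State} (h : s.Bounded V) {x v : ℕ} (hv : v ≤ V) :
    (s.putVar x v).Bounded V := by
  refine ⟨fun y => ?_, h.2⟩
  rw [State.var_putVar]
  split_ifs
  exacts [hv, h.1 y]

theorem State.Bounded.putArr {V : ℕ} {s : State} (h : s.Bounded V) {a i v : ℕ} (hv : v ≤ V) :
    (s.putArr a i v).Bounded V := by
  refine ⟨h.1, fun a' j => ?_⟩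
  rw [State.arr_putArr]
  split_ifs
  · rw [Function.update_apply]
    split_ifs
    exacts [hv, h.2 a j]
  · exact h.2 a' j

/-- A bound on the costs of the expressions and tests of a program. -/
abbrev exprBound : ℕ := 40

/-- The constants in the expression are at most `2`. -/
def WordExpr.small : WordExpr → Bool
  | .const k => k ≤ 2
  | .var _ => true
  | .arr _ i => i.small
  | .op _ e f => e.small && f.small

def WtExpr.small : WtExpr → Bool
  | .cell _ i => i.small
  | .add e f => e.small && f.small

def Test.small : Test → Bool
  | .le e f => e.small && f.small
  | .wtLe e f => e.small && f.small
  | .not p => p.small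
  | .and p q => p.small && q.small

/-- All constants in the program are at most `2`, and the cost of every expression and test is
below `exprBound`. -/
def Cmd.small : Cmd → Bool
  | .skip => true
  | .setVar _ e => e.small && e.cost + 1 ≤ exprBound
  | .setArr _ i e => i.small && e.small && i.cost + e.cost + 1 ≤ exprBound
  | .setWt _ i e => i.small && e.small && i.cost + e.cost + 1 ≤ exprBound
  | .seq c d => c.small && d.small
  | .ite p c d => p.small && p.cost + 1 ≤ exprBound && c.small && d.small
  | .loop p c => p.small && p.cost + 1 ≤ exprBound && c.small

/-- Each operation at most multiplies the bounds of its operands, up to one more factor `V + 2`: a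
sum `a + b` with `a, b ≥ 1` is at most `a * b * (V + 2)`. -/
theorem WordExpr.val_le {V : ℕ} {s : State} (hs : s.Bounded V) :
    ∀ e : WordExpr, e.small → e.val s ≤ (V + 2) ^ e.cost
  | .const k, h => by
    simp only [WordExpr.small, decide_eq_true_eq] at h
    simp only [WordExpr.val, WordExpr.cost, pow_one]
    omega
  | .var x, _ => by
    simp only [WordExpr.val, WordExpr.cost, pow_one]
    have := hs.1 x
    omega
  | .arr a i, _ => by
    simp only [WordExpr.val, WordExpr.cost]
    have h1 := hs.2 a (i.val s)
    have h2 : V + 2 ≤ (V + 2) ^ (i.cost + 1) := Nat.le_self_pow (by omega) _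
    omega
  | .op o e f, h => by
    simp only [WordExpr.small, Bool.and_eq_true] at h
    have he := WordExpr.val_le hs e h.1
    have hf := WordExpr.val_le hs f h.2
    simp only [WordExpr.val, WordExpr.cost]
    have e1 : 1 ≤ (V + 2) ^ e.cost := Nat.one_le_pow _ _ (by omega)
    have f1 : 1 ≤ (V + 2) ^ f.cost := Nat.one_le_pow _ _ (by omega)
    have key : (V + 2) ^ e.cost + (V + 2) ^ f.cost ≤ (V + 2) ^ (e.cost + f.cost + 1) := by
      rw [pow_succ, pow_add]
      generalize (V + 2) ^ e.cost = a at *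
      generalize (V + 2) ^ f.cost = b at *
      have h1 : a ≤ a * b := Nat.le_mul_of_pos_right _ f1
      have h2 : b ≤ a * b := Nat.le_mul_of_pos_left _ e1
      nlinarith [Nat.zero_le (a * b * V)]
    have key2 : e.val s * f.val s ≤ (V + 2) ^ (e.cost + f.cost + 1) := by
      calc e.val s * f.val s ≤ (V + 2) ^ e.cost * (V + 2) ^ f.cost := Nat.mul_le_mul he hf
        _ = (V + 2) ^ (e.cost + f.cost) := (pow_add _ _ _).symm
        _ ≤ _ := Nat.pow_le_pow_right (by omega) (by omega)
    cases o <;> simp only [Op.app]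
    · omega
    · omega
    · exact key2
    · have := Nat.div_le_self (e.val s) (f.val s)
      omega

/-- This reduces the absence of overflow to two facts: the stored words stay at most `V`, and the
program text passes the decidable check `Cmd.small`. -/
theorem WordExpr.fits {V b : ℕ} {s : State} (hb : (V + 2) ^ exprBound < 2 ^ b)
    (hs : s.Bounded V) : ∀ e : WordExpr, e.small → e.cost ≤ exprBound → e.Fits b s := by
  have key : ∀ e : WordExpr, e.small → e.cost ≤ exprBound → e.val s < 2 ^ b := fun e h hc =>
    ((e.val_le hs h).trans (Nat.pow_le_pow_right (by omega) hc)).trans_lt hb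
  intro e
  induction e with
  | const k => exact fun h hc => key (.const k) h hc
  | var x => exact fun h hc => key (.var x) h hc
  | arr a i ih =>
    intro h hc
    refine ⟨ih h ?_, key (.arr a i) h hc⟩
    simp only [WordExpr.cost] at hc
    omega
  | op o e f ihe ihf =>
    intro h hc
    have h' := h
    simp only [WordExpr.small, Bool.and_eq_true] at h'
    have hc' := hc
    simp only [WordExpr.cost] at hc'
    exact ⟨ihe h'.1 (by omega), ihf h'.2 (by omega), key (.op o e f) h hc⟩

theorem WtExpr.fits {V b : ℕ} {s : State} (hb : (V + 2) ^ exprBound < 2 ^ b)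
    (hs : s.Bounded V) : ∀ e : WtExpr, e.small → e.cost ≤ exprBound → e.Fits b s := by
  intro e
  induction e with
  | cell a i =>
    intro h hc
    simp only [WtExpr.cost] at hc
    exact i.fits hb hs h (by omega)
  | add e f ihe ihf =>
    intro h hc
    simp only [WtExpr.small, Bool.and_eq_true] at h
    simp only [WtExpr.cost] at hc
    exact ⟨ihe h.1 (by omega), ihf h.2 (by omega)⟩

theorem Test.fits {V b : ℕ} {s : State} (hb : (V + 2) ^ exprBound < 2 ^ b)
    (hs : s.Bounded V) : ∀ p : Test, p.small → p.cost ≤ exprBound → p.Fits b s := by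
  intro p
  induction p with
  | le e f =>
    intro h hc
    simp only [Test.small, Bool.and_eq_true] at h
    simp only [Test.cost] at hc
    exact ⟨e.fits hb hs h.1 (by omega), f.fits hb hs h.2 (by omega)⟩
  | wtLe e f =>
    intro h hc
    simp only [Test.small, Bool.and_eq_true] at h
    simp only [Test.cost] at hc
    exact ⟨e.fits hb hs h.1 (by omega), f.fits hb hs h.2 (by omega)⟩
  | not p ih =>
    intro h hc
    simp only [Test.cost] at hc
    exact ih h (by omega)
  | and p q ihp ihq =>
    intro h hc
    simp only [Test.small, Bool.and_eq_true] at h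
    simp only [Test.cost] at hc
    exact ⟨ihp h.1 (by omega), ihq h.2 (by omega)⟩

/-- The word variables that the program writes. -/
def Cmd.vars : Cmd → List ℕ
  | .setVar x _ => [x]
  | .seq c d => c.vars ++ d.vars
  | .ite _ c d => c.vars ++ d.vars
  | .loop _ c => c.vars
  | _ => []

/-- The word arrays that the program writes. -/
def Cmd.arrs : Cmd → List ℕ
  | .setArr a _ _ => [a]
  | .seq c d => c.arrs ++ d.arrs
  | .ite _ c d => c.arrs ++ d.arrs
  | .loop _ c => c.arrs
  | _ => []

/-- The weight arrays that the program writes. -/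
def Cmd.wts : Cmd → List ℕ
  | .setWt a _ _ => [a]
  | .seq c d => c.wts ++ d.wts
  | .ite _ c d => c.wts ++ d.wts
  | .loop _ c => c.wts
  | _ => []

/-- The states `s` and `s'` differ only in what `c` writes. -/
structure Frame (c : Cmd) (s s' : State) : Prop where
  var : ∀ x, x ∉ c.vars → s'.var x = s.var x
  arr : ∀ a, a ∉ c.arrs → s'.arr a = s.arr a
  wt : ∀ a, a ∉ c.wts → s'.wt a = s.wt a

theorem Frame.refl (c : Cmd) (s : State) : Frame c s s :=
  ⟨fun _ _ => rfl, fun _ _ => rfl, fun _ _ => rfl⟩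

theorem Frame.trans {c d e : Cmd} {s s' s'' : State} (h : Frame c s s') (h' : Frame d s' s'')
    (hv : ∀ x, x ∈ c.vars ∨ x ∈ d.vars → x ∈ e.vars)
    (ha : ∀ x, x ∈ c.arrs ∨ x ∈ d.arrs → x ∈ e.arrs)
    (hw : ∀ x, x ∈ c.wts ∨ x ∈ d.wts → x ∈ e.wts) : Frame e s s'' := by
  refine ⟨fun x hx => ?_, fun x hx => ?_, fun x hx => ?_⟩
  · rw [h'.var x fun hd => hx (hv x (.inr hd)), h.var x fun hd => hx (hv x (.inl hd))]
  · rw [h'.arr x fun hd => hx (ha x (.inr hd)), h.arr x fun hd => hx (ha x (.inl hd))]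
  · rw [h'.wt x fun hd => hx (hw x (.inr hd)), h.wt x fun hd => hx (hw x (.inl hd))]

/-- Total correctness: with `b`-bit words and all memory contents bounded by `V`, the program `c`
started in `s` halts after at most `t` steps (of at most `exprBound` time units each) in a state
that satisfies `Q`. -/
def Halts (b V : ℕ) (c : Cmd) (s : State) (t : ℕ) (Q : State → Prop) : Prop :=
  (V + 2) ^ exprBound < 2 ^ b → c.small → s.Bounded V →
    ∃ t' s', Run b c s t' s' ∧ t' ≤ exprBound * t ∧ s'.Bounded V ∧ Frame c s s' ∧ Q s'

/-! ### Proof rules for total correctness with time bounds -/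

variable {b V : ℕ}

theorem Halts.mono {c : Cmd} {s : State} {t t' : ℕ} {Q Q' : State → Prop}
    (h : Halts b V c s t Q) (ht : t ≤ t') (hQ : ∀ s', Frame c s s' → Q s' → Q' s') :
    Halts b V c s t' Q' := by
  intro hb hc hs
  obtain ⟨u, s', hr, hu, hs', hf, hq⟩ := h hb hc hs
  exact ⟨u, s', hr, hu.trans (Nat.mul_le_mul_left _ ht), hs', hf, hQ s' hf hq⟩

/-- Makes the memory bound, which is a premise inside `Halts`, available for checking that newly
assigned values stay bounded. -/
theorem Halts.of_bounded {c : Cmd} {s : State} {t : ℕ} {Q : State → Prop}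
    (h : s.Bounded V → Halts b V c s t Q) : Halts b V c s t Q :=
  fun hb hc hs => h hs hb hc hs

theorem Halts.seq {c d : Cmd} {s : State} {t t' : ℕ} {Q R : State → Prop}
    (h : Halts b V c s t R) (h' : ∀ s', Frame c s s' → R s' → Halts b V d s' t' Q) :
    Halts b V (.seq c d) s (t + t' + 1) Q := by
  intro hb hc hs
  simp only [Cmd.small, Bool.and_eq_true] at hc
  obtain ⟨u, s', hr, hu, hs', hf, hq⟩ := h hb hc.1 hs
  obtain ⟨u', s'', hr', hu', hs'', hf', hq'⟩ := h' s' hf hq hb hc.2 hs'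
  refine ⟨_, s'', .seq hr hr', by simp only [exprBound] at *; omega, hs'', hf.trans hf' ?_ ?_ ?_, hq'⟩ <;>
    simp [Cmd.vars, Cmd.arrs, Cmd.wts]

theorem Halts.ite {p : Test} {c d : Cmd} {s : State} {t : ℕ} {Q : State → Prop}
    (h : p.Holds s → Halts b V c s t Q) (h' : ¬ p.Holds s → Halts b V d s t Q) :
    Halts b V (.ite p c d) s (t + 1) Q := by
  intro hb hc hs
  simp only [Cmd.small, Bool.and_eq_true, decide_eq_true_eq] at hc
  have hfit := p.fits hb hs hc.1.1.1 (by have := hc.1.1.2; omega)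
  have hcost := hc.1.1.2
  by_cases hp : p.Holds s
  · obtain ⟨u, s', hr, hu, hs', hf, hq⟩ := h hp hb hc.1.2 hs
    refine ⟨_, s', .iteTrue hfit hp hr, by simp only [exprBound] at *; omega, hs',
      (Frame.refl d s).trans hf ?_ ?_ ?_, hq⟩ <;>
      simp [Cmd.vars, Cmd.arrs, Cmd.wts, or_comm]
  · obtain ⟨u, s', hr, hu, hs', hf, hq⟩ := h' hp hb hc.2 hs
    refine ⟨_, s', .iteFalse hfit hp hr, by simp only [exprBound] at *; omega, hs',
      (Frame.refl c s).trans hf ?_ ?_ ?_, hq⟩ <;>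
      simp [Cmd.vars, Cmd.arrs, Cmd.wts]

/-- The size of a program, which bounds the number of steps of a loop-free program. -/
def Cmd.size : Cmd → ℕ
  | .seq c d => c.size + d.size + 1
  | .ite _ c d => max c.size d.size + 1
  | .loop _ c => c.size
  | _ => 1

/-- The weakest precondition of a loop-free program. -/
def Cmd.wp (V : ℕ) : Cmd → State → (State → Prop) → Prop
  | .skip, s, Q => Q s
  | .setVar x e, s, Q => e.val s ≤ V ∧ Q (s.putVar x (e.val s))
  | .setArr a i e, s, Q => e.val s ≤ V ∧ Q (s.putArr a (i.val s) (e.val s))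
  | .setWt a i e, s, Q => Q (s.putWt a (i.val s) (e.val s))
  | .seq c d, s, Q => c.wp V s fun s' => d.wp V s' Q
  | .ite p c d, s, Q => (p.Holds s → c.wp V s Q) ∧ (¬ p.Holds s → d.wp V s Q)
  | .loop _ _, _, _ => False

theorem Halts.of_wp {c : Cmd} {s : State} {Q : State → Prop} (h : c.wp V s Q) :
    Halts b V c s c.size Q := by
  induction c generalizing s Q with
  | skip =>
    intro _ _ hs
    exact ⟨_, _, .skip s, by simp [Cmd.size], hs, Frame.refl _ _, h⟩
  | setVar x e =>
    intro hb hc hs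
    simp only [Cmd.small, Bool.and_eq_true, decide_eq_true_eq] at hc
    refine ⟨_, _, .setVar s x e (e.fits hb hs hc.1 (by omega)), by simp [Cmd.size]; omega,
      hs.putVar h.1, ⟨fun y hy => ?_, fun _ _ => rfl, fun _ _ => rfl⟩, h.2⟩
    simp only [Cmd.vars, List.mem_singleton] at hy
    simp [State.var_putVar, hy]
  | setArr a i e =>
    intro hb hc hs
    simp only [Cmd.small, Bool.and_eq_true, decide_eq_true_eq] at hc
    refine ⟨_, _, .setArr s a i e (i.fits hb hs hc.1.1 (by omega)) (e.fits hb hs hc.1.2 (by omega)),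
      by simp [Cmd.size]; omega, hs.putArr h.1, ⟨fun _ _ => rfl, fun y hy => ?_, fun _ _ => rfl⟩, h.2⟩
    simp only [Cmd.arrs, List.mem_singleton] at hy
    simp [State.arr_putArr, hy]
  | setWt a i e =>
    intro hb hc hs
    simp only [Cmd.small, Bool.and_eq_true, decide_eq_true_eq] at hc
    refine ⟨_, _, .setWt s a i e (i.fits hb hs hc.1.1 (by omega)) (e.fits hb hs hc.1.2 (by omega)),
      by simp [Cmd.size]; omega, hs, ⟨fun _ _ => rfl, fun _ _ => rfl, fun y hy => ?_⟩, h⟩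
    simp only [Cmd.wts, List.mem_singleton] at hy
    simp [State.wt_putWt, hy]
  | seq c d ihc ihd => exact (ihc h).seq fun s' _ hs' => ihd hs'
  | ite p c d ihc ihd =>
    exact Halts.ite (fun hp => (ihc (h.1 hp)).mono (le_max_left _ _) fun _ _ hq => hq)
      (fun hp => (ihd (h.2 hp)).mono (le_max_right _ _) fun _ _ hq => hq)
  | loop p c => exact h.elim

/-- The invariant carries a number `m` that decreases in every pass and thus bounds both the number
of passes and the time. The frame relative to the initial state `s₀` is kept along, so invariants
need not mention unmodified memory. -/
theorem Halts.loop {p : Test} {c : Cmd} {s₀ : State} {τ : ℕ} {Q : State → Prop}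
    (I : ℕ → State → Prop) {m : ℕ} (h0 : I m s₀)
    (hstep : ∀ m s, Frame c s₀ s → I m s → p.Holds s →
      ∃ m' < m, Halts b V c s τ (I m'))
    (hdone : ∀ m s, Frame c s₀ s → I m s → ¬ p.Holds s → Q s) :
    Halts b V (.loop p c) s₀ (m * (τ + 1) + 1) Q := by
  suffices H : ∀ m s, Frame c s₀ s → I m s →
      Halts b V (.loop p c) s (m * (τ + 1) + 1) Q from H m s₀ (Frame.refl _ _) h0
  intro m
  induction m using Nat.strong_induction_on with
  | _ m ih =>
    intro s hf hI hb hc hs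
    have hc' := hc
    simp only [Cmd.small, Bool.and_eq_true, decide_eq_true_eq] at hc'
    have hfit := p.fits hb hs hc'.1.1 (by have := hc'.1.2; omega)
    have hcost := hc'.1.2
    by_cases hp : p.Holds s
    · obtain ⟨m', hm, hT⟩ := hstep m s hf hI hp
      obtain ⟨u, s', hr, hu, hs', hf', hq⟩ := hT hb hc'.2 hs
      obtain ⟨u', s'', hr', hu', hs'', hf'', hq'⟩ := ih m' hm s'
        (hf.trans hf' (by simp) (by simp) (by simp)) hq hb hc hs'
      refine ⟨_, s'', .loopStep hfit hp hr hr', ?_, hs'', hf'.trans hf'' ?_ ?_ ?_, hq'⟩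
      · have : (m' + 1) * (τ + 1) ≤ m * (τ + 1) := Nat.mul_le_mul_right _ hm
        simp only [exprBound] at *
        nlinarith
      all_goals simp [Cmd.vars, Cmd.arrs, Cmd.wts]
    · refine ⟨_, s, .loopDone hfit hp, ?_, hs, Frame.refl _ _, hdone m s hf hI hp⟩
      simp only [exprBound] at *
      nlinarith [Nat.zero_le (m * (τ + 1))]

/-- The test `e < f`. -/
def Test.lt (e f : WordExpr) : Test := .not (.le f e)

theorem Test.holds_lt {e f : WordExpr} {s : State} : (Test.lt e f).Holds s ↔ e.val s < f.val s := by
  simp [Test.lt, Test.Holds]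

/-- `for x := 0 to y - 1 do c`. -/
def Cmd.forVar (x y : ℕ) (c : Cmd) : Cmd :=
  .seq (.setVar x (.const 0)) (.loop (.lt (.var x) (.var y))
    (.seq c (.setVar x (.op .add (.var x) (.const 1)))))

/-- The body must establish the invariant for the state after the increment, hence the `putVar` in
its postcondition. One pass costs `τ` for the body and `3` for the increment, the sequencing and the
test. -/
theorem Halts.forVar {x y : ℕ} {c : Cmd} {s : State} {τ : ℕ} {Q : State → Prop}
    (I : ℕ → State → Prop) (hx : x ∉ c.vars) (hy : y ∉ c.vars) (hxy : y ≠ x)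
    (h0 : I 0 (s.putVar x 0))
    (hstep : ∀ i < s.var y, ∀ s', Frame (.forVar x y c) s s' → s'.var x = i → s'.var y = s.var y →
      I i s' → Halts b V c s' τ fun s'' => I (i + 1) (s''.putVar x (i + 1)))
    (hQ : ∀ s', Frame (.forVar x y c) s s' → s'.var x = s.var y → s'.var y = s.var y →
      I (s.var y) s' → Q s') :
    Halts b V (.forVar x y c) s (s.var y * (τ + 3) + 3) Q := by
  apply Halts.of_bounded
  intro hs
  have key : Halts b V (.setVar x (.const 0)) s 1 fun s' => s' = s.putVar x 0 :=
    Halts.of_wp ⟨by simp [WordExpr.val], by simp [WordExpr.val]⟩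
  refine (key.seq (t' := s.var y * (τ + 3) + 1) ?_).mono (by omega) (fun _ _ h => h)
  rintro s' hfr rfl
  have hy0 : (s.putVar x 0).var y = s.var y := by simp [State.var_putVar, hxy]
  have frm : ∀ s', Frame (.seq c (.setVar x (.op .add (.var x) (.const 1)))) (s.putVar x 0) s' →
      Frame (.forVar x y c) s s' := fun s' h =>
    hfr.trans h (by simp [Cmd.forVar, Cmd.vars]) (by simp [Cmd.forVar, Cmd.arrs])
      (by simp [Cmd.forVar, Cmd.wts])
  have fry : ∀ s', Frame (.seq c (.setVar x (.op .add (.var x) (.const 1)))) (s.putVar x 0) s' →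
      s'.var y = s.var y := fun s' h => by
    rw [h.var y (by simp [Cmd.vars, hy, hxy]), hy0]
  refine Halts.mono (Halts.loop (τ := τ + 2) (m := s.var y) (Q := Q)
    (fun m s' => m + s'.var x = s.var y ∧ I (s'.var x) s') ?_ ?_ ?_) le_rfl
    (fun _ _ h => h)
  · simp [State.var_putVar, h0]
  · rintro m s' hf ⟨hm, hI⟩ hp
    rw [Test.holds_lt] at hp
    simp only [WordExpr.val, fry s' hf] at hp
    refine ⟨m - 1, by omega, ?_⟩
    refine (hstep (s'.var x) hp s' (frm s' hf) rfl (fry s' hf) hI).seq (t' := 1) ?_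
    intro s'' hf' hI'
    have hxx : s''.var x = s'.var x := hf'.var x hx
    have := hs.1 y
    refine Halts.of_wp ⟨?_, ?_⟩
    · simp only [WordExpr.val, Op.app, hxx]
      omega
    · simp only [WordExpr.val, Op.app, hxx, State.var_putVar, if_true]
      exact ⟨by omega, hI'⟩
  · rintro m s' hf ⟨hm, hI⟩ hp
    rw [Test.holds_lt] at hp
    simp only [WordExpr.val, fry s' hf] at hp
    have : s'.var x = s.var y := by omega
    exact hQ s' (frm s' hf) this (fry s' hf) (this ▸ hI)

end OptSkeleton

/-! ### Full binary trees and their skeletons -/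

namespace OptSkeleton

/-- Full binary trees. -/
inductive FullTree
  | leaf
  | node (l r : FullTree)

namespace FullTree

/-- The set of leaves. -/
def leaves : FullTree → Finset (List Bool)
  | leaf => {[]}
  | node l r => (l.leaves.map ⟨List.cons false, List.cons_injective⟩) ∪
      (r.leaves.map ⟨List.cons true, List.cons_injective⟩)

/-- The child on the side `x` is `sub l r x`. -/
def sub (l r : FullTree) (x : Bool) : FullTree := cond x r l

@[simp] theorem mem_leaves_leaf {v : List Bool} : v ∈ leaf.leaves ↔ v = [] := by simp [leaves]

@[simp] theorem nil_notMem_leaves_node {l r : FullTree} : [] ∉ (node l r).leaves := by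
  simp [leaves]

@[simp] theorem cons_mem_leaves_node {l r : FullTree} {x : Bool} {v : List Bool} :
    x :: v ∈ (node l r).leaves ↔ v ∈ (sub l r x).leaves := by
  cases x <;> simp [leaves, sub]

theorem leaves_nonempty : ∀ t : FullTree, t.leaves.Nonempty
  | leaf => ⟨[], by simp⟩
  | node l _ => by
    obtain ⟨v, hv⟩ := leaves_nonempty l
    exact ⟨false :: v, by simpa [sub] using hv⟩

theorem eq_of_prefix {t : FullTree} : ∀ {u v : List Bool}, u ∈ t.leaves → v ∈ t.leaves →
    u <+: v → u = v := by
  induction t with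
  | leaf => simp
  | node l r ihl ihr =>
    intro u v hu hv h
    obtain _ | ⟨x, u⟩ := u
    · simp at hu
    obtain _ | ⟨y, v⟩ := v
    · simp at hv
    rw [List.cons_prefix_cons] at h
    obtain ⟨rfl, h⟩ := h
    rw [cons_mem_leaves_node] at hu hv
    rw [show u = v from by cases x <;> [exact ihl hu hv h; exact ihr hu hv h]]

/-- The set of nodes. -/
def nodes (t : FullTree) : Set (List Bool) := {v | ∃ u ∈ t.leaves, v <+: u}

@[simp] theorem nil_mem_nodes (t : FullTree) : [] ∈ t.nodes := by
  obtain ⟨v, hv⟩ := t.leaves_nonempty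
  exact ⟨v, hv, List.nil_prefix⟩

@[simp] theorem cons_notMem_nodes_leaf {x : Bool} {v : List Bool} : x :: v ∉ leaf.nodes := by
  simp [nodes]

@[simp] theorem cons_mem_nodes_node {l r : FullTree} {x : Bool} {v : List Bool} :
    x :: v ∈ (node l r).nodes ↔ v ∈ (sub l r x).nodes := by
  constructor
  · rintro ⟨u, hu, h⟩
    obtain _ | ⟨y, u⟩ := u
    · simp at hu
    rw [List.cons_prefix_cons] at h
    obtain ⟨rfl, h⟩ := h
    exact ⟨u, by simpa using hu, h⟩
  · rintro ⟨u, hu, h⟩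
    exact ⟨x :: u, by simpa using hu, by simpa using h⟩

theorem nodes_leaf : leaf.nodes = {[]} := by
  ext v
  cases v <;> simp

theorem nodes_node (l r : FullTree) :
    (node l r).nodes = insert [] (List.cons false '' l.nodes ∪ List.cons true '' r.nodes) := by
  ext v
  obtain _ | ⟨x, v⟩ := v
  · simp
  · cases x <;> simp [sub]

theorem finite_nodes : ∀ t : FullTree, t.nodes.Finite
  | leaf => by simp [nodes_leaf]
  | node l r => by
    rw [nodes_node]
    exact (((finite_nodes l).image _).union ((finite_nodes r).image _)).insert _

theorem card_leaves_node (l r : FullTree) :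
    (node l r).leaves.card = l.leaves.card + r.leaves.card := by
  rw [leaves, Finset.card_union_of_disjoint, Finset.card_map, Finset.card_map]
  rw [Finset.disjoint_left]
  intro v
  obtain _ | ⟨x, v⟩ := v <;> simp
  rintro - rfl
  simp

theorem ncard_nodes : ∀ t : FullTree, t.nodes.ncard + 1 = 2 * t.leaves.card
  | leaf => by simp [nodes_leaf, leaves]
  | node l r => by
    rw [nodes_node, Set.ncard_insert_of_notMem (by simp)
      (((finite_nodes l).image _).union ((finite_nodes r).image _)),
      Set.ncard_union_eq _ ((finite_nodes l).image _) ((finite_nodes r).image _),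
      Set.ncard_image_of_injective _ List.cons_injective,
      Set.ncard_image_of_injective _ List.cons_injective, card_leaves_node]
    · have := ncard_nodes l
      have := ncard_nodes r
      omega
    · rw [Set.disjoint_left]
      rintro _ ⟨u, _, rfl⟩ ⟨v, _, h⟩
      simp at h

/-- The perfect tree of height `h`. -/
def perfect : ℕ → FullTree
  | 0 => leaf
  | h + 1 => node (perfect h) (perfect h)

theorem mem_leaves_perfect : ∀ {h : ℕ} {v : List Bool},
    v ∈ (perfect h).leaves ↔ v.length = h
  | 0, v => by simp [perfect]
  | h + 1, v => by
    obtain _ | ⟨x, v⟩ := v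
    · simp [perfect]
    · simp [perfect, ← mem_leaves_perfect (v := v) (h := h), sub]

/-- The tree is perfect. -/
def IsPerfect (t : FullTree) : Prop := ∃ h, t = perfect h

theorem isPerfect_of_length : ∀ {t : FullTree} {h : ℕ}, (∀ v ∈ t.leaves, v.length = h) →
    t = perfect h
  | leaf, h, H => by
    have : h = 0 := by simpa using (H [] (by simp)).symm
    rw [this, perfect]
  | node l r, h, H => by
    obtain _ | h := h
    · obtain ⟨v, hv⟩ := (node l r).leaves_nonempty
      have := H v hv
      rw [List.length_eq_zero_iff] at this
      simp [this] at hv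
    · have hl : l = perfect h := isPerfect_of_length fun v hv => by
        simpa using H (false :: v) (by simpa [sub] using hv)
      have hr : r = perfect h := isPerfect_of_length fun v hv => by
        simpa using H (true :: v) (by simpa [sub] using hv)
      rw [hl, hr, perfect]

open Classical in
/-- The skeleton of a tree. -/
noncomputable def skel : FullTree → FullTree
  | leaf => leaf
  | node l r => if (node l r).IsPerfect then leaf else node l.skel r.skel

/-! ### The skeleton as a recursive operation on full trees -/

theorem isLeaf_nodes {t : FullTree} {v : List Bool} : IsLeaf t.nodes v ↔ v ∈ t.leaves := by
  constructor
  · rintro ⟨⟨u, hu, w, rfl⟩, h⟩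
    obtain _ | ⟨x, w⟩ := w
    · simpa using hu
    · exact absurd ⟨_, hu, w, by simp⟩ (h x)
  · refine fun hv => ⟨⟨v, hv, List.prefix_rfl⟩, ?_⟩
    rintro x ⟨u, hu, h⟩
    have := eq_of_prefix hv hu ((List.prefix_append v [x]).trans h)
    subst this
    have := h.length_le
    simp at this

theorem append_mem_nodes {t : FullTree} (v : List Bool) :
    (∀ x : Bool, v ++ [x] ∈ t.nodes) ∨ (∀ x : Bool, v ++ [x] ∉ t.nodes) := by
  induction t generalizing v with
  | leaf =>
    refine .inr fun x => ?_
    cases v <;> simp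
  | node l r ihl ihr =>
    obtain _ | ⟨y, v⟩ := v
    · simp
    · cases y
      · simpa [sub] using ihl v
      · simpa [sub] using ihr v

/-- In a full tree the condition on the number of children is automatic, and only the equality of
the leaf depths remains. -/
theorem isPerfectAt_iff {t : FullTree} {u : List Bool} : IsPerfectAt t.nodes u ↔
    u ∈ t.nodes ∧ ∀ v v', u ++ v ∈ t.leaves → u ++ v' ∈ t.leaves → v.length = v'.length := by
  constructor
  · rintro ⟨h1, -, h3⟩
    refine ⟨h1, fun v v' hv hv' => ?_⟩
    simpa using h3 _ _ (isLeaf_nodes.2 hv) (isLeaf_nodes.2 hv') (by simp) (by simp)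
  · rintro ⟨h1, h3⟩
    refine ⟨h1, fun v _ _ => append_mem_nodes v, ?_⟩
    rintro _ _ hv hv' ⟨w, rfl⟩ ⟨w', rfl⟩
    simpa using h3 w w' (isLeaf_nodes.1 hv) (isLeaf_nodes.1 hv')

theorem isPerfectAt_nil {t : FullTree} : IsPerfectAt t.nodes [] ↔ t.IsPerfect := by
  rw [isPerfectAt_iff]
  constructor
  · rintro ⟨-, h⟩
    obtain ⟨v, hv⟩ := t.leaves_nonempty
    exact ⟨v.length, isPerfect_of_length fun v' hv' => h v' v hv' hv⟩
  · rintro ⟨h, rfl⟩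
    refine ⟨by simp, fun v v' hv hv' => ?_⟩
    rw [List.nil_append, mem_leaves_perfect] at hv hv'
    rw [hv, hv']

theorem isPerfectAt_cons {l r : FullTree} {x : Bool} {u : List Bool} :
    IsPerfectAt (node l r).nodes (x :: u) ↔ IsPerfectAt (sub l r x).nodes u := by
  simp [isPerfectAt_iff]

theorem isMaximalPerfectAt_of_isPerfect {t : FullTree} (h : t.IsPerfect) {u : List Bool} :
    IsMaximalPerfectAt t.nodes u ↔ u = [] := by
  constructor
  · exact fun hu => (hu.2 [] (isPerfectAt_nil.2 h) List.nil_prefix).symm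
  · rintro rfl
    exact ⟨isPerfectAt_nil.2 h, fun u' _ h' => by simpa using h'⟩

/-- The only subtree that could contain more than those of the child is the whole tree, and it is
not perfect; so maximality can be tested inside the child. -/
theorem isMaximalPerfectAt_cons {l r : FullTree} (h : ¬ (node l r).IsPerfect) {x : Bool}
    {u : List Bool} :
    IsMaximalPerfectAt (node l r).nodes (x :: u) ↔ IsMaximalPerfectAt (sub l r x).nodes u := by
  constructor
  · rintro ⟨h1, h2⟩
    refine ⟨isPerfectAt_cons.1 h1, fun u' hu' hp => ?_⟩
    simpa using h2 (x :: u') (isPerfectAt_cons.2 hu') (by simpa using hp)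
  · rintro ⟨h1, h2⟩
    refine ⟨isPerfectAt_cons.2 h1, fun u' hu' hp => ?_⟩
    obtain _ | ⟨y, u'⟩ := u'
    · exact absurd (isPerfectAt_nil.1 hu') h
    · rw [List.cons_prefix_cons] at hp
      obtain ⟨rfl, hp⟩ := hp
      rw [h2 u' (isPerfectAt_cons.1 hu') hp]

/-- A perfect tree shrinks to its root. Otherwise the root is in no perfect subtree, and the two
children are shrunk independently. -/
theorem skeleton_nodes : ∀ t : FullTree, skeleton t.nodes = t.skel.nodes := by
  have perf : ∀ t : FullTree, t.IsPerfect → skeleton t.nodes = leaf.nodes := by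
    intro t ht
    ext v
    simp only [skeleton, Set.mem_ofPred_eq, isMaximalPerfectAt_of_isPerfect ht, nodes_leaf,
      Set.mem_singleton_iff, forall_eq, List.nil_prefix, forall_const]
    constructor
    · exact fun h => h.2
    · rintro rfl
      exact ⟨by simp, rfl⟩
  intro t
  induction t with
  | leaf => exact perf leaf ⟨0, rfl⟩
  | node l r ihl ihr =>
    rw [skel]
    split_ifs with hp
    · exact perf _ hp
    · ext v
      obtain _ | ⟨x, v⟩ := v
      · simp [skeleton]
      · have ih : skeleton (sub l r x).nodes = (sub l.skel r.skel x).nodes := by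
          cases x
          · exact ihl
          · exact ihr
        rw [cons_mem_nodes_node, ← ih]
        simp only [skeleton, Set.mem_ofPred_eq, cons_mem_nodes_node]
        refine and_congr_right fun _ => ⟨fun H u hu huv => ?_, fun H u hu huv => ?_⟩
        · simpa using H (x :: u) ((isMaximalPerfectAt_cons hp).2 hu) (by simpa using huv)
        · obtain _ | ⟨y, u⟩ := u
          · exact absurd (isPerfectAt_nil.1 hu.1) hp
          · rw [List.cons_prefix_cons] at huv
            obtain ⟨rfl, huv⟩ := huv
            rw [H u ((isMaximalPerfectAt_cons hp).1 hu) huv]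

/-- The tree `t` in which every leaf `v` is replaced by a perfect tree of height `h v`. -/
def expand : FullTree → (List Bool → ℕ) → FullTree
  | leaf, h => perfect (h [])
  | node l r, h => node (l.expand fun v => h (false :: v)) (r.expand fun v => h (true :: v))

theorem mem_leaves_expand : ∀ {t : FullTree} {h : List Bool → ℕ} {v : List Bool},
    v ∈ (t.expand h).leaves ↔ ∃ u ∈ t.leaves, ∃ β : List Bool, β.length = h u ∧ v = u ++ β
  | leaf, h, v => by simp [expand, mem_leaves_perfect]
  | node l r, h, v => by
    obtain _ | ⟨x, v⟩ := v
    · simp only [expand, nil_notMem_leaves_node, false_iff]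
      rintro ⟨u, hu, β, -, h⟩
      obtain ⟨rfl, -⟩ := List.append_eq_nil_iff.1 h.symm
      simp at hu
    · rw [expand, cons_mem_leaves_node]
      have : v ∈ (sub (l.expand fun v => h (false :: v)) (r.expand fun v => h (true :: v)) x).leaves
          ↔ ∃ u ∈ (sub l r x).leaves, ∃ β : List Bool, β.length = h (x :: u) ∧ v = u ++ β := by
        cases x <;> simp only [sub, cond_true, cond_false, mem_leaves_expand]
      rw [this]
      constructor
      · rintro ⟨u, hu, β, hβ, rfl⟩
        exact ⟨x :: u, by simpa using hu, β, hβ, rfl⟩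
      · rintro ⟨u, hu, β, hβ, h⟩
        obtain _ | ⟨y, u⟩ := u
        · simp at hu
        · rw [List.cons_append, List.cons.injEq] at h
          obtain ⟨rfl, rfl⟩ := h
          exact ⟨u, by simpa using hu, β, hβ, rfl⟩

theorem card_leaves_pos (t : FullTree) : 0 < t.leaves.card := Finset.card_pos.2 t.leaves_nonempty

theorem skel_of_isPerfect {t : FullTree} (h : t.IsPerfect) : t.skel = leaf := by
  cases t with
  | leaf => rfl
  | node l r => rw [skel, if_pos h]

/-- Perfect trees hung below the leaves of `t` can only merge into larger perfect subtrees. Each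
merger loses at least one leaf, because a node has at least two leaves below it; without a loss
nothing has merged. -/
theorem skel_expand : ∀ (t : FullTree) (h : List Bool → ℕ),
    (t.expand h).skel.leaves.card ≤ t.leaves.card ∧
      ((t.expand h).skel.leaves.card = t.leaves.card → (t.expand h).skel = t)
  | leaf, h => by
    rw [expand, skel_of_isPerfect ⟨_, rfl⟩]
    simp
  | node l r, h => by
    obtain ⟨h1, h2⟩ := skel_expand l fun v => h (false :: v)
    obtain ⟨h3, h4⟩ := skel_expand r fun v => h (true :: v)
    have := l.card_leaves_pos
    have := r.card_leaves_pos
    rw [card_leaves_node, expand, skel]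
    split_ifs with hp
    · simp only [leaves, Finset.card_singleton]
      exact ⟨by omega, fun _ => by omega⟩
    · rw [card_leaves_node]
      refine ⟨by omega, fun _ => ?_⟩
      rw [h2 (by omega), h4 (by omega)]

/-- A finite nonempty prefix-free set of words in which every inner node has two children is the
set of leaves of a full tree. -/
theorem exists_leaves_eq (m : ℕ) : ∀ S : Finset (List Bool), S.Nonempty →
    (∀ u ∈ S, u.length ≤ m) → (∀ u ∈ S, ∀ v ∈ S, u <+: v → u = v) →
    (∀ v x, (∃ u ∈ S, v ++ [x] <+: u) → ∃ u ∈ S, v ++ [!x] <+: u) →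
    ∃ t : FullTree, t.leaves = S := by
  have base : ∀ S : Finset (List Bool), [] ∈ S → (∀ u ∈ S, ∀ v ∈ S, u <+: v → u = v) →
      ∃ t : FullTree, t.leaves = S := by
    intro S h0 hp
    refine ⟨leaf, ?_⟩
    ext v
    rw [mem_leaves_leaf]
    constructor
    · rintro rfl
      exact h0
    · exact fun hv => (hp [] h0 v hv List.nil_prefix).symm
  induction m with
  | zero =>
    rintro S ⟨u, hu⟩ hm hp _
    have := hm u hu
    rw [Nat.le_zero, List.length_eq_zero_iff] at this
    exact base S (this ▸ hu) hp
  | succ m ih =>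
    intro S hS hm hp hf
    by_cases h0 : [] ∈ S
    · exact base S h0 hp
    let D : Bool → Finset (List Bool) := fun x =>
      S.preimage (List.cons x) (List.cons_injective.injOn)
    have hD : ∀ x v, v ∈ D x ↔ x :: v ∈ S := fun x v => by simp [D]
    have flip : ∀ x y : Bool, y ≠ x → y = !x := by decide
    -- One side is inhabited because `[] ∉ S` and `S` is nonempty; fullness at the root gives the
    -- other side.
    have hne : ∀ x, (D x).Nonempty := by
      have : ∃ x, (D x).Nonempty := by
        obtain ⟨u, hu⟩ := hS
        obtain _ | ⟨x, u⟩ := u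
        · exact absurd hu h0
        · exact ⟨x, u, (hD x u).2 hu⟩
      obtain ⟨x, u, hu⟩ := this
      intro y
      by_cases hxy : y = x
      · exact ⟨u, hxy ▸ hu⟩
      · obtain ⟨w, hw, h⟩ := hf [] x ⟨x :: u, (hD x u).1 hu, by simp⟩
        obtain ⟨w', rfl⟩ := h
        refine ⟨w', (hD y w').2 ?_⟩
        rw [flip x y hxy]
        simpa using hw
    have sub : ∀ x, ∃ t : FullTree, t.leaves = D x := by
      intro x
      refine ih (D x) (hne x) (fun u hu => ?_) (fun u hu v hv h => ?_) ?_
      · simpa using hm _ ((hD x u).1 hu)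
      · simpa using hp _ ((hD x u).1 hu) _ ((hD x v).1 hv) (by simpa using h)
      · rintro v y ⟨u, hu, h⟩
        obtain ⟨w, hw, h'⟩ := hf (x :: v) y ⟨x :: u, (hD x u).1 hu, by simpa using h⟩
        obtain _ | ⟨z, w⟩ := w
        · simp at h'
        · rw [List.cons_append, List.cons_prefix_cons] at h'
          obtain ⟨rfl, h'⟩ := h'
          exact ⟨w, (hD x w).2 hw, h'⟩
    obtain ⟨l, hl⟩ := sub false
    obtain ⟨r, hr⟩ := sub true
    refine ⟨node l r, ?_⟩
    ext v
    obtain _ | ⟨x, v⟩ := v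
    · simpa using h0
    · rw [cons_mem_leaves_node, ← hD]
      cases x
      · simp [FullTree.sub, hl]
      · simp [FullTree.sub, hr]

end FullTree

end OptSkeleton

/-! ### Ranks of weights and sums of small weights -/

namespace OptSkeleton

/-- The number of weights that precede `w i` among `w 0, …, w (n - 1)`, sorted by weight and then
by index. -/
noncomputable def rank (n : ℕ) (w : ℕ → ℝ) (i : ℕ) : ℕ := by
  classical exact ((Finset.range n).filter fun j => w j ≤ w i ∧ ¬ (w i ≤ w j ∧ i ≤ j)).card

/-- The sum of the `x` smallest weights among `w 0, …, w (n - 1)`. -/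
noncomputable def smallSum (n : ℕ) (w : ℕ → ℝ) (x : ℕ) : ℝ :=
  ∑ i ∈ (Finset.range n).filter fun i => rank n w i < x, w i

section rank

variable {n : ℕ} {w : ℕ → ℝ}

/-- The relation in `h` is the strict total order by weight and then by index, so by transitivity
the predecessors of `i`, together with `i`, are predecessors of `j`. -/
theorem rank_lt_rank {i j : ℕ} (hi : i < n) (h : w i ≤ w j ∧ ¬ (w j ≤ w i ∧ j ≤ i)) :
    rank n w i < rank n w j := by
  classical
  unfold rank
  apply Finset.card_lt_card
  rw [Finset.ssubset_iff_of_subset]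
  · refine ⟨i, by simpa [hi] using h, by simp⟩
  · intro k hk
    simp only [Finset.mem_filter, Finset.mem_range, not_and, not_le] at hk h ⊢
    refine ⟨hk.1, hk.2.1.trans h.1, fun hjk => ?_⟩
    have h1 := h.2 (hjk.trans hk.2.1)
    have h2 := hk.2.2 (h.1.trans hjk)
    omega

theorem rank_lt {i : ℕ} (hi : i < n) : rank n w i < n := by
  classical
  unfold rank
  calc _ < (Finset.range n).card := by
        apply Finset.card_lt_card
        rw [Finset.ssubset_iff_of_subset (Finset.filter_subset _ _)]
        exact ⟨i, by simpa using hi, by simp⟩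
    _ = n := Finset.card_range n

theorem rank_injOn : Set.InjOn (rank n w) (Finset.range n : Set ℕ) := by
  intro i hi j hj hij
  simp only [Finset.coe_range, Set.mem_Iio] at hi hj
  by_contra hne
  by_cases h : w i ≤ w j ∧ ¬ (w j ≤ w i ∧ j ≤ i)
  · exact absurd hij (rank_lt_rank hi h).ne
  · refine absurd hij (rank_lt_rank hj ?_).ne'
    by_cases h1 : w i ≤ w j
    · have h2 : w j ≤ w i ∧ j ≤ i := by
        by_contra h2
        exact h ⟨h1, h2⟩
      exact ⟨h2.1, fun h3 => hne (by omega)⟩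
    · exact ⟨(not_le.1 h1).le, fun h3 => h1 h3.1⟩

theorem le_of_rank_lt {i j : ℕ} (hj : j < n) (h : rank n w i < rank n w j) : w i ≤ w j := by
  by_contra hw
  exact absurd h (rank_lt_rank hj ⟨(not_le.1 hw).le, fun h => hw h.1⟩).not_gt

theorem image_rank : (Finset.range n).image (rank n w) = Finset.range n := by
  apply Finset.eq_of_subset_of_card_le
  · intro x hx
    obtain ⟨i, hi, rfl⟩ := Finset.mem_image.1 hx
    simpa using rank_lt (Finset.mem_range.1 hi)
  · rw [Finset.card_image_of_injOn rank_injOn]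

theorem exists_rank_eq {ρ : ℕ} (h : ρ < n) : ∃ i < n, rank n w i = ρ := by
  have : ρ ∈ (Finset.range n).image (rank n w) := by rw [image_rank]; simpa using h
  simpa using this

theorem card_rank_lt {x : ℕ} (hx : x ≤ n) :
    ((Finset.range n).filter fun i => rank n w i < x).card = x := by
  rw [← Finset.card_image_of_injOn (f := rank n w)
    (rank_injOn.mono (by intro i hi; simp only [Finset.coe_filter] at hi; simpa using hi.1))]
  have : ((Finset.range n).filter fun i => rank n w i < x).image (rank n w) = Finset.range x := by
    ext ρ
    simp only [Finset.mem_image, Finset.mem_filter, Finset.mem_range]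
    constructor
    · rintro ⟨i, hi, rfl⟩
      exact hi.2
    · intro hρ
      obtain ⟨i, hi, rfl⟩ := exists_rank_eq (w := w) (hρ.trans_le hx)
      exact ⟨i, ⟨hi, hρ⟩, rfl⟩
  rw [this, Finset.card_range]

/-- Exchange argument: outside their intersection, `S` and the set of the smallest ranks have
equally many elements, and every weight of the latter is at most every weight of the former. -/
theorem smallSum_card_le {S : Finset ℕ} (hS : S ⊆ Finset.range n) :
    smallSum n w S.card ≤ ∑ i ∈ S, w i := by
  have hSn : S.card ≤ n := by simpa using Finset.card_le_card hS
  unfold smallSum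
  set R := (Finset.range n).filter fun i => rank n w i < S.card with hR
  have hc : R.card = S.card := card_rank_lt hSn
  have hc' : (R \ S).card = (S \ R).card := Finset.card_sdiff_comm hc
  have hle : ∀ i ∈ R \ S, ∀ j ∈ S \ R, w i ≤ w j := by
    intro i hi j hj
    simp only [hR, Finset.mem_sdiff, Finset.mem_filter, Finset.mem_range, not_and, not_lt] at hi hj
    have hj' : j < n := Finset.mem_range.1 (hS hj.1)
    have := hj.2 hj'
    exact le_of_rank_lt hj' (by omega)
  rw [← Finset.sum_inter_add_sum_sdiff R S, ← Finset.sum_inter_add_sum_sdiff S R,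
    Finset.inter_comm]
  gcongr 1
  rcases (R \ S).eq_empty_or_nonempty with h0 | h0
  · rw [h0, Finset.card_empty] at hc'
    rw [h0, Finset.card_eq_zero.1 hc'.symm]
  -- The heaviest weight in `R \ S` separates the two sums.
  · obtain ⟨i, hi, hmax⟩ := Finset.exists_max_image (R \ S) w h0
    calc ∑ j ∈ R \ S, w j ≤ (R \ S).card • w i := Finset.sum_le_card_nsmul _ _ _ hmax
      _ = (S \ R).card • w i := by rw [hc']
      _ ≤ _ := Finset.card_nsmul_le_sum _ _ _ (hle i hi)

end rank

/-! ### Plans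

A plan constructs a code level by level. In the state `(x, N)` there are `x` symbols left, for
which `N` nodes of the present level are available. -/

/-- `Plan W x N c k`: starting with `x` symbols and `N` nodes at the present level, we can finish
the code with `k` perfect subtrees and additional cost `c`. -/
inductive Plan (W : ℕ → ℝ) : ℕ → ℕ → ℝ → ℕ → Prop
  | done : Plan W 0 0 0 0
  | descend {x N : ℕ} {c : ℝ} {k : ℕ} (h : Plan W x (2 * N) c k) : Plan W x N (c + W x) k
  | place (β : ℕ) {x N : ℕ} {c : ℝ} {k : ℕ} (h : Plan W x N c k) :
      Plan W (x + 2 ^ β) (N + 2 ^ β) c (k + 1)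

/-- All available nodes must eventually lead to leaves, and without nodes no symbol can be placed.
This confines the table to `1 ≤ N ≤ x`, apart from the cell `(0, 0)`. -/
theorem Plan.le {W : ℕ → ℝ} {x N : ℕ} {c : ℝ} {k : ℕ} (h : Plan W x N c k) :
    N ≤ x ∧ (N = 0 → x = 0) := by
  induction h with
  | done => simp
  | descend h ih => exact ⟨by omega, fun h0 => ih.2 (by omega)⟩
  | place β h ih =>
    have := Nat.one_le_two_pow (n := β)
    omega

theorem Plan.nonneg {W : ℕ → ℝ} (hW : ∀ x, 0 ≤ W x) {x N : ℕ} {c : ℝ} {k : ℕ}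
    (h : Plan W x N c k) : 0 ≤ c := by
  induction h with
  | done => exact le_rfl
  | descend h ih => exact add_nonneg ih (hW _)
  | place β h ih => exact ih

/-- `p` leaves at the present level can be placed as `k` parts of perfect subtrees. -/
def Placeable (W : ℕ → ℝ) (p k : ℕ) : Prop :=
  ∀ x N c k', Plan W x N c k' → Plan W (x + p) (N + p) c (k' + k)

theorem Placeable.zero (W : ℕ → ℝ) : Placeable W 0 0 := fun _ _ _ _ h => h

theorem Placeable.add {W : ℕ → ℝ} {p k p' k' : ℕ} (h : Placeable W p k) (h' : Placeable W p' k') :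
    Placeable W (p + p') (k + k') := fun x N c k'' hp => by
  simpa only [add_assoc] using h' _ _ _ _ (h _ _ _ _ hp)

theorem Placeable.pow (W : ℕ → ℝ) (β : ℕ) : Placeable W (2 ^ β) 1 := fun _ _ _ _ h => h.place β

/-- The cost of a code with `a d` leaves at depth `d < H`, if the small weights get the long
codewords. -/
def levelCost (W : ℕ → ℝ) : ℕ → (ℕ → ℕ) → ℝ
  | 0, _ => 0
  | H + 1, a => levelCost W H (fun d => a (d + 1)) + W (∑ d ∈ Finset.range H, a (d + 1))

/-- Here `a d` and `ν d` stand for the leaves and the inner nodes at depth `d`. After the `a 0`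
leaves are placed, the `ν 0` inner nodes remain, and the descent doubles them to `a 1 + ν 1`. -/
theorem Plan.of_levels {W : ℕ → ℝ} : ∀ (H : ℕ) (a ν k : ℕ → ℕ), (∀ d, Placeable W (a d) (k d)) →
    (∀ d, a (d + 1) + ν (d + 1) = 2 * ν d) → (a H + ν H = 0) →
    Plan W (∑ d ∈ Finset.range H, a d) (a 0 + ν 0) (levelCost W H a) (∑ d ∈ Finset.range H, k d)
  | 0, a, ν, k, _, _, h0 => by
    rw [h0]
    exact .done
  | H + 1, a, ν, k, hp, hν, h0 => by
    have ih := Plan.of_levels H (fun d => a (d + 1)) (fun d => ν (d + 1)) (fun d => k (d + 1))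
      (fun d => hp (d + 1)) (fun d => hν (d + 1)) h0
    rw [hν 0] at ih
    have := hp 0 _ _ _ _ ih.descend
    rw [Finset.sum_range_succ', Finset.sum_range_succ', add_comm (a 0)]
    exact this

/-- Summation by levels: removing one edge from every positive length saves the total weight of the
symbols below the root, which is at least `W` of their number. -/
theorem levelCost_le {ι : Type*} [DecidableEq ι] {W : ℕ → ℝ} {w : ι → ℝ}
    (hW : ∀ S : Finset ι, W S.card ≤ ∑ i ∈ S, w i) :
    ∀ (H : ℕ) (S : Finset ι) (ℓ : ι → ℕ), (∀ i ∈ S, ℓ i < H) →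
      levelCost W H (fun d => (S.filter fun i => ℓ i = d).card) ≤ ∑ i ∈ S, (ℓ i : ℝ) * w i
  | 0, S, ℓ, h => by
    rw [Finset.eq_empty_of_forall_notMem (s := S) fun i hi => by simpa using h i hi]
    simp [levelCost]
  | H + 1, S, ℓ, h => by
    set S' := S.filter fun i => 1 ≤ ℓ i with hS'
    have h1 : ∀ d, (S.filter fun i => ℓ i = d + 1).card = (S'.filter fun i => ℓ i - 1 = d).card := by
      intro d
      congr 1
      ext i
      simp only [hS', Finset.mem_filter]
      constructor
      · rintro ⟨h1, h2⟩
        exact ⟨⟨h1, by omega⟩, by omega⟩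
      · rintro ⟨⟨h1, h2⟩, h3⟩
        exact ⟨h1, by omega⟩
    have h2 : ∀ i ∈ S', ℓ i - 1 < H := fun i hi => by
      have := h i (Finset.mem_of_mem_filter i hi)
      have := (Finset.mem_filter.1 hi).2
      omega
    have h3 : ∑ d ∈ Finset.range H, (S'.filter fun i => ℓ i - 1 = d).card = S'.card :=
      (Finset.card_eq_sum_card_fiberwise fun i hi => by simpa using h2 i hi).symm
    have h4 : ∑ i ∈ S, (ℓ i : ℝ) * w i = ∑ i ∈ S', (ℓ i : ℝ) * w i := by
      rw [hS', Finset.sum_filter]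
      refine Finset.sum_congr rfl fun i _ => ?_
      split_ifs with hi
      · rfl
      · rw [show ℓ i = 0 by omega]
        simp
    have h5 : ∑ i ∈ S', (ℓ i : ℝ) * w i
        = ∑ i ∈ S', ((ℓ i - 1 : ℕ) : ℝ) * w i + ∑ i ∈ S', w i := by
      rw [← Finset.sum_add_distrib]
      refine Finset.sum_congr rfl fun i hi => ?_
      rw [Nat.cast_sub (Finset.mem_filter.1 hi).2]
      push_cast
      ring
    simp only [levelCost, h1]
    rw [h3, h4, h5]
    exact add_le_add (levelCost_le hW H S' (fun i => ℓ i - 1) h2) (hW S')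

/-! ### Leaves, inner nodes and perfect subtrees counted by levels -/

namespace FullTree

/-- The number of leaves at depth `d`. -/
def leavesAt (t : FullTree) (d : ℕ) : ℕ := (t.leaves.filter fun v => v.length = d).card

theorem leavesAt_node_zero (l r : FullTree) : (node l r).leavesAt 0 = 0 := by
  rw [leavesAt, Finset.card_eq_zero, Finset.filter_eq_empty_iff]
  intro v hv h0
  rw [List.length_eq_zero_iff] at h0
  simp [h0] at hv

theorem leavesAt_node_succ (l r : FullTree) (d : ℕ) :
    (node l r).leavesAt (d + 1) = l.leavesAt d + r.leavesAt d := by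
  rw [leavesAt, leaves, Finset.filter_union, Finset.card_union_of_disjoint, Finset.filter_map,
    Finset.filter_map, Finset.card_map, Finset.card_map, leavesAt, leavesAt]
  · simp
  · apply Finset.disjoint_filter_filter
    rw [Finset.disjoint_left]
    intro v
    obtain _ | ⟨x, v⟩ := v <;> simp
    rintro - rfl
    simp

theorem leavesAt_leaf (d : ℕ) : leaf.leavesAt d = if d = 0 then 1 else 0 := by
  rw [leavesAt, leaves, Finset.filter_singleton]
  split_ifs with h h' h' <;> simp_all

theorem leavesAt_perfect : ∀ h d : ℕ, (perfect h).leavesAt d = if d = h then 2 ^ h else 0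
  | 0, d => by simp [perfect, leavesAt_leaf]
  | h + 1, 0 => by simp [perfect, leavesAt_node_zero]
  | h + 1, d + 1 => by
    rw [perfect, leavesAt_node_succ, leavesAt_perfect h d]
    by_cases hd : d = h
    · simp [hd, pow_succ, mul_two]
    · simp [hd]

/-- The number of inner nodes at depth `d`. -/
def innerAt : FullTree → ℕ → ℕ
  | leaf, _ => 0
  | node _ _, 0 => 1
  | node l r, d + 1 => l.innerAt d + r.innerAt d

theorem leavesAt_add_innerAt_zero : ∀ t : FullTree, t.leavesAt 0 + t.innerAt 0 = 1
  | leaf => by simp [leavesAt_leaf, innerAt]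
  | node l r => by simp [leavesAt_node_zero, innerAt]

theorem leavesAt_add_innerAt_succ : ∀ (t : FullTree) (d : ℕ),
    t.leavesAt (d + 1) + t.innerAt (d + 1) = 2 * t.innerAt d
  | leaf, d => by simp [leavesAt_leaf, innerAt]
  | node l r, 0 => by
    have := l.leavesAt_add_innerAt_zero
    have := r.leavesAt_add_innerAt_zero
    simp only [leavesAt_node_succ, innerAt]
    omega
  | node l r, d + 1 => by
    have := l.leavesAt_add_innerAt_succ d
    have := r.leavesAt_add_innerAt_succ d
    simp only [leavesAt_node_succ, innerAt] at *
    omega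

theorem eq_zero_of_height : ∀ (t : FullTree) (H : ℕ), (∀ v ∈ t.leaves, v.length < H) →
    t.leavesAt H + t.innerAt H = 0
  | leaf, H, h => by
    have : 0 < H := by simpa using h [] (by simp)
    simp [leavesAt_leaf, innerAt, this.ne']
  | node l r, 0, h => by
    obtain ⟨v, hv⟩ := (node l r).leaves_nonempty
    exact absurd (h v hv) (by simp)
  | node l r, H + 1, h => by
    have := l.eq_zero_of_height H fun v hv => by
      simpa using h (false :: v) (by simpa [sub] using hv)
    have := r.eq_zero_of_height H fun v hv => by
      simpa using h (true :: v) (by simpa [sub] using hv)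
    simp only [leavesAt_node_succ, innerAt]
    omega

open Classical in
/-- The number of maximal perfect subtrees with leaves at depth `d`. -/
noncomputable def blocksAt : FullTree → ℕ → ℕ
  | leaf, d => if leaf.leavesAt d = 0 then 0 else 1
  | node l r, d => if (node l r).IsPerfect then (if (node l r).leavesAt d = 0 then 0 else 1) else
    match d with
    | 0 => 0
    | d + 1 => l.blocksAt d + r.blocksAt d

theorem blocksAt_of_isPerfect {t : FullTree} (h : t.IsPerfect) (d : ℕ) :
    t.blocksAt d = if t.leavesAt d = 0 then 0 else 1 := by
  cases t with
  | leaf => rw [blocksAt.eq_def]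
  | node l r => rw [blocksAt.eq_def]; exact if_pos h

/-- The leaves at depth `d` are partitioned by the maximal perfect subtrees, and one of height `h`
contributes `2 ^ h` of them, which is one placement. -/
theorem placeable (W : ℕ → ℝ) : ∀ (t : FullTree) (d : ℕ), Placeable W (t.leavesAt d) (t.blocksAt d) := by
  have perf : ∀ (t : FullTree) (d : ℕ), t.IsPerfect → Placeable W (t.leavesAt d) (t.blocksAt d) := by
    rintro t d ht
    rw [blocksAt_of_isPerfect ht]
    obtain ⟨h, rfl⟩ := ht
    rw [leavesAt_perfect]
    by_cases hd : d = h
    · simpa [hd] using Placeable.pow W h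
    · simpa [hd] using Placeable.zero W
  intro t
  induction t with
  | leaf => exact fun d => perf _ _ ⟨0, rfl⟩
  | node l r ihl ihr =>
    intro d
    by_cases hp : (node l r).IsPerfect
    · exact perf _ _ hp
    · cases d with
      | zero =>
        rw [blocksAt, if_neg hp, leavesAt_node_zero]
        exact .zero W
      | succ d =>
        rw [blocksAt, if_neg hp, leavesAt_node_succ]
        exact (ihl d).add (ihr d)

theorem sum_leavesAt {t : FullTree} {H : ℕ} (h : ∀ v ∈ t.leaves, v.length < H) :
    ∑ d ∈ Finset.range H, t.leavesAt d = t.leaves.card :=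
  (Finset.card_eq_sum_card_fiberwise fun v hv => by simpa using h v hv).symm

/-- All leaves of a perfect subtree have the same depth, so each maximal one is counted at exactly
one level; the recursion is that of `skel`. -/
theorem sum_blocksAt : ∀ {t : FullTree} {H : ℕ}, (∀ v ∈ t.leaves, v.length < H) →
    ∑ d ∈ Finset.range H, t.blocksAt d = t.skel.leaves.card := by
  have perf : ∀ {t : FullTree} {H : ℕ}, t.IsPerfect → (∀ v ∈ t.leaves, v.length < H) →
      ∑ d ∈ Finset.range H, t.blocksAt d = t.skel.leaves.card := by
    intro t H ht hH
    rw [skel_of_isPerfect ht]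
    simp only [blocksAt_of_isPerfect ht]
    obtain ⟨h, rfl⟩ := ht
    have hh : h < H := by
      obtain ⟨v, hv⟩ := (perfect h).leaves_nonempty
      rw [← mem_leaves_perfect.1 hv]
      exact hH v hv
    simp only [leavesAt_perfect]
    rw [Finset.sum_eq_single h]
    · simp [leaves]
    · intro d _ hd
      simp [hd]
    · simp [hh]
  intro t
  induction t with
  | leaf => exact fun h => perf ⟨0, rfl⟩ h
  | node l r ihl ihr =>
    intro H h
    by_cases hp : (node l r).IsPerfect
    · exact perf hp h
    · obtain _ | H := H
      · obtain ⟨v, hv⟩ := (node l r).leaves_nonempty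
        exact absurd (h v hv) (by simp)
      · rw [Finset.sum_range_succ', blocksAt, if_neg hp, skel, if_neg hp, card_leaves_node,
          ← ihl fun v hv => by simpa using h (false :: v) (by simpa [sub] using hv),
          ← ihr fun v hv => by simpa using h (true :: v) (by simpa [sub] using hv),
          ← Finset.sum_add_distrib, add_zero]
        refine Finset.sum_congr rfl fun d _ => ?_
        rw [blocksAt, if_neg hp]

theorem exists_height (t : FullTree) : ∃ H, ∀ v ∈ t.leaves, v.length < H :=
  ⟨t.leaves.sup List.length + 1, fun _ hv => Nat.lt_succ_of_le (Finset.le_sup (f := List.length) hv)⟩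

/-- The leaves of a tree give a plan. -/
theorem plan (W : ℕ → ℝ) {t : FullTree} {H : ℕ} (h : ∀ v ∈ t.leaves, v.length < H) :
    Plan W t.leaves.card 1 (levelCost W H t.leavesAt) t.skel.leaves.card := by
  rw [← sum_leavesAt h, ← sum_blocksAt h, ← t.leavesAt_add_innerAt_zero]
  exact Plan.of_levels H t.leavesAt t.innerAt t.blocksAt (t.placeable W)
    t.leavesAt_add_innerAt_succ (t.eq_zero_of_height H h)

end FullTree

/-! ### Optimal codes have full trees -/

section codes

variable {n : ℕ}

/-- Every inner node of the tree of the code has two children. -/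
def IsFullCode (c : Fin n → List Bool) : Prop :=
  ∀ v x, (∃ i, v ++ [x] <+: c i) → ∃ i, v ++ [!x] <+: c i

theorem IsPrefixFree.injective {c : Fin n → List Bool} (h : IsPrefixFree c) :
    Function.Injective c := by
  intro i j hij
  by_contra hne
  exact h i j hne (hij ▸ List.prefix_rfl)

/-- If `v` has the only child `v ++ [x]`, the edge between them is contracted, which deletes this
bit from all codewords through it. The total length is recorded as well, for use as an induction
measure. -/
theorem exists_cheaper {w : Fin n → ℝ} (hw : ∀ i, 0 < w i) {c : Fin n → List Bool}
    (hc : IsPrefixFree c) (hf : ¬ IsFullCode c) : ∃ c' : Fin n → List Bool, IsPrefixFree c' ∧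
      codeCost w c' < codeCost w c ∧ ∑ i, (c' i).length < ∑ i, (c i).length := by
  classical
  unfold IsFullCode at hf
  push Not at hf
  obtain ⟨v, x, ⟨i₀, hi₀⟩, hx⟩ := hf
  -- A codeword that passes `v` but not `v ++ [x]` either equals `v`, a prefix of `c i₀`, or uses
  -- the missing child.
  have key : ∀ j, ¬ v ++ [x] <+: c j → ¬ v <+: c j := by
    rintro j hj ⟨a, ha⟩
    obtain _ | ⟨y, a⟩ := a
    · rw [List.append_nil] at ha
      refine hc j i₀ ?_ (ha ▸ (List.prefix_append v [x]).trans hi₀)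
      rintro rfl
      exact hj hi₀
    · by_cases hy : y = x
      · exact hj ⟨a, by simp [← ha, hy]⟩
      · have : y = !x := (by decide : ∀ x y : Bool, ¬ y = x → y = !x) x y hy
        exact hx j ⟨a, by simp [← ha, this]⟩
  let c' : Fin n → List Bool := fun i =>
    if v ++ [x] <+: c i then v ++ (c i).drop (v.length + 1) else c i
  have hin : ∀ i, v ++ [x] <+: c i → ∃ a, c i = v ++ x :: a ∧ c' i = v ++ a := by
    rintro i hi
    obtain ⟨a, ha⟩ := hi
    refine ⟨a, by simp [← ha], ?_⟩
    simp only [c', ← ha, List.prefix_append, if_true]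
    congr 1
    rw [List.drop_left' (by simp)]
  have hout : ∀ i, ¬ v ++ [x] <+: c i → c' i = c i := fun i hi => by simp only [c', if_neg hi]
  have hlen : ∀ i, (c' i).length ≤ (c i).length := by
    intro i
    by_cases hi : v ++ [x] <+: c i
    · obtain ⟨a, h1, h2⟩ := hin i hi
      simp [h1, h2]
    · rw [hout i hi]
  have hlt : (c' i₀).length < (c i₀).length := by
    obtain ⟨a, h1, h2⟩ := hin i₀ hi₀
    simp [h1, h2]
  refine ⟨c', ?_, ?_, Finset.sum_lt_sum (fun i _ => hlen i) ⟨i₀, Finset.mem_univ _, hlt⟩⟩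
  · intro i j hij h
    by_cases hi : v ++ [x] <+: c i <;> by_cases hj : v ++ [x] <+: c j
    · obtain ⟨a, h1, h2⟩ := hin i hi
      obtain ⟨a', h1', h2'⟩ := hin j hj
      rw [h2, h2', List.prefix_append_right_inj] at h
      refine hc i j hij ?_
      rw [h1, h1', List.prefix_append_right_inj, List.cons_prefix_cons]
      exact ⟨rfl, h⟩
    · obtain ⟨a, h1, h2⟩ := hin i hi
      rw [h2, hout j hj] at h
      exact key j hj ((List.prefix_append v a).trans h)
    · obtain ⟨a, h1, h2⟩ := hin j hj
      rw [h2, hout i hi] at h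
      rcases List.prefix_or_prefix_of_prefix h (List.prefix_append v a) with h' | h'
      · exact hc i j hij (h'.trans (h1 ▸ List.prefix_append _ _))
      · exact key i hi h'
    · rw [hout i hi, hout j hj] at h
      exact hc i j hij h
  · refine Finset.sum_lt_sum (fun i _ => ?_) ⟨i₀, Finset.mem_univ _, ?_⟩
    · exact mul_le_mul_of_nonneg_right (by exact_mod_cast hlen i) (hw i).le
    · exact mul_lt_mul_of_pos_right (by exact_mod_cast hlt) (hw i₀)

/-- Contractions are repeated by induction on the total length, since real costs are not
well-founded. This allows comparison with arbitrary codes before an optimal code is known to exist.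
-/
theorem exists_full_code {w : Fin n → ℝ} (hw : ∀ i, 0 < w i) {c : Fin n → List Bool}
    (hc : IsPrefixFree c) : ∃ c' : Fin n → List Bool, IsPrefixFree c' ∧ IsFullCode c' ∧
      codeCost w c' ≤ codeCost w c := by
  induction hm : ∑ i, (c i).length using Nat.strong_induction_on generalizing c with
  | _ m ih =>
    by_cases hf : IsFullCode c
    · exact ⟨c, hc, hf, le_rfl⟩
    · obtain ⟨c', h1, h2, h3⟩ := exists_cheaper hw hc hf
      obtain ⟨c'', h4, h5, h6⟩ := ih _ (hm ▸ h3) h1 rfl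
      exact ⟨c'', h4, h5, h6.trans h2.le⟩

theorem IsOptimalCode.isFullCode {w : Fin n → ℝ} (hw : ∀ i, 0 < w i) {c : Fin n → List Bool}
    (hc : IsOptimalCode w c) : IsFullCode c := by
  by_contra hf
  obtain ⟨c', h1, h2, -⟩ := exists_cheaper hw hc.1 hf
  exact absurd (hc.2 c' h1) (not_le.2 h2)

theorem codeTree_eq_nodes {c : Fin n → List Bool} {t : FullTree}
    (h : t.leaves = Finset.univ.image c) : codeTree c = t.nodes := by
  ext v
  simp [codeTree, FullTree.nodes, h]

theorem exists_tree (hn : 1 ≤ n) {c : Fin n → List Bool} (hc : IsPrefixFree c)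
    (hf : IsFullCode c) : ∃ t : FullTree, t.leaves = Finset.univ.image c := by
  refine FullTree.exists_leaves_eq (∑ i, (c i).length) _
    ⟨c ⟨0, hn⟩, Finset.mem_image_of_mem _ (Finset.mem_univ _)⟩ ?_ ?_ ?_
  · intro u hu
    obtain ⟨i, -, rfl⟩ := Finset.mem_image.1 hu
    exact Finset.single_le_sum (f := fun i => (c i).length) (fun _ _ => Nat.zero_le _)
      (Finset.mem_univ i)
  · intro u hu v hv h
    obtain ⟨i, -, rfl⟩ := Finset.mem_image.1 hu
    obtain ⟨j, -, rfl⟩ := Finset.mem_image.1 hv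
    by_contra hne
    exact hc i j (fun hij => hne (hij ▸ rfl)) h
  · intro v x h
    simp only [Finset.mem_image, Finset.mem_univ, true_and, exists_exists_eq_and] at h ⊢
    exact hf v x h

/-- A code with a full tree gives a plan that is not more expensive. -/
theorem exists_plan {w : Fin n → ℝ} {W : ℕ → ℝ}
    (hW : ∀ S : Finset (Fin n), W S.card ≤ ∑ i ∈ S, w i) {c : Fin n → List Bool}
    (hc : IsPrefixFree c) {t : FullTree} (ht : t.leaves = Finset.univ.image c) :
    ∃ κ ≤ codeCost w c, Plan W n 1 κ t.skel.leaves.card := by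
  obtain ⟨H, hH⟩ := t.exists_height
  have hcard : t.leaves.card = n := by
    rw [ht, Finset.card_image_of_injective _ hc.injective, Finset.card_univ, Fintype.card_fin]
  refine ⟨_, ?_, hcard ▸ t.plan W hH⟩
  have h1 : t.leavesAt = fun d => (Finset.univ.filter fun i => (c i).length = d).card := by
    funext d
    rw [FullTree.leavesAt, ht, Finset.filter_image, Finset.card_image_of_injective _ hc.injective]
  rw [h1]
  refine levelCost_le hW H Finset.univ (fun i => (c i).length) fun i _ => hH _ ?_
  rw [ht]
  exact Finset.mem_image_of_mem _ (Finset.mem_univ _)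

/-- `(c, k)` is lexicographically at most `(c', k')`. -/
def LexLE (c : ℝ) (k : ℕ) (c' : ℝ) (k' : ℕ) : Prop := c < c' ∨ c = c' ∧ k ≤ k'

/-- A code whose tree is obtained by expanding the leaves of `t`, and whose cost and number of
perfect subtrees are at most those of every plan, induces an optimal skeleton, namely `t`. -/
theorem inducesOptimalSkeleton {w : Fin n → ℝ} (hn : 1 ≤ n) (hw : ∀ i, 0 < w i) {W : ℕ → ℝ}
    (hW : ∀ S : Finset (Fin n), W S.card ≤ ∑ i ∈ S, w i) {c : Fin n → List Bool}
    (hc : IsPrefixFree c) {t : FullTree} {h : List Bool → ℕ}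
    (ht : (t.expand h).leaves = Finset.univ.image c)
    (hmin : ∀ κ k, Plan W n 1 κ k → LexLE (codeCost w c) t.leaves.card κ k) :
    InducesOptimalSkeleton w c ∧ skeleton (codeTree c) = t.nodes := by
  have hopt : IsOptimalCode w c := by
    refine ⟨hc, fun c' hc' => ?_⟩
    obtain ⟨c'', h1, h2, h3⟩ := exists_full_code hw hc'
    obtain ⟨t', ht'⟩ := exists_tree hn h1 h2
    obtain ⟨κ, hκ, hp⟩ := exists_plan hW h1 ht'
    rcases hmin κ _ hp with h4 | h4
    · linarith
    · linarith
  -- The plan of an optimal code cannot be strictly more expensive than `c`, so the lexicographic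
  -- comparison is decided by the number of blocks.
  have hle : ∀ c' : Fin n → List Bool, IsOptimalCode w c' → ∀ t' : FullTree,
      t'.leaves = Finset.univ.image c' → t.leaves.card ≤ t'.skel.leaves.card := by
    intro c' hc' t' ht'
    obtain ⟨κ, hκ, hp⟩ := exists_plan hW hc'.1 ht'
    rcases hmin κ _ hp with h4 | h4
    · have := hc'.2 c hc
      linarith
    · exact h4.2
  -- `hle` is applied to `c` itself: its skeleton has at least as many leaves as `t`, so no blocks
  -- have merged.
  have hskel : (t.expand h).skel = t :=
    (t.skel_expand h).2 ((t.skel_expand h).1.antisymm (hle c hopt _ ht))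
  have heq : skeleton (codeTree c) = t.nodes := by
    rw [codeTree_eq_nodes ht, FullTree.skeleton_nodes, hskel]
  refine ⟨⟨hopt, fun c' hc' => ?_⟩, heq⟩
  obtain ⟨t', ht'⟩ := exists_tree hn hc'.1 (hc'.isFullCode hw)
  rw [heq, codeTree_eq_nodes ht', FullTree.skeleton_nodes]
  have h1 := hle c' hc' t' ht'
  have h2 := t.ncard_nodes
  have h3 := t'.skel.ncard_nodes
  omega

end codes

end OptSkeleton

/-! ### Computing the ranks and the sums of small weights -/

namespace OptSkeleton

attribute [simp] State.var_putVar State.arr_putVar State.wt_putVar State.var_putArr State.arr_putArr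
  State.wt_putArr State.var_putWt State.arr_putWt State.wt_putWt WordExpr.val WtExpr.val Op.app
  Test.Holds Test.holds_lt Cmd.wp

variable {b V : ℕ}

/-- Variable `4` counts the weights that precede the weight with index in variable `2`. -/
def rankStep : Cmd :=
  .ite (.and (.wtLe (.cell 0 (.var 3)) (.cell 0 (.var 2)))
      (.not (.and (.wtLe (.cell 0 (.var 2)) (.cell 0 (.var 3))) (.le (.var 2) (.var 3)))))
    (.setVar 4 (.op .add (.var 4) (.const 1))) .skip

/-- Word array `4` gets the ranks of the `n` weights; `n` is in variable `1`. -/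
def rankProg : Cmd :=
  .forVar 2 1 (.seq (.setVar 4 (.const 0)) (.seq (.forVar 3 1 rankStep)
    (.setArr 4 (.var 2) (.var 4))))

/-- Quadratic time suffices to count the predecessors of every weight directly, so no sorting is
needed. -/
theorem rankProg_halts {n : ℕ} (hV : n ≤ V) {s : State} (hn : s.var 1 = n) :
    Halts b V rankProg s (n * (n * 5 + 11) + 3)
      fun s' => ∀ i < n, s'.arr 4 i = rank n (s.wt 0) i := by
  classical
  subst hn
  refine (Halts.forVar (τ := s.var 1 * 5 + 8) (fun i s' => ∀ i' < i, s'.arr 4 i' = rank (s.var 1) (s.wt 0) i')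
    (by decide) (by decide) (by decide) (by simp) ?_ (fun s' _ _ _ h => h)).mono (by simp) fun _ _ h => h
  intro i hi s₁ hf hi₁ hn₁ hI
  have hw := hf.wt 0 (by decide)
  refine ((Halts.of_wp (c := .setVar 4 (.const 0)) (Q := fun s' => s'.var 4 = 0) (by simp)).seq
    (t' := s.var 1 * 5 + 5) ?_).mono (by simp [Cmd.size]; omega) fun _ _ h => h
  intro s₂ hf₂ h4
  have h21 : s₂.var 1 = s.var 1 := (hf₂.var 1 (by decide)).trans hn₁
  have h22 : s₂.var 2 = i := (hf₂.var 2 (by decide)).trans hi₁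
  have hw₂ : s₂.wt 0 = s.wt 0 := (hf₂.wt 0 (by decide)).trans hw
  refine Halts.seq (t := s.var 1 * 5 + 3) (t' := 1) (R := fun s' => s'.var 4 = rank (s.var 1) (s.wt 0) i) ?_ ?_
  · refine (Halts.forVar (τ := 2) (fun J s' => s'.var 4 = ((Finset.range J).filter fun j =>
      s.wt 0 j ≤ s.wt 0 i ∧ ¬ (s.wt 0 i ≤ s.wt 0 j ∧ i ≤ j)).card)
      (by decide) (by decide) (by decide) (by simp [h4]) ?_ ?_).mono (by simp [h21]) fun _ _ h => h
    · intro J hJ s₃ hf₃ h33 h31 hI₃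
      have hw₃ : s₃.wt 0 = s.wt 0 := (hf₃.wt 0 (by decide)).trans hw₂
      have h32 : s₃.var 2 = i := (hf₃.var 2 (by decide)).trans h22
      refine (Halts.of_wp (c := rankStep) ?_).mono (by simp [Cmd.size, rankStep]) fun _ _ h => h
      have hle : ((Finset.range J).filter fun j =>
          s.wt 0 j ≤ s.wt 0 i ∧ ¬ (s.wt 0 i ≤ s.wt 0 j ∧ i ≤ j)).card ≤ J :=
        (Finset.card_filter_le _ _).trans (by simp)
      simp only [rankStep, Cmd.wp, Test.Holds, WtExpr.val, WordExpr.val, hw₃, h33, h32, Op.app]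
      rw [Finset.range_add_one, Finset.filter_insert]
      constructor
      · intro hp
        rw [if_pos hp, Finset.card_insert_of_notMem (by simp)]
        exact ⟨by omega, by simp [hI₃]⟩
      · intro hp
        rw [if_neg hp]
        simpa using hI₃
    · intro s' _ _ _ h
      rw [h, h21, rank]
  · intro s₄ hf₄ h44
    have h42 : s₄.var 2 = i := (hf₄.var 2 (by decide)).trans h22
    refine Halts.of_wp ?_
    have hr : rank (s.var 1) (s.wt 0) i < s.var 1 := rank_lt hi
    simp only [Cmd.wp, WordExpr.val, h44, h42]
    refine ⟨by omega, fun i' hi' => ?_⟩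
    simp only [State.arr_putVar, State.arr_putArr, if_true, Function.update_apply]
    split_ifs with h
    · rw [h]
    · rw [hf₄.arr 4 (by decide), hf₂.arr 4 (by decide)]
      exact hI i' (by omega)

/-- Cell `x ≤ n` of weight array `1` gets the sum of the `x` smallest weights. -/
def sumProg : Cmd :=
  .forVar 2 5 (.forVar 3 1 (.ite (.lt (.arr 4 (.var 3)) (.var 2))
    (.setWt 1 (.var 2) (.add (.cell 1 (.var 2)) (.cell 0 (.var 3)))) .skip))

/-- Every sum is accumulated anew in its own cell, which therefore has to be zero at the start; the
outer invariant keeps the untouched cells zero. -/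
theorem sumProg_halts {n : ℕ} {s : State} (hn : s.var 1 = n) (h5 : s.var 5 = n + 1)
    (hr : ∀ i < n, s.arr 4 i = rank n (s.wt 0) i) (h0 : s.wt 1 = fun _ => 0) :
    Halts b V sumProg s ((n + 1) * (n * 5 + 6) + 3)
      fun s' => ∀ x ≤ n, s'.wt 1 x = smallSum n (s.wt 0) x := by
  classical
  refine (Halts.forVar (τ := n * 5 + 3) (fun x s' => (∀ x' < x, s'.wt 1 x' = smallSum n (s.wt 0) x') ∧
      ∀ x' ≥ x, s'.wt 1 x' = 0) (by decide) (by decide) (by decide) ?_ ?_ ?_).mono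
      (by rw [h5]) fun _ _ h => h
  · simp [h0]
  · intro x hx s₂ hf₂ h22 h25 hI
    have h21 : s₂.var 1 = n := (hf₂.var 1 (by decide)).trans hn
    have hw₂ : s₂.wt 0 = s.wt 0 := hf₂.wt 0 (by decide)
    have ha₂ : s₂.arr 4 = s.arr 4 := hf₂.arr 4 (by decide)
    refine (Halts.forVar (τ := 2) (fun J s' => (∀ x' < x, s'.wt 1 x' = smallSum n (s.wt 0) x') ∧
      s'.wt 1 x = (∑ i ∈ (Finset.range J).filter fun i => rank n (s.wt 0) i < x, s.wt 0 i) ∧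
      ∀ x' ≥ x + 1, s'.wt 1 x' = 0) (by decide) (by decide) (by decide) ?_ ?_ ?_).mono
      (by rw [h21]) fun _ _ h => h
    · exact ⟨hI.1, by simpa using hI.2 x le_rfl, fun x' hx' => hI.2 x' (by omega)⟩
    · rintro J hJ s₃ hf₃ h33 h31 ⟨hI1, hI2, hI3⟩
      have hw₃ : s₃.wt 0 = s.wt 0 := (hf₃.wt 0 (by decide)).trans hw₂
      have ha₃ : s₃.arr 4 = s.arr 4 := (hf₃.arr 4 (by decide)).trans ha₂
      have h32 : s₃.var 2 = x := (hf₃.var 2 (by decide)).trans h22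
      rw [h21] at hJ
      refine (Halts.of_wp ?_).mono (by simp [Cmd.size]) fun _ _ h => h
      simp only [Cmd.wp, Test.holds_lt, WtExpr.val, WordExpr.val, hw₃, h33, h32, ha₃, hr J hJ]
      rw [Finset.range_add_one, Finset.filter_insert]
      constructor
      · intro hp
        rw [if_pos hp, Finset.sum_insert (by simp)]
        simp only [State.wt_putVar, State.wt_putWt, if_true]
        refine ⟨fun x' hx' => ?_, ?_, fun x' hx' => ?_⟩
        · rw [Function.update_of_ne (by omega), hI1 x' hx']
        · rw [Function.update_self, hI2, add_comm]
        · rw [Function.update_of_ne (by omega), hI3 x' hx']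
      · intro hp
        rw [if_neg hp]
        exact ⟨hI1, hI2, hI3⟩
    · rintro s' _ _ _ ⟨hI1, hI2, hI3⟩
      refine ⟨fun x' hx' => ?_, hI3⟩
      rcases Nat.lt_succ_iff_lt_or_eq.1 hx' with h | rfl
      · exact hI1 x' h
      · rw [State.wt_putVar, hI2, h21, smallSum]
  · rintro s' _ _ _ ⟨hI, -⟩ x hx
    exact hI x (by omega)

end OptSkeleton

/-! ### The table of optimal plans -/

namespace OptSkeleton

variable {b V : ℕ}

/-! ### The lexicographic order of costs and numbers of blocks -/

theorem LexLE.refl (c : ℝ) (k : ℕ) : LexLE c k c k := .inr ⟨rfl, le_rfl⟩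

theorem LexLE.trans {c c' c'' : ℝ} {k k' k'' : ℕ} (h : LexLE c k c' k') (h' : LexLE c' k' c'' k'') :
    LexLE c k c'' k'' := by
  rcases h with h | ⟨rfl, h⟩
  · rcases h' with h' | ⟨rfl, h'⟩
    exacts [.inl (h.trans h'), .inl h]
  · rcases h' with h' | ⟨rfl, h'⟩
    exacts [.inl h', .inr ⟨rfl, h.trans h'⟩]

theorem LexLE.add_right {c c' : ℝ} {k k' : ℕ} (h : LexLE c k c' k') (a : ℝ) :
    LexLE (c + a) k (c' + a) k' := by
  rcases h with h | ⟨rfl, h⟩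
  exacts [.inl (by linarith), .inr ⟨rfl, h⟩]

theorem LexLE.succ {c c' : ℝ} {k k' : ℕ} (h : LexLE c k c' k') :
    LexLE c (k + 1) c' (k' + 1) := by
  rcases h with h | ⟨rfl, h⟩
  exacts [.inl h, .inr ⟨rfl, by omega⟩]

/-- The hypothesis is the strict lexicographic comparison, expressed by `≤` alone as in the
machine's tests. -/
theorem LexLE.of_test {c c' : ℝ} {k k' : ℕ} (h : c ≤ c' ∧ ¬ (c' ≤ c ∧ k' ≤ k)) :
    LexLE c k c' k' := by
  rcases h.1.lt_or_eq with h1 | h1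
  · exact .inl h1
  · refine .inr ⟨h1, ?_⟩
    by_contra hk
    exact h.2 ⟨h1.ge, by omega⟩

theorem LexLE.of_not_test {c c' : ℝ} {k k' : ℕ} (h : ¬ (c ≤ c' ∧ ¬ (c' ≤ c ∧ k' ≤ k))) :
    LexLE c' k' c k := by
  by_cases h1 : c ≤ c'
  · have h2 : c' ≤ c ∧ k' ≤ k := by
      by_contra h2
      exact h ⟨h1, h2⟩
    exact .inr ⟨h2.1.antisymm h1, h2.2⟩
  · exact .inl (not_le.1 h1)

/-- The index of the table cell for `x` symbols and `N` nodes. -/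
def cellIx (n x N : ℕ) : ℕ := x * (n + 1) + N

theorem cellIx_inj {n x N x' N' : ℕ} (hN : N ≤ n) (hN' : N' ≤ n) (h : cellIx n x N = cellIx n x' N') :
    x = x' ∧ N = N' := by
  unfold cellIx at h
  rcases lt_trichotomy x x' with hx | hx | hx
  · nlinarith
  · subst hx
    omega
  · nlinarith

/-- Placing `p` leaves moves diagonally in the table, by `p` rows of length `n + 1` and `p` columns.
-/
theorem cellIx_sub {n x N p : ℕ} (h : p ≤ N) (h' : N ≤ x) :
    cellIx n x N - p * (n + 1 + 1) = cellIx n (x - p) (N - p) := by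
  obtain ⟨N, rfl⟩ := Nat.exists_eq_add_of_le' h
  obtain ⟨x, rfl⟩ := Nat.exists_eq_add_of_le' (h.trans h')
  simp only [Nat.add_sub_cancel, cellIx]
  rw [Nat.sub_eq_iff_eq_add]
  · ring
  · nlinarith [Nat.zero_le (x * (n + 1))]

theorem cellIx_le {n x N : ℕ} (h : x ≤ n) (h' : N ≤ n) : cellIx n x N ≤ 4 * (n + 1) ^ 2 := by
  unfold cellIx
  nlinarith

/-- The value `(c, k)` of the cell `(x, N)` comes from the choice `(p, β)`: to descend if `p = 0`,
and to place a block of `p = 2 ^ β` leaves otherwise. -/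
def ChoiceOk (n : ℕ) (W C : ℕ → ℝ) (K : ℕ → ℕ) (x N : ℕ) (c : ℝ) (k p β : ℕ) : Prop :=
  (p = 0 ∧ 2 * N ≤ x ∧ c = C (cellIx n x (2 * N)) + W x ∧ k = K (cellIx n x (2 * N))) ∨
  (p = 2 ^ β ∧ p ≤ N ∧ (p < N ∨ x ≤ N) ∧ c = C (cellIx n (x - p) (N - p)) ∧
    k = K (cellIx n (x - p) (N - p)) + 1)

/-- A choice refers only to cells that come earlier in the order of computation, so writing the cell
`q`, which is not among them, does not invalidate it. -/
theorem ChoiceOk.congr {n : ℕ} {W C C' : ℕ → ℝ} {K K' : ℕ → ℕ} {x N : ℕ} {c : ℝ} {k p β : ℕ}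
    (h : ChoiceOk n W C K x N c k p β) {q : ℕ}
    (hC : ∀ i, i ≠ q → C' i = C i) (hK : ∀ i, i ≠ q → K' i = K i)
    (hq : ∀ x' N', N' ≤ x' → (x' < x ∨ x' = x ∧ N < N') → cellIx n x' N' ≠ q)
    (hN : 1 ≤ N) (hNx : N ≤ x) :
    ChoiceOk n W C' K' x N c k p β := by
  rcases h with ⟨h1, h2, h3, h4⟩ | ⟨h1, h2, h3, h4, h5⟩
  · have := hq x (2 * N) h2 (.inr ⟨rfl, by omega⟩)
    exact .inl ⟨h1, h2, by rw [hC _ this, h3], by rw [hK _ this, h4]⟩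
  · have hp := h1 ▸ Nat.one_le_two_pow (n := β)
    have := hq (x - p) (N - p) (by omega) (.inl (by omega))
    exact .inr ⟨h1, h2, h3, by rw [hC _ this, h4], by rw [hK _ this, h5]⟩

/-- The cell `(x, N)` of the table has the right contents. -/
structure CellOk (n : ℕ) (W : ℕ → ℝ) (s : State) (x N : ℕ) : Prop where
  lower : ∀ c k, Plan W x N c k → LexLE (s.wt 2 (cellIx n x N)) (s.arr 5 (cellIx n x N)) c k
  le : s.arr 5 (cellIx n x N) ≤ x
  choice : ChoiceOk n W (s.wt 2) (s.arr 5) x N (s.wt 2 (cellIx n x N)) (s.arr 5 (cellIx n x N))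
    (s.arr 6 (cellIx n x N)) (s.arr 15 (cellIx n x N))

/-- The table is right at `(0, 0)` and at the cells that precede `(x₀, N₀)`. -/
structure TableOk (n : ℕ) (W : ℕ → ℝ) (s : State) (x₀ N₀ : ℕ) : Prop where
  wt_zero : s.wt 2 0 = 0
  arr_zero : s.arr 5 0 = 0
  cell : ∀ x N, 1 ≤ N → N ≤ x → x ≤ n → (x < x₀ ∨ x = x₀ ∧ N₀ < N) → CellOk n W s x N

/-- The value of the cell `(x, N)` is at most the values that result from descending and from
placing blocks of less than `2 ^ β` leaves. -/
structure Best (n : ℕ) (W C : ℕ → ℝ) (K : ℕ → ℕ) (x N γ : ℕ) (c : ℝ) (k p β : ℕ) : Prop where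
  choice : ChoiceOk n W C K x N c k p β
  le : k ≤ x
  descend : 2 * N ≤ x → LexLE c k (C (cellIx n x (2 * N)) + W x) (K (cellIx n x (2 * N)))
  place : ∀ β' < γ, 2 ^ β' ≤ N → (2 ^ β' < N ∨ x ≤ N) →
    LexLE c k (C (cellIx n (x - 2 ^ β') (N - 2 ^ β'))) (K (cellIx n (x - 2 ^ β') (N - 2 ^ β')) + 1)

/-- `s'` results from `s` by writing a value and a choice into the cell `(x, N)`. -/
structure Written (n : ℕ) (s s' : State) (x N : ℕ) (c : ℝ) (k p β : ℕ) : Prop where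
  wt : s'.wt 2 = Function.update (s.wt 2) (cellIx n x N) c
  arr5 : s'.arr 5 = Function.update (s.arr 5) (cellIx n x N) k
  arr6 : s'.arr 6 = Function.update (s.arr 6) (cellIx n x N) p
  arr15 : s'.arr 15 = Function.update (s.arr 15) (cellIx n x N) β

theorem TableOk.congr {n : ℕ} {W : ℕ → ℝ} {s s' : State} {x N : ℕ} (h : TableOk n W s x N)
    (h2 : s'.wt 2 = s.wt 2) (h5 : s'.arr 5 = s.arr 5) (h6 : s'.arr 6 = s.arr 6)
    (h15 : s'.arr 15 = s.arr 15) : TableOk n W s' x N := by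
  refine ⟨by rw [h2, h.wt_zero], by rw [h5, h.arr_zero], fun x' N' g1 g2 g3 g4 => ?_⟩
  obtain ⟨k1, k2, k3⟩ := h.cell x' N' g1 g2 g3 g4
  rw [← h2, ← h5] at k1 k3
  rw [← h5] at k2
  rw [← h6, ← h15] at k3
  exact ⟨k1, k2, k3⟩

theorem TableOk.le {n : ℕ} {W : ℕ → ℝ} {s : State} {x₀ N₀ : ℕ} (h : TableOk n W s x₀ N₀)
    {x N : ℕ} (hNx : N ≤ x) (hN : N = 0 → x = 0) (hx : x ≤ n)
    (hlt : x < x₀ ∨ x = x₀ ∧ N₀ < N) : s.arr 5 (cellIx n x N) ≤ x := by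
  rcases Nat.eq_zero_or_pos N with h0 | h0
  · rw [hN h0, h0]
    simp [cellIx, h.arr_zero]
  · exact (h.cell x N h0 hNx hx hlt).le

theorem TableOk.lower {n : ℕ} {W : ℕ → ℝ} (hW : ∀ x, 0 ≤ W x) {s : State} {x₀ N₀ : ℕ}
    (h : TableOk n W s x₀ N₀) {x N : ℕ} {c : ℝ} {k : ℕ} (hp : Plan W x N c k) (hx : x ≤ n)
    (hlt : x < x₀ ∨ x = x₀ ∧ N₀ < N) :
    LexLE (s.wt 2 (cellIx n x N)) (s.arr 5 (cellIx n x N)) c k := by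
  have hle := hp.le
  rcases Nat.eq_zero_or_pos N with h0 | h0
  · have hc := hp.nonneg hW
    rw [hle.2 h0, h0]
    simp only [cellIx, Nat.zero_mul, Nat.zero_add, h.wt_zero, h.arr_zero]
    rcases hc.lt_or_eq with hc | hc
    exacts [.inl hc, .inr ⟨hc, Nat.zero_le _⟩]
  · exact (h.cell x N h0 hle.1 hx hlt).lower c k hp

/-- Bellman's principle: a plan for `(x, N)` starts with a descent or a placement, and its rest is a
plan for an earlier cell, whose value is a lower bound. Since `N < 2 ^ γ`, all possible block sizes
have been considered. -/
theorem TableOk.write {n : ℕ} {W : ℕ → ℝ} (hW : ∀ x, 0 ≤ W x) {s s' : State} {x N : ℕ}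
    (h : TableOk n W s x N) (hN : 1 ≤ N) (hNx : N ≤ x) (hx : x ≤ n) {γ : ℕ} (hγ : N < 2 ^ γ)
    {c : ℝ} {k p β : ℕ} (hw : Written n s s' x N c k p β)
    (hb : Best n W (s.wt 2) (s.arr 5) x N γ c k p β) : TableOk n W s' x (N - 1) := by
  have hq : ∀ x' N', N' ≤ x' → (x' < x ∨ x' = x ∧ N < N') → x' ≤ n →
      cellIx n x' N' ≠ cellIx n x N := by
    intro x' N' h1 h2 h3 h4
    have := cellIx_inj (by omega) (by omega) h4
    omega
  have hq0 : 0 ≠ cellIx n x N := by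
    unfold cellIx
    omega
  refine ⟨by rw [hw.wt, Function.update_of_ne hq0, h.wt_zero],
    by rw [hw.arr5, Function.update_of_ne hq0, h.arr_zero], fun x' N' h1 h2 h3 h4 => ?_⟩
  have hC : ∀ i, i ≠ cellIx n x N → s'.wt 2 i = s.wt 2 i := fun i hi => by
    rw [hw.wt, Function.update_of_ne hi]
  have hK : ∀ i, i ≠ cellIx n x N → s'.arr 5 i = s.arr 5 i := fun i hi => by
    rw [hw.arr5, Function.update_of_ne hi]
  by_cases h5 : x' < x ∨ x' = x ∧ N < N'
  · have hc := h.cell x' N' h1 h2 h3 h5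
    have hne := hq x' N' h2 h5 h3
    refine ⟨?_, ?_, ?_⟩
    · rw [hC _ hne, hK _ hne]
      exact hc.lower
    · rw [hK _ hne]
      exact hc.le
    · rw [hC _ hne, hK _ hne, hw.arr6, hw.arr15, Function.update_of_ne hne,
        Function.update_of_ne hne]
      exact hc.choice.congr hC hK (fun x'' N'' g1 g2 => hq x'' N'' g1 (by omega) (by omega)) h1 h2
  · obtain ⟨rfl, rfl⟩ : x' = x ∧ N' = N := by omega
    refine ⟨?_, ?_, ?_⟩
    · rw [hw.wt, hw.arr5, Function.update_self, Function.update_self]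
      intro c' k' hp
      cases hp with
      | done => omega
      | descend hp =>
        exact (hb.descend hp.le.1).trans ((h.lower hW hp h3 (.inr ⟨rfl, by omega⟩)).add_right _)
      | @place β' x₁ N₁ _ _ hp =>
        have hpos := Nat.one_le_two_pow (n := β')
        have hlt : β' < γ := (Nat.pow_lt_pow_iff_right (by omega : 1 < 2)).1
          (lt_of_le_of_lt (by omega) hγ)
        have := hb.place β' hlt (by omega) (by have := hp.le; omega)
        simp only [Nat.add_sub_cancel] at this
        exact this.trans (h.lower hW hp (by omega) (.inl (by omega))).succ
    · rw [hw.arr5, Function.update_self]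
      exact hb.le
    · have key := hb.choice.congr hC hK
        (fun x'' N'' g1 g2 => hq x'' N'' g1 (by omega) (by omega)) h1 h2
      rw [hw.wt, hw.arr5, hw.arr6, hw.arr15] at *
      simp only [Function.update_self]
      exact key

/-- Initialize the cell with index in variable `7`. -/
def cellInit : Cmd :=
  .ite (.le (.op .mul (.const 2) (.var 6)) (.var 2))
    (.seq (.setWt 2 (.var 7) (.add (.cell 2 (.op .add (.var 7) (.var 6))) (.cell 1 (.var 2))))
      (.seq (.setArr 5 (.var 7) (.arr 5 (.op .add (.var 7) (.var 6))))
        (.seq (.setArr 6 (.var 7) (.const 0)) (.setArr 15 (.var 7) (.const 0)))))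
    (.seq (.setWt 2 (.var 7) (.cell 2 (.op .sub (.var 7)
        (.op .mul (.const 1) (.op .add (.var 5) (.const 1))))))
      (.seq (.setArr 5 (.var 7) (.op .add (.arr 5 (.op .sub (.var 7)
          (.op .mul (.const 1) (.op .add (.var 5) (.const 1))))) (.const 1)))
        (.seq (.setArr 6 (.var 7) (.const 1)) (.setArr 15 (.var 7) (.const 0)))))

/-- Try to improve the cell by placing a block whose size is in variable `8`. -/
def cellTry : Cmd :=
  .seq (.ite (.not (.and (.le (.var 6) (.var 8)) (.not (.le (.var 2) (.var 6)))))
      (.seq (.setVar 10 (.op .sub (.var 7) (.op .mul (.var 8) (.op .add (.var 5) (.const 1)))))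
        (.ite (.and (.wtLe (.cell 2 (.var 10)) (.cell 2 (.var 7)))
            (.not (.and (.wtLe (.cell 2 (.var 7)) (.cell 2 (.var 10)))
              (.le (.arr 5 (.var 7)) (.op .add (.arr 5 (.var 10)) (.const 1))))))
          (.seq (.setWt 2 (.var 7) (.cell 2 (.var 10)))
            (.seq (.setArr 5 (.var 7) (.op .add (.arr 5 (.var 10)) (.const 1)))
              (.seq (.setArr 6 (.var 7) (.var 8)) (.setArr 15 (.var 7) (.var 9)))))
          .skip))
      .skip)
    (.seq (.setVar 8 (.op .mul (.const 2) (.var 8))) (.setVar 9 (.op .add (.var 9) (.const 1))))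

/-- Compute the cell of the table for `x` in variable `2` and `N = x - y`, `y` in variable `3`. -/
def cellProg : Cmd :=
  .seq (.seq (.setVar 6 (.op .sub (.var 2) (.var 3)))
    (.seq (.setVar 7 (.op .add (.op .mul (.var 2) (.var 5)) (.var 6)))
      (.seq (.setVar 8 (.const 1)) (.setVar 9 (.const 0)))))
    (.seq cellInit (.loop (.le (.var 8) (.var 6)) cellTry))

/-- Compute the table. -/
def tableProg : Cmd := .forVar 2 5 (.forVar 3 2 cellProg)

theorem cellInit_wp {n : ℕ} (hV : 4 * (n + 1) ^ 2 ≤ V) {W : ℕ → ℝ} {s : State} {x N : ℕ}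
    (h : TableOk n W s x N) (hN : 1 ≤ N) (hNx : N ≤ x) (hx : x ≤ n) (h2 : s.var 2 = x)
    (h5 : s.var 5 = n + 1) (h6 : s.var 6 = N) (h7 : s.var 7 = cellIx n x N)
    (hw : s.wt 1 x = W x) :
    cellInit.wp V s fun s' => ∃ c k p β, Written n s s' x N c k p β ∧
      Best n W (s.wt 2) (s.arr 5) x N 0 c k p β := by
  have hV' : n + 2 ≤ V := by nlinarith
  have e1 : cellIx n x N + N = cellIx n x (2 * N) := by
    unfold cellIx
    ring
  have e2 : cellIx n x N - (n + 1 + 1) = cellIx n (x - 1) (N - 1) := by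
    simpa using cellIx_sub (n := n) (p := 1) hN hNx
  have l1 : 2 * N ≤ x → s.arr 5 (cellIx n x (2 * N)) ≤ x := fun h' =>
    h.le h' (by omega) hx (.inr ⟨rfl, by omega⟩)
  have l2 : ¬ 2 * N ≤ x → s.arr 5 (cellIx n (x - 1) (N - 1)) ≤ x - 1 := fun h' =>
    h.le (by omega) (by omega) (by omega) (.inl (by omega))
  have hne : 2 * N ≤ x → cellIx n x (2 * N) ≠ cellIx n x N := by
    intro _ h'
    unfold cellIx at h'
    omega
  have hne' : cellIx n (x - 1) (N - 1) ≠ cellIx n x N := by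
    unfold cellIx
    have : (x - 1) * (n + 1) ≤ x * (n + 1) := Nat.mul_le_mul_right _ (by omega)
    omega
  simp only [cellInit, Cmd.wp, Test.Holds, WordExpr.val, WtExpr.val, Op.app, h2, h5, h6, h7,
    State.var_putWt, State.var_putArr, State.arr_putWt, one_mul, e1, e2, hw]
  constructor
  · intro hp
    refine ⟨by have := l1 hp; omega, by omega, by omega, s.wt 2 (cellIx n x (2 * N)) + W x,
      s.arr 5 (cellIx n x (2 * N)), 0, 0, ⟨?_, ?_, ?_, ?_⟩, ⟨?_, ?_, ?_, ?_⟩⟩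
    rotate_left 4
    · exact .inl ⟨rfl, hp, rfl, rfl⟩
    · exact l1 hp
    · exact fun _ => LexLE.refl _ _
    · exact fun _ h => absurd h (by omega)
    all_goals simp
  · intro hp
    refine ⟨by have := l2 hp; omega, by omega, by omega, s.wt 2 (cellIx n (x - 1) (N - 1)),
      s.arr 5 (cellIx n (x - 1) (N - 1)) + 1, 1, 0, ⟨?_, ?_, ?_, ?_⟩, ⟨?_, ?_, ?_, ?_⟩⟩
    rotate_left 4
    · exact .inr ⟨(pow_zero 2).symm, hN, by omega, rfl, rfl⟩
    · have := l2 hp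
      omega
    · exact fun h => absurd h hp
    · exact fun _ h => absurd h (by omega)
    all_goals simp

theorem cellTry_wp {n : ℕ} (hV : 4 * (n + 1) ^ 2 ≤ V) {W : ℕ → ℝ} {s s₁ : State} {x N γ : ℕ}
    (h : TableOk n W s x N) (hN : 1 ≤ N) (hNx : N ≤ x) (hx : x ≤ n) (h2 : s₁.var 2 = x)
    (h5 : s₁.var 5 = n + 1) (h6 : s₁.var 6 = N) (h7 : s₁.var 7 = cellIx n x N)
    (h8 : s₁.var 8 = 2 ^ γ) (h9 : s₁.var 9 = γ) (hγ : 2 ^ γ ≤ N) {c : ℝ} {k p β : ℕ}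
    (hw : Written n s s₁ x N c k p β) (hb : Best n W (s.wt 2) (s.arr 5) x N γ c k p β) :
    cellTry.wp V s₁ fun s' => s'.var 8 = 2 ^ (γ + 1) ∧ s'.var 9 = γ + 1 ∧
      ∃ c k p β, Written n s s' x N c k p β ∧
        Best n W (s.wt 2) (s.arr 5) x N (γ + 1) c k p β := by
  have hV' : 2 * n + 2 ≤ V := by nlinarith
  have hγn : γ < 2 ^ γ := Nat.lt_two_pow_self
  have hpos := Nat.one_le_two_pow (n := γ)
  have hc7 := cellIx_le (n := n) (x := x) (N := N) hx (by omega)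
  have e2 := cellIx_sub (n := n) hγ hNx
  have hne : cellIx n (x - 2 ^ γ) (N - 2 ^ γ) ≠ cellIx n x N := by
    intro h'
    have := cellIx_inj (by omega) (by omega) h'
    omega
  have w1 : s₁.wt 2 (cellIx n (x - 2 ^ γ) (N - 2 ^ γ)) = s.wt 2 (cellIx n (x - 2 ^ γ) (N - 2 ^ γ)) := by
    rw [hw.wt, Function.update_of_ne hne]
  have w2 : s₁.arr 5 (cellIx n (x - 2 ^ γ) (N - 2 ^ γ)) = s.arr 5 (cellIx n (x - 2 ^ γ) (N - 2 ^ γ)) := by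
    rw [hw.arr5, Function.update_of_ne hne]
  have w3 : s₁.wt 2 (cellIx n x N) = c := by rw [hw.wt, Function.update_self]
  have w4 : s₁.arr 5 (cellIx n x N) = k := by rw [hw.arr5, Function.update_self]
  have hsucc : ∀ c' k' p' β', (LexLE c' k' c k) → ChoiceOk n W (s.wt 2) (s.arr 5) x N c' k' p' β' →
      k' ≤ x → ((2 ^ γ < N ∨ x ≤ N) → LexLE c' k' (s.wt 2 (cellIx n (x - 2 ^ γ) (N - 2 ^ γ)))
        (s.arr 5 (cellIx n (x - 2 ^ γ) (N - 2 ^ γ)) + 1)) →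
      Best n W (s.wt 2) (s.arr 5) x N (γ + 1) c' k' p' β' := by
    intro c' k' p' β' g1 g2 g3 g4
    refine ⟨g2, g3, fun h => g1.trans (hb.descend h), fun β' hβ' hle hc => ?_⟩
    rcases Nat.lt_succ_iff_lt_or_eq.1 hβ' with h' | rfl
    · exact g1.trans (hb.place β' h' hle hc)
    · exact g4 hc
  have hle10 : cellIx n (x - 2 ^ γ) (N - 2 ^ γ) ≤ V := (cellIx_le (by omega) (by omega)).trans hV
  simp only [cellTry, Cmd.wp, Test.Holds, WordExpr.val, WtExpr.val, Op.app, h2, h5, h6, h7, h8, h9,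
    State.var_putWt, State.var_putArr, State.arr_putWt,
    State.var_putVar, State.arr_putVar, State.wt_putVar, e2, if_true, w1, w2, w3, w4,
    Nat.reduceEqDiff, if_false]
  constructor
  · intro hp
    refine ⟨hle10, ?_, ?_⟩
    · intro ht
      have hl : s.arr 5 (cellIx n (x - 2 ^ γ) (N - 2 ^ γ)) ≤ x - 2 ^ γ :=
        h.le (by omega) (by omega) (by omega) (.inl (by omega))
      refine ⟨by omega, by omega, by omega, by omega, by omega, by rw [pow_succ, mul_comm], trivial,
        s.wt 2 (cellIx n (x - 2 ^ γ) (N - 2 ^ γ)), s.arr 5 (cellIx n (x - 2 ^ γ) (N - 2 ^ γ)) + 1,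
        2 ^ γ, γ, ⟨?_, ?_, ?_, ?_⟩, ?_⟩
      rotate_left 4
      · exact hsucc _ _ _ _ (LexLE.of_test ht) (.inr ⟨rfl, hγ, by omega, rfl, rfl⟩) (by omega)
          fun _ => LexLE.refl _ _
      · simp [hw.wt]
      · simp [hw.arr5]
      · simp [hw.arr6]
      · simp [hw.arr15]
    · intro ht
      exact ⟨by omega, by omega, by rw [pow_succ, mul_comm], trivial, c, k, p, β,
        ⟨hw.wt, hw.arr5, hw.arr6, hw.arr15⟩,
        hsucc _ _ _ _ (LexLE.refl _ _) hb.choice hb.le fun _ => LexLE.of_not_test ht⟩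
  · intro hp
    exact ⟨by omega, by omega, by rw [pow_succ, mul_comm], trivial, c, k, p, β,
      ⟨hw.wt, hw.arr5, hw.arr6, hw.arr15⟩,
      hsucc _ _ _ _ (LexLE.refl _ _) hb.choice hb.le fun h' => absurd hp (by omega)⟩

theorem cellProg_halts {n : ℕ} (hV : 4 * (n + 1) ^ 2 ≤ V) {W : ℕ → ℝ} (hW : ∀ x, 0 ≤ W x)
    {s : State} {x N : ℕ} (h : TableOk n W s x N) (hN : 1 ≤ N) (hNx : N ≤ x) (hx : x ≤ n)
    (h2 : s.var 2 = x) (h3 : s.var 3 = x - N) (h5 : s.var 5 = n + 1) (hw : s.wt 1 x = W x) :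
    Halts b V cellProg s ((Nat.log 2 n + 1) * 20 + 20)
      fun s' => TableOk n W s' x (N - 1) := by
  have hV' : 2 * n + 2 ≤ V := by nlinarith
  have hc7 := cellIx_le (n := n) (x := x) (N := N) hx (by omega)
  have e6 : x - (x - N) = N := by omega
  have e7 : x * (n + 1) + N = cellIx n x N := rfl
  refine ((Halts.of_wp (Q := fun s' => s'.var 6 = N ∧ s'.var 7 = cellIx n x N ∧ s'.var 8 = 1 ∧
    s'.var 9 = 0) ?_).seq (t' := (Nat.log 2 n + 1) * 20 + 12)
    ?_).mono (by simp [Cmd.size]; omega) fun _ _ h => h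
  · simp only [Cmd.wp, WordExpr.val, Op.app, h2, h3, h5, State.var_putVar,
      Nat.reduceEqDiff, if_true, if_false, e6, e7]
    exact ⟨by omega, by omega, by omega, by omega, trivial, trivial, trivial, trivial⟩
  rintro s₁ hf₁ ⟨h16, h17, h18, h19⟩
  have h12 : s₁.var 2 = x := (hf₁.var 2 (by decide)).trans h2
  have h15 : s₁.var 5 = n + 1 := (hf₁.var 5 (by decide)).trans h5
  have ht : TableOk n W s₁ x N := h.congr (hf₁.wt 2 (by decide)) (hf₁.arr 5 (by decide))
    (hf₁.arr 6 (by decide)) (hf₁.arr 15 (by decide))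
  refine ((Halts.of_wp (cellInit_wp hV ht hN hNx hx h12 h15 h16 h17
    (by rw [hf₁.wt 1 (by decide), hw]))).seq (t' := (Nat.log 2 N + 1) * (19 + 1) + 1) ?_).mono ?_
    fun _ _ h => h
  · rintro s₂ hf₂ hI
    -- After `γ` passes the blocks of fewer than `2 ^ γ` leaves have been tried; the test `2 ^ γ ≤
    -- N` succeeds only for `γ ≤ Nat.log 2 N`.
    refine (Halts.loop (τ := 19) (m := Nat.log 2 N + 1) (fun m s' => ∃ γ, γ + m = Nat.log 2 N + 1 ∧
      s'.var 8 = 2 ^ γ ∧ s'.var 9 = γ ∧ ∃ c k p β, Written n s₁ s' x N c k p β ∧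
        Best n W (s₁.wt 2) (s₁.arr 5) x N γ c k p β) ?_ ?_ ?_)
    · exact ⟨0, by omega, by rw [hf₂.var 8 (by decide), h18, pow_zero],
        by rw [hf₂.var 9 (by decide), h19], hI⟩
    · rintro m s₃ hf₃ ⟨γ, hm, g8, g9, c, k, p, β, gw, gb⟩ hp
      have g2 : s₃.var 2 = x := by rw [hf₃.var 2 (by decide), hf₂.var 2 (by decide), h12]
      have g5 : s₃.var 5 = n + 1 := by rw [hf₃.var 5 (by decide), hf₂.var 5 (by decide), h15]
      have g6 : s₃.var 6 = N := by rw [hf₃.var 6 (by decide), hf₂.var 6 (by decide), h16]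
      have g7 : s₃.var 7 = cellIx n x N := by
        rw [hf₃.var 7 (by decide), hf₂.var 7 (by decide), h17]
      simp only [Test.Holds, WordExpr.val, g8, g6] at hp
      have hγ := Nat.le_log_of_pow_le (by omega) hp
      refine ⟨m - 1, by omega, (Halts.of_wp (cellTry_wp hV ht hN hNx hx g2 g5 g6 g7 g8 g9 hp
        gw gb)).mono (by simp [Cmd.size, cellTry]) ?_⟩
      rintro s₄ - ⟨k8, k9, k⟩
      exact ⟨γ + 1, by omega, k8, k9, k⟩
    · rintro m s₃ hf₃ ⟨γ, hm, g8, g9, c, k, p, β, gw, gb⟩ hp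
      have g6 : s₃.var 6 = N := by rw [hf₃.var 6 (by decide), hf₂.var 6 (by decide), h16]
      simp only [Test.Holds, WordExpr.val, g8, g6, not_le] at hp
      exact ht.write hW hN hNx hx hp gw gb
  · have : Nat.log 2 N ≤ Nat.log 2 n := Nat.log_mono_right (hNx.trans hx)
    simp [Cmd.size, cellInit]
    omega

/-- Rows are computed by increasing `x`, and within a row by decreasing `N`, because descending
refers to `(x, 2 * N)` and placing to a smaller `x`. -/
theorem tableProg_halts {n : ℕ} (hV : 4 * (n + 1) ^ 2 ≤ V) {W : ℕ → ℝ} (hW : ∀ x, 0 ≤ W x)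
    {s : State} (h5 : s.var 5 = n + 1) (hw : ∀ x ≤ n, s.wt 1 x = W x) (h2 : s.wt 2 0 = 0)
    (ha : s.arr 5 0 = 0) :
    Halts b V tableProg s ((n + 1) * (n * ((Nat.log 2 n + 1) * 20 + 23) + 6) + 3)
      fun s' => TableOk n W s' (n + 1) 0 := by
  refine (Halts.forVar (τ := n * ((Nat.log 2 n + 1) * 20 + 23) + 3)
    (fun x s' => TableOk n W s' x x) (by decide) (by decide) (by decide) ?_ ?_ ?_).mono
    (by rw [h5]) fun _ _ h => h
  · exact ⟨h2, ha, fun x N _ _ _ h => by omega⟩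
  · intro x hx s₁ hf₁ h12 h15 hI
    rw [h5] at hx h15
    refine (Halts.forVar (τ := (Nat.log 2 n + 1) * 20 + 20)
      (fun y s' => TableOk n W s' x (x - y)) (by decide) (by decide) (by decide) ?_ ?_ ?_).mono
      ?_ fun _ _ h => h
    · exact hI.congr rfl rfl rfl rfl
    · intro y hy s₂ hf₂ h23 h22 hI'
      rw [h12] at hy h22
      refine (cellProg_halts hV hW hI' (by omega) (by omega) (by omega) h22 (by omega)
        (by rw [hf₂.var 5 (by decide), h15]) ?_).mono le_rfl ?_
      · rw [hf₂.wt 1 (by decide), hf₁.wt 1 (by decide), hw x (by omega)]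
      · intro s₃ _ hs₃
        rw [show x - (y + 1) = x - y - 1 by omega]
        exact hs₃.congr rfl rfl rfl rfl
    · intro s₂ _ _ _ hI'
      rw [h12, Nat.sub_self] at hI'
      have h' := hI'.congr (s' := s₂.putVar 2 (x + 1)) rfl rfl rfl rfl
      -- No cell of the row `x + 1` has `N > x + 1`, so the end of one row is the start of the next.
      exact ⟨h'.wt_zero, h'.arr_zero, fun x' N' k1 k2 k3 k4 => h'.cell x' N' k1 k2 k3 (by omega)⟩
    · rw [h12]
      have : x * ((Nat.log 2 n + 1) * 20 + 20 + 3) ≤ n * ((Nat.log 2 n + 1) * 20 + 20 + 3) :=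
        Nat.mul_le_mul_right _ (by omega)
      exact Nat.add_le_add_right this 3
  · intro s₁ _ _ _ hI
    rw [h5] at hI
    exact ⟨hI.wt_zero, hI.arr_zero, fun x' N' k1 k2 k3 k4 => hI.cell x' N' k1 k2 k3 (by omega)⟩

end OptSkeleton

/-! ### Extracting the perfect subtrees of an optimal code from the table -/

namespace OptSkeleton

variable {b V : ℕ}

/-- The symbols of rank at least `x` are divided into `r` blocks; the `k`th block consists of the
`P k = 2 ^ B k` symbols of rank at least `F k`, which form a perfect subtree of height `B k` with
root at depth `E k`. The depths of the leaves are given by `L`, and `L ρ = d` for `ρ < x`. -/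
structure BlocksFrom (n x r d : ℕ) (E P B F L : ℕ → ℕ) : Prop where
  pow : ∀ k < r, P k = 2 ^ B k
  top : ∀ k < r, F k + P k ≤ n
  bot : ∀ k < r, x ≤ F k
  disjoint : ∀ k k', k < k' → k' < r → F k' + P k' ≤ F k
  cover : ∀ ρ, x ≤ ρ → ρ < n → ∃ k < r, F k ≤ ρ ∧ ρ < F k + P k
  length_le : ∀ k < r, E k + B k ≤ n
  depth : ∀ k < r, ∀ ρ, F k ≤ ρ → ρ < F k + P k → L ρ = E k + B k
  rest : ∀ ρ < x, L ρ = d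

/-- The depths of the unplaced symbols are provisional: they grow with every descent and become
final when a block is placed. -/
theorem BlocksFrom.descend {n x r d : ℕ} {E P B F L : ℕ → ℕ} (h : BlocksFrom n x r d E P B F L) :
    BlocksFrom n x r (d + 1) E P B F fun ρ => if ρ < x then d + 1 else L ρ := by
  refine ⟨h.pow, h.top, h.bot, h.disjoint, h.cover, h.length_le, fun k hk ρ h1 h2 => ?_,
    fun ρ hρ => if_pos hρ⟩
  have := h.bot k hk
  rw [if_neg (by omega), h.depth k hk ρ h1 h2]

theorem BlocksFrom.place {n x r d : ℕ} {E P B F L : ℕ → ℕ} (h : BlocksFrom n x r d E P B F L)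
    {β : ℕ} (hx : 2 ^ β ≤ x) (hxn : x ≤ n) (hβ : β ≤ d) (hd : d ≤ n) :
    BlocksFrom n (x - 2 ^ β) (r + 1) d (Function.update E r (d - β))
      (Function.update P r (2 ^ β)) (Function.update B r β) (Function.update F r (x - 2 ^ β)) L := by
  generalize hp : 2 ^ β = p at *
  have hne : ∀ k < r, k ≠ r := fun k hk => hk.ne
  refine ⟨fun k hk => ?_, fun k hk => ?_, fun k hk => ?_, fun k k' hk hk' => ?_, fun ρ h1 h2 => ?_,
    fun k hk => ?_, fun k hk => ?_, fun ρ hρ => h.rest ρ (by omega)⟩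
  · rcases Nat.lt_succ_iff_lt_or_eq.1 hk with hk | rfl
    · simpa [hne k hk] using h.pow k hk
    · simp [hp]
  · rcases Nat.lt_succ_iff_lt_or_eq.1 hk with hk | rfl
    · simpa [hne k hk] using h.top k hk
    · simp only [Function.update_self]
      omega
  · rcases Nat.lt_succ_iff_lt_or_eq.1 hk with hk | rfl
    · have := h.bot k hk
      simp only [Function.update_of_ne (hne k hk)]
      omega
    · simp
  · rcases Nat.lt_succ_iff_lt_or_eq.1 hk' with hk' | rfl
    · simpa [hne k' hk', hne k (hk.trans hk')] using h.disjoint k k' hk hk'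
    · have := h.bot k hk
      simp only [Function.update_self, Function.update_of_ne (hne k hk)]
      omega
  · by_cases hρ : x ≤ ρ
    · obtain ⟨k, hk, h3⟩ := h.cover ρ hρ h2
      exact ⟨k, by omega, by simpa [hne k hk] using h3⟩
    · refine ⟨r, by omega, ?_⟩
      simp only [Function.update_self]
      omega
  · rcases Nat.lt_succ_iff_lt_or_eq.1 hk with hk | rfl
    · simpa [hne k hk] using h.length_le k hk
    · simp only [Function.update_self]
      omega
  · rcases Nat.lt_succ_iff_lt_or_eq.1 hk with hk | rfl
    · simpa [hne k hk] using h.depth k hk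
    · simp only [Function.update_self]
      intro ρ h1 h2
      rw [h.rest ρ (by omega)]
      omega

/-- The state `(x, N)` at depth `d` of an optimal plan has been reached, after placing `r` blocks,
which are stored in word arrays `7` to `10`. -/
structure Reached (n : ℕ) (w : ℕ → ℝ) (s : State) (x N d r : ℕ) (L : ℕ → ℕ) : Prop where
  blocks : BlocksFrom n x r d (s.arr 7) (s.arr 8) (s.arr 9) (s.arr 10) L
  le : N ≤ x
  pos : N = 0 → x = 0
  le_n : x ≤ n
  depth_le : d + x + 1 ≤ n + N
  count_le : r + x ≤ n
  kraft : ∑ k ∈ Finset.range r, (1 / 2 : ℚ) ^ s.arr 7 k + N * (1 / 2 : ℚ) ^ d = 1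
  cost : s.wt 2 (cellIx n n 1) = ∑ i ∈ Finset.range n, (L (rank n w i) : ℝ) * w i +
    s.wt 2 (cellIx n x N)
  count : s.arr 5 (cellIx n n 1) = r + s.arr 5 (cellIx n x N)

/-- The `x` unplaced symbols are those of smallest rank, so lengthening their codewords by one costs
exactly `smallSum n w x`. The Kraft sum is unchanged because twice as many nodes count half as much.
-/
theorem Reached.descend {n : ℕ} {w : ℕ → ℝ} {s s' : State} {x N d r : ℕ} {L : ℕ → ℕ}
    (h : Reached n w s x N d r L) (hN : 1 ≤ N) (hNx : 2 * N ≤ x)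
    (hc : s.wt 2 (cellIx n x N) = s.wt 2 (cellIx n x (2 * N)) + smallSum n w x)
    (hk : s.arr 5 (cellIx n x N) = s.arr 5 (cellIx n x (2 * N)))
    (ha : s'.arr = s.arr) (hw : s'.wt = s.wt) :
    Reached n w s' x (2 * N) (d + 1) r fun ρ => if ρ < x then d + 1 else L ρ := by
  have := h.depth_le
  refine ⟨?_, hNx, by omega, h.le_n, by omega, h.count_le, ?_, ?_, ?_⟩
  · rw [ha]
    exact h.blocks.descend
  · rw [ha]
    push_cast
    linear_combination h.kraft
  · have key : ∑ i ∈ Finset.range n, ((if rank n w i < x then d + 1 else L (rank n w i) : ℕ) : ℝ) * w i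
        = ∑ i ∈ Finset.range n, (L (rank n w i) : ℝ) * w i + smallSum n w x := by
      rw [smallSum, Finset.sum_filter, ← Finset.sum_add_distrib]
      refine Finset.sum_congr rfl fun i _ => ?_
      split_ifs with hi
      · rw [h.blocks.rest _ hi]
        push_cast
        ring
      · ring
    rw [hw, key, h.cost, hc]
    ring
  · rw [ha, h.count, hk]

/-- The available nodes contribute at most `1` to the Kraft sum. For a block of `2 ^ β ≤ N` leaves
this gives `β ≤ d`, so the depth `d - β` of its root is not truncated. -/
theorem Reached.le_two_pow {n : ℕ} {w : ℕ → ℝ} {s : State} {x N d r : ℕ} {L : ℕ → ℕ}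
    (h : Reached n w s x N d r L) : N ≤ 2 ^ d := by
  have h1 : 0 ≤ ∑ k ∈ Finset.range r, (1 / 2 : ℚ) ^ s.arr 7 k :=
    Finset.sum_nonneg fun _ _ => by positivity
  have h2 : (N : ℚ) * (1 / 2) ^ d ≤ 1 := by linarith [h.kraft]
  rw [one_div, inv_pow, ← div_eq_mul_inv, div_le_one (by positivity)] at h2
  exact_mod_cast h2

theorem Reached.place {n : ℕ} {w : ℕ → ℝ} {s s' : State} {x N d r β : ℕ} {L : ℕ → ℕ}
    (h : Reached n w s x N d r L) (hN : 2 ^ β ≤ N) (hv : 2 ^ β < N ∨ x ≤ N)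
    (hc : s.wt 2 (cellIx n x N) = s.wt 2 (cellIx n (x - 2 ^ β) (N - 2 ^ β)))
    (hk : s.arr 5 (cellIx n x N) = s.arr 5 (cellIx n (x - 2 ^ β) (N - 2 ^ β)) + 1)
    (h5 : s'.arr 5 = s.arr 5) (h7 : s'.arr 7 = Function.update (s.arr 7) r (d - β))
    (h8 : s'.arr 8 = Function.update (s.arr 8) r (2 ^ β))
    (h9 : s'.arr 9 = Function.update (s.arr 9) r β)
    (h10 : s'.arr 10 = Function.update (s.arr 10) r (x - 2 ^ β)) (hw : s'.wt = s.wt) :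
    Reached n w s' (x - 2 ^ β) (N - 2 ^ β) d (r + 1) L := by
  have hβ : β ≤ d := by
    have := hN.trans h.le_two_pow
    exact (Nat.pow_le_pow_iff_right (by omega)).1 this
  have := h.depth_le
  have := h.le
  have := h.le_n
  have := h.count_le
  have hpos := Nat.one_le_two_pow (n := β)
  refine ⟨?_, by omega, by omega, by omega, by omega, by omega, ?_, ?_, ?_⟩
  · rw [h7, h8, h9, h10]
    exact h.blocks.place (by omega) h.le_n hβ (by omega)
  · have e1 : ∑ k ∈ Finset.range r, (1 / 2 : ℚ) ^ Function.update (s.arr 7) r (d - β) k =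
        ∑ k ∈ Finset.range r, (1 / 2 : ℚ) ^ s.arr 7 k :=
      Finset.sum_congr rfl fun k hk => by
        rw [Function.update_of_ne (Finset.mem_range.1 hk).ne]
    have e2 : (1 / 2 : ℚ) ^ (d - β) = 2 ^ β * (1 / 2) ^ d := by
      obtain ⟨e, rfl⟩ := Nat.exists_eq_add_of_le hβ
      rw [Nat.add_sub_cancel_left, pow_add, ← mul_assoc, ← mul_pow]
      norm_num
    rw [h7, Finset.sum_range_succ, e1, Function.update_self, e2, Nat.cast_sub hN]
    push_cast
    linear_combination h.kraft
  · rw [hw, h.cost, hc]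
  · rw [h5, h.count, hk]
    omega

/-- One step of an optimal plan. -/
def blockStep : Cmd :=
  .seq (.setVar 7 (.op .add (.op .mul (.var 11) (.var 5)) (.var 12)))
    (.seq (.setVar 8 (.arr 6 (.var 7)))
      (.ite (.le (.var 8) (.const 0))
        (.seq (.setVar 12 (.op .mul (.const 2) (.var 12)))
          (.setVar 13 (.op .add (.var 13) (.const 1))))
        (.seq (.setArr 7 (.var 14) (.op .sub (.var 13) (.arr 15 (.var 7))))
          (.seq (.setArr 8 (.var 14) (.var 8))
            (.seq (.setArr 9 (.var 14) (.arr 15 (.var 7)))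
              (.seq (.setVar 11 (.op .sub (.var 11) (.var 8)))
                (.seq (.setArr 10 (.var 14) (.var 11))
                  (.seq (.setVar 12 (.op .sub (.var 12) (.var 8)))
                    (.setVar 14 (.op .add (.var 14) (.const 1)))))))))))

/-- Extract the blocks of an optimal plan; variable `14` gets their number. -/
def blockProg : Cmd :=
  .seq (.seq (.setVar 11 (.var 1)) (.seq (.setVar 12 (.const 1))
      (.seq (.setVar 13 (.const 0)) (.setVar 14 (.const 0)))))
    (.loop (.le (.const 1) (.var 11)) blockStep)

theorem blockStep_wp {n : ℕ} (hV : 4 * (n + 1) ^ 2 ≤ V) {w : ℕ → ℝ} {s : State} {x N d r : ℕ}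
    {L : ℕ → ℕ} (ht : TableOk n (smallSum n w) s (n + 1) 0) (h : Reached n w s x N d r L)
    (hx : 1 ≤ x) (h5 : s.var 5 = n + 1) (h11 : s.var 11 = x) (h12 : s.var 12 = N)
    (h13 : s.var 13 = d) (h14 : s.var 14 = r) :
    blockStep.wp V s fun s' => ∃ x' N' d' r' L', Reached n w s' x' N' d' r' L' ∧
      2 * x' + N < 2 * x + N' ∧ s'.var 11 = x' ∧ s'.var 12 = N' ∧ s'.var 13 = d' ∧
      s'.var 14 = r' := by
  have hV' : 2 * n + 2 ≤ V := by nlinarith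
  have hpos := h.pos
  have hN : 1 ≤ N := by omega
  have hle := h.le
  have hlen := h.le_n
  have hdep := h.depth_le
  have hcnt := h.count_le
  have e7 : x * (n + 1) + N = cellIx n x N := rfl
  have hc7 := cellIx_le (n := n) (x := x) (N := N) hlen (by omega)
  have hcell := (ht.cell x N hN hle hlen (by omega)).choice
  have hd := h.le_two_pow
  rcases hcell with ⟨g1, g2, g3, g4⟩ | ⟨g1, g2, g3, g4, g5⟩
  · simp only [blockStep, Cmd.wp, WordExpr.val, Op.app, Test.Holds, State.var_putVar,
      State.arr_putVar, h5, h11, h12, h13, h14, e7, if_true, Nat.reduceEqDiff, if_false, g1]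
    refine ⟨by omega, by omega, fun _ => ⟨by omega, by omega, x, 2 * N, d + 1, r, _,
      h.descend hN g2 g3 g4 rfl rfl, by omega, rfl, rfl, rfl, rfl⟩, fun hp => absurd le_rfl hp⟩
  · generalize hβ : s.arr 15 (cellIx n x N) = β at *
    have hpos := Nat.one_le_two_pow (n := β)
    have hβn : β < 2 ^ β := Nat.lt_two_pow_self
    rw [g1] at g2 g3 g4 g5
    simp only [blockStep, Cmd.wp, WordExpr.val, Op.app, Test.Holds, State.var_putVar,
      State.arr_putVar, State.var_putArr, State.arr_putArr, h5, h11, h12, h13, h14, e7, if_true,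
      Nat.reduceEqDiff, if_false, g1, hβ]
    refine ⟨by omega, by omega, fun hp => by omega, fun _ => ⟨by omega, by omega, by omega,
      by omega, by omega, by omega, by omega, x - 2 ^ β, N - 2 ^ β, d, r + 1, L,
      h.place g2 g3 g4 g5 ?_ ?_ ?_ ?_ ?_ ?_, by omega, rfl, rfl, rfl, rfl⟩⟩
    all_goals simp

/-- The stored choices are followed from `(n, 1)`. Descents and placements both decrease `2 * x -
N`, so there are at most `2 * n` steps. At `(0, 0)` no available node is left, and the Kraft sum is
carried by the roots of the blocks alone. -/
theorem blockProg_halts {n : ℕ} (hn : 1 ≤ n) (hV : 4 * (n + 1) ^ 2 ≤ V) {w : ℕ → ℝ} {s : State}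
    (ht : TableOk n (smallSum n w) s (n + 1) 0) (h1 : s.var 1 = n) (h5 : s.var 5 = n + 1) :
    Halts b V blockProg s (n * 60 + 9) fun s' => ∃ r d L, s'.var 14 = r ∧ r ≤ n ∧
      BlocksFrom n 0 r d (s'.arr 7) (s'.arr 8) (s'.arr 9) (s'.arr 10) L ∧
      ∑ k ∈ Finset.range r, (1 / 2 : ℚ) ^ s'.arr 7 k = 1 ∧
      s.wt 2 (cellIx n n 1) = ∑ i ∈ Finset.range n, (L (rank n w i) : ℝ) * w i ∧
      s.arr 5 (cellIx n n 1) = r := by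
  have hV' : 2 * n + 2 ≤ V := by nlinarith
  refine ((Halts.of_wp (Q := fun s' => s'.var 11 = n ∧ s'.var 12 = 1 ∧ s'.var 13 = 0 ∧
    s'.var 14 = 0) ?_).seq (t' := (2 * n) * (20 + 1) + 1) ?_).mono ?_ fun _ _ h => h
  · simp [h1]
    omega
  · rintro s₁ hf₁ ⟨h11, h12, h13, h14⟩
    have ht₁ : TableOk n (smallSum n w) s₁ (n + 1) 0 := ht.congr (hf₁.wt 2 (by decide))
      (hf₁.arr 5 (by decide)) (hf₁.arr 6 (by decide)) (hf₁.arr 15 (by decide))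
    have h15 : s₁.var 5 = n + 1 := (hf₁.var 5 (by decide)).trans h5
    refine Halts.loop (τ := 20) (m := 2 * n) (fun m s' => ∃ x N d r L, Reached n w s' x N d r L ∧
      2 * x ≤ m + N ∧ s'.var 11 = x ∧ s'.var 12 = N ∧ s'.var 13 = d ∧ s'.var 14 = r) ?_ ?_ ?_
    · refine ⟨n, 1, 0, 0, fun _ => 0, ⟨⟨?_, ?_, ?_, ?_, ?_, ?_, ?_, ?_⟩, hn, by omega, le_rfl,
        by omega, by omega, by simp, by simp, by simp⟩, by omega, h11, h12, h13, h14⟩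
      all_goals simp
    · rintro m s₂ hf₂ ⟨x, N, d, r, L, hr, hm, g11, g12, g13, g14⟩ hp
      simp only [Test.Holds, WordExpr.val, g11] at hp
      have ht₂ : TableOk n (smallSum n w) s₂ (n + 1) 0 := ht₁.congr (hf₂.wt 2 (by decide))
        (hf₂.arr 5 (by decide)) (hf₂.arr 6 (by decide)) (hf₂.arr 15 (by decide))
      have h25 : s₂.var 5 = n + 1 := (hf₂.var 5 (by decide)).trans h15
      have := hr.le
      refine ⟨m - 1, by omega, (Halts.of_wp (blockStep_wp hV ht₂ hr hp h25 g11 g12 g13 g14)).mono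
        (by simp [Cmd.size, blockStep]) ?_⟩
      rintro s₃ - ⟨x', N', d', r', L', hr', hm', k⟩
      exact ⟨x', N', d', r', L', hr', by omega, k⟩
    · rintro m s₂ hf₂ ⟨x, N, d, r, L, hr, hm, g11, g12, g13, g14⟩ hp
      simp only [Test.Holds, WordExpr.val, g11] at hp
      obtain rfl : x = 0 := by omega
      obtain rfl : N = 0 := by have := hr.le; omega
      have h2 : s₂.wt 2 = s.wt 2 := (hf₂.wt 2 (by decide)).trans (hf₁.wt 2 (by decide))
      have h5 : s₂.arr 5 = s.arr 5 := (hf₂.arr 5 (by decide)).trans (hf₁.arr 5 (by decide))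
      have e0 : cellIx n 0 0 = 0 := by simp [cellIx]
      refine ⟨r, d, L, g14, by have := hr.count_le; omega, hr.blocks, by simpa using hr.kraft, ?_, ?_⟩
      · rw [← h2, hr.cost, h2, e0, ht.wt_zero, add_zero]
      · rw [← h5, hr.count, h5, e0, ht.arr_zero, add_zero]
  · simp [Cmd.size]
    omega

end OptSkeleton

/-! ### Building the skeleton tree -/

namespace OptSkeleton

variable {b V : ℕ}

/-- The node at address `i` has no children among the nodes at the addresses `1, …, m`. -/
structure Childless (ch : Bool → ℕ → ℕ) (path : ℕ → List Bool) (m i : ℕ) : Prop where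
  child : ∀ x, ch x i = 0
  path : ∀ j x, 1 ≤ j → j ≤ m → path j ≠ path i ++ [x]

/-- The state of the construction of a tree with `r` leaves at depths `E k`. The nodes at the
addresses `1, …, m` have been created, and those at the addresses below `a` have been turned into
inner nodes or leaves. -/
structure TreeInv (r : ℕ) (E : ℕ → ℕ) (ch : Bool → ℕ → ℕ) (leaf par bit : ℕ → ℕ)
    (path : ℕ → List Bool) (a m : ℕ) : Prop where
  one_le : 1 ≤ a
  le : a ≤ m + 1
  root : path 1 = []
  inj : ∀ i j, 1 ≤ i → i ≤ m → 1 ≤ j → j ≤ m → path i = path j → i = j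
  parent : ∀ i, 2 ≤ i → i ≤ m → 1 ≤ par i ∧ par i < i ∧ bit i ≤ 1 ∧
    path i = path (par i) ++ [decide (bit i = 1)]
  closed : ∀ i, 1 ≤ i → i < a → (∃ k < r, leaf k = i) ∨
    ∀ x, i < ch x i ∧ ch x i ≤ m ∧ path (ch x i) = path i ++ [x]
  childless : ∀ i, a ≤ i → i ≤ m → Childless ch path m i
  fresh : ∀ i, m < i → ∀ x, ch x i = 0
  leaf_le : ∀ k < r, leaf k ≠ 0 → leaf k < a ∧ (path (leaf k)).length = E k ∧
    Childless ch path m (leaf k)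
  leaf_inj : ∀ k < r, ∀ k' < r, leaf k ≠ 0 → leaf k = leaf k' → k = k'
  kraft : ∑ i ∈ Finset.Ico a (m + 1), (1 / 2 : ℚ) ^ (path i).length =
    ∑ k ∈ (Finset.range r).filter fun k => leaf k = 0, (1 / 2 : ℚ) ^ E k
  low : ∀ i, a ≤ i → i ≤ m → ∀ k < r, leaf k = 0 → (path i).length ≤ E k
  count : m + 1 + 2 * ((Finset.range r).filter fun k => leaf k = 0).card = 2 * (m + 1 - a + r)

namespace TreeInv

variable {r : ℕ} {E : ℕ → ℕ} {ch : Bool → ℕ → ℕ} {leaf par bit : ℕ → ℕ} {path : ℕ → List Bool}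
  {a m : ℕ}

/-- Let `e` be the least depth of an unassigned leaf. Each waiting node has Kraft weight at least `2
^ (-e)`, each unassigned leaf at most that, and the totals agree; so at most as many nodes wait as
leaves are unassigned. The identity `count` then bounds `m`. -/
theorem lt (h : TreeInv r E ch leaf par bit path a m) : m < 2 * r := by
  set U := (Finset.range r).filter fun k => leaf k = 0 with hU
  have key : m + 1 - a ≤ U.card := by
    rcases U.eq_empty_or_nonempty with h0 | h0
    · have hk := h.kraft
      rw [← hU, h0, Finset.sum_empty, Finset.sum_eq_zero_iff_of_nonneg
        fun _ _ => by positivity] at hk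
      have : Finset.Ico a (m + 1) = ∅ := by
        rw [Finset.eq_empty_iff_forall_notMem]
        exact fun i hi => absurd (hk i hi) (by positivity)
      rw [Finset.Ico_eq_empty_iff] at this
      omega
    · obtain ⟨k, hk, hmin⟩ := Finset.exists_min_image U E h0
      have hk' : k < r ∧ leaf k = 0 := by simpa [hU] using hk
      have h1 : (Finset.Ico a (m + 1)).card • (1 / 2 : ℚ) ^ E k ≤
          ∑ i ∈ Finset.Ico a (m + 1), (1 / 2 : ℚ) ^ (path i).length := by
        refine Finset.card_nsmul_le_sum _ _ _ fun i hi => ?_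
        rw [Finset.mem_Ico] at hi
        exact pow_le_pow_of_le_one (by norm_num) (by norm_num)
          (h.low i hi.1 (by omega) k hk'.1 hk'.2)
      have h2 : ∑ k ∈ U, (1 / 2 : ℚ) ^ E k ≤ U.card • (1 / 2 : ℚ) ^ E k :=
        Finset.sum_le_card_nsmul _ _ _ fun i hi =>
          pow_le_pow_of_le_one (by norm_num) (by norm_num) (hmin i hi)
      rw [h.kraft, Nat.card_Ico] at h1
      have h3 := h1.trans h2
      simp only [nsmul_eq_mul] at h3
      have h4 := le_of_mul_le_mul_right h3 (by positivity)
      exact_mod_cast h4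
  have hc := h.count
  rw [← hU] at hc
  have := h.le
  have hr : U.card ≤ r := (Finset.card_filter_le _ _).trans (by simp)
  omega

/-- The node and the leaf have the same depth, so equal terms disappear from both sides of the Kraft
identity. -/
theorem assign (h : TreeInv r E ch leaf par bit path a m) (ha : a ≤ m) {f : ℕ} (hf : f < r)
    (hf0 : leaf f = 0) (hE : E f = (path a).length) :
    TreeInv r E ch (Function.update leaf f a) par bit path (a + 1) m := by
  have h1 := h.one_le
  have hU : ((Finset.range r).filter fun k => Function.update leaf f a k = 0) =
      ((Finset.range r).filter fun k => leaf k = 0).erase f := by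
    ext k
    by_cases hk : k = f
    · subst hk
      simp
      omega
    · simp [hk]
  have hfU : f ∈ (Finset.range r).filter fun k => leaf k = 0 := by simp [hf, hf0]
  refine ⟨by omega, by omega, h.root, h.inj, h.parent, fun i h2 h3 => ?_,
    fun i h2 h3 => h.childless i (by omega) h3, h.fresh, fun k hk h2 => ?_,
    fun k hk k' hk' h2 h3 => ?_, ?_, fun i h2 h3 k hk h4 => ?_, ?_⟩
  · rcases Nat.lt_succ_iff_lt_or_eq.1 h3 with h4 | rfl
    · rcases h.closed i h2 h4 with ⟨k, hk, hki⟩ | h5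
      · refine .inl ⟨k, hk, ?_⟩
        rw [Function.update_of_ne, hki]
        rintro rfl
        omega
      · exact .inr h5
    · exact .inl ⟨f, hf, Function.update_self ..⟩
  · by_cases hkf : k = f
    · subst hkf
      rw [Function.update_self]
      exact ⟨by omega, hE.symm, h.childless a le_rfl ha⟩
    · rw [Function.update_of_ne hkf] at h2 ⊢
      obtain ⟨h3, h4⟩ := h.leaf_le k hk h2
      exact ⟨by omega, h4⟩
  · by_cases hkf : k = f <;> by_cases hkf' : k' = f
    · rw [hkf, hkf']
    · rw [hkf, Function.update_self, Function.update_of_ne hkf'] at h3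
      have := (h.leaf_le k' hk' (by omega)).1
      omega
    · rw [hkf', Function.update_self, Function.update_of_ne hkf] at h3
      have := (h.leaf_le k hk (by omega)).1
      omega
    · rw [Function.update_of_ne hkf] at h2 h3
      rw [Function.update_of_ne hkf'] at h3
      exact h.leaf_inj k hk k' hk' h2 h3
  · have hk := h.kraft
    rw [Finset.sum_eq_sum_Ico_succ_bot (by omega), ← Finset.add_sum_erase _ _ hfU, hE] at hk
    rw [hU]
    exact add_left_cancel hk
  · have hkf : k ≠ f := by
      rintro rfl
      rw [Function.update_self] at h4
      omega
    rw [Function.update_of_ne hkf] at h4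
    exact h.low i (by omega) h3 k hk h4
  · have hc := h.count
    rw [hU, Finset.card_erase_of_mem hfU]
    have := Finset.card_pos.2 ⟨f, hfU⟩
    omega

/-- By `low` and `hE`, all unassigned leaves are strictly deeper than the node `a`, hence at least
as deep as its children. The children together have the Kraft weight of `a`. -/
theorem split (h : TreeInv r E ch leaf par bit path a m) (ha : a ≤ m)
    (hE : ∀ k < r, leaf k = 0 → E k ≠ (path a).length) {ch' : Bool → ℕ → ℕ} {par' bit' : ℕ → ℕ}
    (hch : ∀ x, ch' x = Function.update (ch x) a (m + 1 + x.toNat))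
    (hpar : par' = Function.update (Function.update par (m + 1) a) (m + 2) a)
    (hbit : bit' = Function.update (Function.update bit (m + 1) 0) (m + 2) 1) :
    TreeInv r E ch' leaf par' bit' (Function.update (Function.update path (m + 1) (path a ++ [false]))
      (m + 2) (path a ++ [true])) (a + 1) (m + 2) := by
  set path' := Function.update (Function.update path (m + 1) (path a ++ [false]))
      (m + 2) (path a ++ [true]) with hpath
  have h1 := h.one_le
  have p0 : ∀ i, i ≤ m → path' i = path i := fun i hi => by
    rw [hpath, Function.update_of_ne (by omega), Function.update_of_ne (by omega)]
  have p1 : path' (m + 1) = path a ++ [false] := by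
    rw [hpath, Function.update_of_ne (by omega), Function.update_self]
  have p2 : path' (m + 2) = path a ++ [true] := by
    rw [hpath, Function.update_self]
  have px : ∀ x : Bool, path' (m + 1 + x.toNat) = path a ++ [x] := by
    rintro (_ | _)
    · exact p1
    · exact p2
  have old : ∀ i, i ≤ m + 2 → i ≤ m ∨ ∃ x : Bool, i = m + 1 + x.toNat := by
    intro i hi
    by_cases h2 : i ≤ m
    · exact .inl h2
    · by_cases h3 : i = m + 1
      · exact .inr ⟨false, h3⟩
      · exact .inr ⟨true, by simp; omega⟩
  have hca := h.childless a le_rfl ha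
  have hnew : ∀ i, i ≤ m → i ≠ a → Childless ch path m i → 1 ≤ i → Childless ch' path' (m + 2) i := by
    intro i hi hia hc hi1
    refine ⟨fun x => ?_, fun j x hj1 hj2 => ?_⟩
    · rw [hch, Function.update_of_ne hia, hc.child]
    · rw [p0 i hi]
      rcases old j hj2 with hj | ⟨y, rfl⟩
      · rw [p0 j hj]
        exact hc.path j x hj1 hj
      · rw [px]
        intro heq
        have := List.append_inj_left' heq rfl
        exact hia (h.inj i a hi1 hi h1 ha this.symm)
  refine ⟨by omega, by omega, by rw [p0 1 (by omega), h.root], ?_, ?_, ?_, ?_, ?_, ?_, h.leaf_inj,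
    ?_, ?_, ?_⟩
  · intro i j hi1 hi2 hj1 hj2 hij
    rcases old i hi2 with hi | ⟨x, rfl⟩ <;> rcases old j hj2 with hj | ⟨y, rfl⟩
    · rw [p0 i hi, p0 j hj] at hij
      exact h.inj i j hi1 hi hj1 hj hij
    · rw [p0 i hi, px] at hij
      exact absurd hij (hca.path i y hi1 hi)
    · rw [p0 j hj, px] at hij
      exact absurd hij.symm (hca.path j x hj1 hj)
    · rw [px, px] at hij
      have := List.append_cancel_left hij
      simp only [List.cons.injEq, and_true] at this
      rw [this]
  · intro i hi1 hi2
    rcases old i hi2 with hi | ⟨x, rfl⟩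
    · obtain ⟨k1, k2, k3, k4⟩ := h.parent i hi1 hi
      have e1 : par' i = par i := by
        rw [hpar, Function.update_of_ne (by omega), Function.update_of_ne (by omega)]
      have e2 : bit' i = bit i := by
        rw [hbit, Function.update_of_ne (by omega), Function.update_of_ne (by omega)]
      rw [e1, e2, p0 i hi, p0 _ (by omega)]
      exact ⟨k1, k2, k3, k4⟩
    · have e1 : par' (m + 1 + x.toNat) = a := by
        cases x <;> simp [hpar]
      have e2 : bit' (m + 1 + x.toNat) = x.toNat := by
        cases x <;> simp [hbit]
      rw [e1, e2, p0 a ha, px]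
      refine ⟨h1, by omega, by cases x <;> simp, by cases x <;> simp⟩
  · intro i hi1 hi2
    rcases Nat.lt_succ_iff_lt_or_eq.1 hi2 with hi | rfl
    · rcases h.closed i hi1 hi with h3 | h3
      · exact .inl h3
      · refine .inr fun x => ?_
        obtain ⟨k1, k2, k3⟩ := h3 x
        rw [hch, Function.update_of_ne (by omega), p0 _ k2, p0 i (by omega)]
        exact ⟨k1, by omega, k3⟩
    · refine .inr fun x => ?_
      rw [hch, Function.update_self, px, p0 i ha]
      exact ⟨by omega, by cases x <;> simp, rfl⟩
  · intro i hi1 hi2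
    rcases old i hi2 with hi | ⟨y, rfl⟩
    · exact hnew i hi (by omega) (h.childless i (by omega) hi) (by omega)
    · refine ⟨fun x => ?_, fun j x hj1 hj2 => ?_⟩
      · rw [hch, Function.update_of_ne (by omega), h.fresh _ (by omega)]
      · rw [px]
        rcases old j hj2 with hj | ⟨z, rfl⟩
        · rw [p0 j hj]
          intro heq
          by_cases hj' : j = 1
          · rw [hj', h.root] at heq
            simp at heq
          -- An old node below a new one would have an old parent with the path of a child of `a`,
          -- but `a` was childless.
          · obtain ⟨k1, k2, k3, k4⟩ := h.parent j (by omega) hj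
            rw [k4] at heq
            exact hca.path (par j) y k1 (by omega) (List.append_inj_left' heq rfl)
        · rw [px]
          intro heq
          have := congrArg List.length heq
          simp at this
  · intro i hi x
    rw [hch, Function.update_of_ne (by omega), h.fresh i (by omega)]
  · intro k hk h2
    obtain ⟨k1, k2, k3⟩ := h.leaf_le k hk h2
    refine ⟨by omega, by rw [p0 _ (by omega), k2], hnew _ (by omega) (by omega) k3 (by omega)⟩
  · have e : ∑ i ∈ Finset.Ico (a + 1) (m + 1), (1 / 2 : ℚ) ^ (path' i).length =
        ∑ i ∈ Finset.Ico (a + 1) (m + 1), (1 / 2 : ℚ) ^ (path i).length :=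
      Finset.sum_congr rfl fun i hi => by
        rw [Finset.mem_Ico] at hi
        rw [p0 i (by omega)]
    rw [← h.kraft, Finset.sum_eq_sum_Ico_succ_bot (show a < m + 1 by omega),
      Finset.sum_Ico_succ_top (by omega), Finset.sum_Ico_succ_top (by omega), e, p1, p2]
    simp only [List.length_append, List.length_singleton, pow_succ]
    ring
  · intro i hi1 hi2 k hk h2
    rcases old i hi2 with hi | ⟨y, rfl⟩
    · rw [p0 i hi]
      exact h.low i (by omega) hi k hk h2
    · have h3 := h.low a le_rfl ha k hk h2
      have h4 := hE k hk h2
      rw [px, List.length_append, List.length_singleton]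
      omega
  · have hc := h.count
    omega

end TreeInv

/-- The addresses of the left and right children. -/
def State.child (s : State) (x : Bool) : ℕ → ℕ := s.arr x.toNat

/-- The state of the construction of the tree in memory. -/
def TreeState (r : ℕ) (E : ℕ → ℕ) (s : State) (path : ℕ → List Bool) (a m : ℕ) : Prop :=
  TreeInv r E s.child (s.arr 11) (s.arr 12) (s.arr 13) path a m ∧
    ∀ i, 1 ≤ i → i ≤ m → s.arr 14 i = (path i).length

/-- Variable `19` gets the number of an unused block whose root is at the depth given in
variable `18`, or `r` if there is none. -/
def findBlock : Cmd :=
  .seq (.setVar 19 (.var 14)) (.forVar 3 14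
    (.ite (.and (.le (.arr 11 (.var 3)) (.const 0)) (.and (.le (.arr 7 (.var 3)) (.var 18))
        (.le (.var 18) (.arr 7 (.var 3)))))
      (.setVar 19 (.var 3)) .skip))

/-- Make the node with address in variable `16` a leaf or give it two children. -/
def growNode : Cmd :=
  .seq (.ite (.lt (.var 19) (.var 14))
      (.setArr 11 (.var 19) (.var 16))
      (.seq (.setArr 0 (.var 16) (.op .add (.var 17) (.const 1)))
        (.seq (.setArr 1 (.var 16) (.op .add (.var 17) (.const 2)))
          (.seq (.setArr 12 (.op .add (.var 17) (.const 1)) (.var 16))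
            (.seq (.setArr 12 (.op .add (.var 17) (.const 2)) (.var 16))
              (.seq (.setArr 13 (.op .add (.var 17) (.const 1)) (.const 0))
                (.seq (.setArr 13 (.op .add (.var 17) (.const 2)) (.const 1))
                  (.seq (.setArr 14 (.op .add (.var 17) (.const 1)) (.op .add (.var 18) (.const 1)))
                    (.seq (.setArr 14 (.op .add (.var 17) (.const 2))
                        (.op .add (.var 18) (.const 1)))
                      (.setVar 17 (.op .add (.var 17) (.const 2))))))))))))
    (.setVar 16 (.op .add (.var 16) (.const 1)))

/-- Build the skeleton tree with the roots of the blocks as leaves. -/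
def treeProg : Cmd :=
  .seq (.seq (.setVar 16 (.const 1)) (.setVar 17 (.const 1)))
    (.loop (.le (.var 16) (.var 17))
      (.seq (.setVar 18 (.arr 14 (.var 16))) (.seq findBlock growNode)))

theorem findBlock_halts {r δ : ℕ} (hV : r ≤ V) {s : State} (h14 : s.var 14 = r)
    (h18 : s.var 18 = δ) :
    Halts b V findBlock s (r * 5 + 5) fun s' =>
      (s'.var 19 < r ∧ s.arr 11 (s'.var 19) = 0 ∧ s.arr 7 (s'.var 19) = δ) ∨
      (s'.var 19 = r ∧ ∀ k < r, s.arr 11 k = 0 → s.arr 7 k ≠ δ) := by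
  refine ((Halts.of_wp (Q := fun s' => s'.var 19 = r) ?_).seq (t' := r * (2 + 3) + 3) ?_).mono
    (by simp [Cmd.size]; omega) fun _ _ h => h
  · simp [h14, hV]
  intro s₁ hf₁ h19
  have g14 : s₁.var 14 = r := (hf₁.var 14 (by decide)).trans h14
  refine (Halts.forVar (τ := 2) (fun K s' =>
    (s'.var 19 < r ∧ s.arr 11 (s'.var 19) = 0 ∧ s.arr 7 (s'.var 19) = δ) ∨
      (s'.var 19 = r ∧ ∀ k < K, s.arr 11 k = 0 → s.arr 7 k ≠ δ)) (by decide) (by decide)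
      (by decide) ?_ ?_ ?_).mono (by rw [g14]) fun _ _ h => h
  · exact .inr ⟨h19, by simp⟩
  · intro K hK s₂ hf₂ h23 _ hI
    have a11 : s₂.arr 11 = s.arr 11 := (hf₂.arr 11 (by decide)).trans (hf₁.arr 11 (by decide))
    have a7 : s₂.arr 7 = s.arr 7 := (hf₂.arr 7 (by decide)).trans (hf₁.arr 7 (by decide))
    have g18 : s₂.var 18 = δ := by rw [hf₂.var 18 (by decide), hf₁.var 18 (by decide), h18]
    rw [g14] at hK
    refine (Halts.of_wp ?_).mono (by simp [Cmd.size]) fun _ _ h => h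
    simp only [Cmd.wp, Test.Holds, WordExpr.val, a11, a7, h23, g18, State.var_putVar,
      Nat.reduceEqDiff, if_true, if_false]
    constructor
    · intro hp
      exact ⟨by omega, .inl ⟨hK, by omega, by omega⟩⟩
    · intro hp
      rcases hI with hI | ⟨hI1, hI2⟩
      · exact .inl hI
      · refine .inr ⟨hI1, fun k hk h1 h2 => ?_⟩
        rcases Nat.lt_succ_iff_lt_or_eq.1 hk with hk | rfl
        · exact hI2 k hk h1 h2
        · omega
  · intro s₂ _ _ _ hI
    rw [g14] at hI
    exact hI

theorem growNode_wp {r δ : ℕ} {E : ℕ → ℕ} {s : State} {path : ℕ → List Bool} {a m : ℕ}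
    (hV : 2 * r + 2 ≤ V) (h : TreeState r E s path a m) (ha : a ≤ m) (h14 : s.var 14 = r)
    (h16 : s.var 16 = a) (h17 : s.var 17 = m) (h18 : s.var 18 = δ) (hδ : δ = (path a).length)
    (hδr : δ < V)
    (h19 : (s.var 19 < r ∧ s.arr 11 (s.var 19) = 0 ∧ E (s.var 19) = δ) ∨
      (s.var 19 = r ∧ ∀ k < r, s.arr 11 k = 0 → E k ≠ δ)) :
    growNode.wp V s fun s' => ∃ path' m', TreeState r E s' path' (a + 1) m' ∧ s'.var 16 = a + 1 ∧
      s'.var 17 = m' := by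
  have hm := h.1.lt
  simp only [growNode, Cmd.wp, Test.holds_lt, WordExpr.val, Op.app, State.var_putVar,
    State.var_putArr, h14, h16, h17, h18, Nat.reduceEqDiff, if_true, if_false]
  constructor
  · intro hp
    rcases h19 with ⟨h1, h2, h3⟩ | h1
    · refine ⟨by omega, by omega, path, m, ⟨?_, ?_⟩, trivial, rfl⟩
      · have key := h.1.assign ha hp h2 (h3.trans hδ)
        convert key using 1
        · funext x
          cases x <;> simp [State.child]
        all_goals simp
      · simpa using h.2
    · omega
  · intro hp
    rcases h19 with h1 | ⟨h1, h2⟩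
    · omega
    · refine ⟨by omega, by omega, by omega, by omega, by omega, by omega, by omega, by omega,
        by omega, by omega, _, _, ⟨h.1.split ha (hδ ▸ h2) (fun x => ?_) ?_ ?_, ?_⟩, trivial, rfl⟩
      · cases x <;> simp [State.child]
      · simp
      · simp
      · intro i hi1 hi2
        simp only [State.arr_putVar, State.arr_putArr, Nat.reduceEqDiff, if_true, if_false]
        simp only [Function.update_apply]
        have := h.2 i hi1
        split_ifs
        · simp [hδ]
        · simp [hδ]
        · exact this (by omega)

/-- The addresses form a queue, one of which is processed per pass; `TreeInv.lt` bounds the number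
of passes by `2 * n`. Initially only the root waits, and its Kraft weight `1` is the content of
`hkraft`. -/
theorem treeProg_halts {n r : ℕ} (hrn : r ≤ n) (hV : 2 * n + 2 ≤ V) {E : ℕ → ℕ} {s : State}
    (h14 : s.var 14 = r) (hE : s.arr 7 = E) (hEn : ∀ k < r, E k ≤ n)
    (hkraft : ∑ k ∈ Finset.range r, (1 / 2 : ℚ) ^ E k = 1)
    (h0 : ∀ a ∈ [0, 1, 11, 14], s.arr a = fun _ => 0) :
    Halts b V treeProg s (2 * n * (n * 5 + 30) + 5) fun s' => ∃ path m,
      TreeState r E s' path (m + 1) m := by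
  refine ((Halts.of_wp (Q := fun s' => s'.var 16 = 1 ∧ s'.var 17 = 1) ?_).seq
    (t' := 2 * n * (n * 5 + 29 + 1) + 1) ?_).mono (le_of_eq (by simp [Cmd.size]; ring)) fun _ _ h => h
  · simp
    omega
  rintro s₁ hf₁ ⟨h16, h17⟩
  have ha : ∀ a, s₁.arr a = s.arr a := fun a => hf₁.arr a (by simp [Cmd.arrs])
  refine Halts.loop (τ := n * 5 + 29) (m := 2 * n) (fun t s' => ∃ path a m,
    TreeState r E s' path a m ∧ s'.var 16 = a ∧ s'.var 17 = m ∧ t + a = 2 * n + 1) ?_ ?_ ?_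
  · refine ⟨fun _ => [], 1, 1, ⟨⟨le_rfl, by omega, rfl, fun i j h1 h2 h3 h4 _ => by omega,
      fun i h1 h2 => by omega, fun i h1 h2 => by omega, fun i h1 h2 => ⟨fun x => ?_,
      fun j x _ _ h => by simp at h⟩, fun i h1 x => ?_, fun k hk h => ?_, fun k hk k' hk' h => ?_,
      ?_, fun i h1 h2 k hk h => by simp, ?_⟩, fun i h1 h2 => ?_⟩, h16, h17, by omega⟩
    · cases x <;> simp [State.child, ha, h0]
    · cases x <;> simp [State.child, ha, h0]
    · simp [ha, h0] at h
    · simp [ha, h0] at h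
    · simp only [ha, h0 11 (by simp), Finset.filter_true, hkraft]
      simp
    · simp only [ha, h0 11 (by simp), Finset.filter_true, Finset.card_range]
      omega
    · simp [ha, h0]
  · rintro t s₂ hf₂ ⟨path, a, m, hT, g16, g17, ht⟩ hp
    simp only [Test.Holds, WordExpr.val, g16, g17] at hp
    have hm := hT.1.lt
    have g14 : s₂.var 14 = r := by rw [hf₂.var 14 (by decide), hf₁.var 14 (by decide), h14]
    have a7 : s₂.arr 7 = E := by rw [hf₂.arr 7 (by decide), ha, hE]
    have hdep : s₂.arr 14 a = (path a).length := hT.2 a hT.1.one_le hp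
    -- The waiting node has positive Kraft weight, so some leaf is unassigned, and its depth bounds
    -- that of the node.
    have hlen : (path a).length ≤ n := by
      have hk := hT.1.kraft
      have : ∃ k < r, s₂.arr 11 k = 0 := by
        by_contra hcon
        push Not at hcon
        rw [Finset.filter_eq_empty_iff.2 (by simpa using hcon), Finset.sum_empty,
          Finset.sum_eq_zero_iff_of_nonneg fun _ _ => by positivity] at hk
        exact absurd (hk a (by simp; omega)) (by positivity)
      obtain ⟨k, hk, hk0⟩ := this
      exact (hT.1.low a le_rfl hp k hk hk0).trans (hEn k hk)
    refine ⟨t - 1, by omega, ?_⟩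
    refine ((Halts.of_wp (Q := fun s' => s'.var 18 = (path a).length) ?_).seq
      (t' := n * 5 + 27) ?_).mono (by simp [Cmd.size]; omega) fun _ _ h => h
    · simp only [Cmd.wp, WordExpr.val, g16, hdep, State.var_putVar, if_true, and_true]
      omega
    intro s₃ hf₃ g18
    have k14 : s₃.var 14 = r := (hf₃.var 14 (by decide)).trans g14
    have e3 : ∀ a, s₃.arr a = s₂.arr a := fun a => hf₃.arr a (by simp [Cmd.arrs])
    refine ((findBlock_halts (by omega) k14 g18).seq (t' := 21) ?_).mono
      (by omega) fun _ _ h => h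
    intro s₄ hf₄ h19
    have e4 : ∀ a, s₄.arr a = s₂.arr a := fun a => by
      rw [hf₄.arr a (by simp [findBlock, Cmd.forVar, Cmd.arrs]), e3]
    have hT' : TreeState r E s₄ path a m := by
      have : s₄.child = s₂.child := by
        funext x
        exact e4 _
      unfold TreeState
      rw [this, e4, e4, e4, e4]
      exact hT
    rw [e3, e3, a7] at h19
    refine (Halts.of_wp (growNode_wp (by omega) hT' hp ((hf₄.var 14 (by decide)).trans k14)
      (by rw [hf₄.var 16 (by decide), hf₃.var 16 (by decide), g16])
      (by rw [hf₄.var 17 (by decide), hf₃.var 17 (by decide), g17])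
      ((hf₄.var 18 (by decide)).trans g18) rfl (by omega) (by rw [e4]; exact h19))).mono
      (by simp [Cmd.size, growNode]) ?_
    rintro s₅ - ⟨path', m', hT'', k16, k17⟩
    exact ⟨path', a + 1, m', hT'', k16, k17, by omega⟩
  · rintro t s₂ hf₂ ⟨path, a, m, hT, g16, g17, ht⟩ hp
    simp only [Test.Holds, WordExpr.val, g16, g17] at hp
    have := hT.1.le
    obtain rfl : a = m + 1 := by omega
    exact ⟨path, m, hT⟩

end OptSkeleton

/-! ### Writing the codewords -/

namespace OptSkeleton

variable {b V : ℕ}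

/-- The last `β` bits of the binary representation of `o`. -/
def bitsOf : ℕ → ℕ → List Bool
  | 0, _ => []
  | β + 1, o => bitsOf β (o / 2) ++ [decide (o % 2 = 1)]

@[simp] theorem length_bitsOf : ∀ β o : ℕ, (bitsOf β o).length = β
  | 0, _ => rfl
  | β + 1, o => by simp [bitsOf, length_bitsOf β]

theorem bitsOf_inj : ∀ {β o o' : ℕ}, o < 2 ^ β → o' < 2 ^ β → bitsOf β o = bitsOf β o' → o = o'
  | 0, o, o', h, h', _ => by
    rw [pow_zero] at h h'
    omega
  | β + 1, o, o', h, h', heq => by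
    rw [pow_succ] at h h'
    rw [bitsOf, bitsOf] at heq
    obtain ⟨h1, h2⟩ := List.append_inj heq (by simp)
    have h3 := bitsOf_inj (by omega) (by omega) h1
    simp only [List.cons.injEq, decide_eq_decide, and_true] at h2
    omega

theorem exists_bitsOf_eq (v : List Bool) : ∃ o < 2 ^ v.length, bitsOf v.length o = v := by
  induction v using List.reverseRecOn with
  | nil => exact ⟨0, by simp, rfl⟩
  | append_singleton v x ih =>
    obtain ⟨o, ho, h⟩ := ih
    refine ⟨2 * o + x.toNat, ?_, ?_⟩
    · rw [List.length_append, List.length_singleton, pow_succ]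
      have := x.toNat_le
      omega
    · rw [List.length_append, List.length_singleton, bitsOf]
      have h1 : (2 * o + x.toNat) / 2 = o := by
        have := x.toNat_le
        omega
      have h2 : decide ((2 * o + x.toNat) % 2 = 1) = x := by
        cases x <;> simp
      rw [h1, h2, h]

/-- The bits of the word `l` are stored in the array `A` from cell `i` on. -/
def StoredAt (A : ℕ → ℕ) (i : ℕ) (l : List Bool) : Prop :=
  ∀ (j : ℕ) (hj : j < l.length), A (i + j) = (l[j]).toNat

theorem StoredAt.nil (A : ℕ → ℕ) (i : ℕ) : StoredAt A i [] := fun j hj => by simp at hj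

theorem StoredAt.cons {A : ℕ → ℕ} {i : ℕ} {x : Bool} {l : List Bool} (h : A i = x.toNat)
    (h' : StoredAt A (i + 1) l) : StoredAt A i (x :: l) := by
  rintro (_ | j) hj
  · exact h
  · have := h' j (by simpa using hj)
    rw [← add_assoc, add_right_comm, this]
    rfl

theorem StoredAt.append {A : ℕ → ℕ} {i : ℕ} {l l' : List Bool} (h : StoredAt A i l)
    (h' : StoredAt A (i + l.length) l') : StoredAt A i (l ++ l') := by
  intro j hj
  by_cases hjl : j < l.length
  · rw [h j hjl, List.getElem_append_left hjl]
  · have := h' (j - l.length) (by rw [List.length_append] at hj; omega)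
    rw [List.getElem_append_right (by omega), ← this]
    congr 1
    omega

theorem StoredAt.congr {A A' : ℕ → ℕ} {i : ℕ} {l : List Bool} (h : StoredAt A i l)
    (h' : ∀ j, i ≤ j → j < i + l.length → A' j = A j) : StoredAt A' i l := fun j hj => by
  rw [h' _ (by omega) (by omega), h j hj]

/-- Variable `19` gets the number of the block that contains the rank in variable `20`. -/
def locateBlock : Cmd :=
  .forVar 3 14 (.ite (.and (.le (.arr 10 (.var 3)) (.var 20))
      (.lt (.var 20) (.op .add (.arr 10 (.var 3)) (.arr 8 (.var 3)))))
    (.setVar 19 (.var 3)) .skip)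

/-- Write the path to the node with address in variable `16` from cell (variable `22`) on. -/
def pathLoop : Cmd :=
  .loop (.le (.const 1) (.var 21))
    (.seq (.setVar 21 (.op .sub (.var 21) (.const 1)))
      (.seq (.setArr 3 (.op .add (.var 22) (.var 21)) (.arr 13 (.var 16)))
        (.setVar 16 (.arr 12 (.var 16)))))

/-- Write the last (variable `21`) bits of variable `20` from cell (variable `22`) on. -/
def bitsLoop : Cmd :=
  .loop (.le (.const 1) (.var 21))
    (.seq (.setVar 21 (.op .sub (.var 21) (.const 1)))
      (.seq (.setArr 3 (.op .add (.var 22) (.var 21))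
          (.op .sub (.var 20) (.op .mul (.const 2) (.op .div (.var 20) (.const 2)))))
        (.setVar 20 (.op .div (.var 20) (.const 2)))))

/-- Write the codeword of the symbol in variable `2`. -/
def wordProg : Cmd :=
  .seq (.seq (.setVar 20 (.arr 4 (.var 2))) (.setVar 19 (.const 0)))
    (.seq locateBlock
      (.seq (.seq (.setVar 16 (.arr 11 (.var 19))) (.seq (.setVar 21 (.arr 7 (.var 19)))
          (.seq (.setVar 22 (.op .mul (.var 2) (.var 1)))
            (.setArr 2 (.var 2) (.op .add (.arr 7 (.var 19)) (.arr 9 (.var 19)))))))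
        (.seq pathLoop
          (.seq (.seq (.setVar 22 (.op .add (.op .mul (.var 2) (.var 1)) (.arr 7 (.var 19))))
              (.seq (.setVar 20 (.op .sub (.var 20) (.arr 10 (.var 19))))
                (.setVar 21 (.arr 9 (.var 19)))))
            bitsLoop))))

/-- Write the code. -/
def codeProg : Cmd := .forVar 2 1 wordProg

/-! ### Correctness of the output of the codewords -/

theorem locateBlock_halts {r ρ : ℕ} (hV : r ≤ V) {s : State} (h14 : s.var 14 = r)
    (h20 : s.var 20 = ρ)
    (hex : ∃ k < r, s.arr 10 k ≤ ρ ∧ ρ < s.arr 10 k + s.arr 8 k) :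
    Halts b V locateBlock s (r * 5 + 3) fun s' => s'.var 19 < r ∧ s.arr 10 (s'.var 19) ≤ ρ ∧
      ρ < s.arr 10 (s'.var 19) + s.arr 8 (s'.var 19) := by
  refine (Halts.forVar (τ := 2) (fun K s' =>
    (∃ k < K, s.arr 10 k ≤ ρ ∧ ρ < s.arr 10 k + s.arr 8 k) → s'.var 19 < r ∧
      s.arr 10 (s'.var 19) ≤ ρ ∧ ρ < s.arr 10 (s'.var 19) + s.arr 8 (s'.var 19)) (by decide)
      (by decide) (by decide) (by simp) ?_ ?_).mono (by rw [h14]) fun _ _ h => h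
  · intro K hK s₁ hf₁ h13 _ hI
    rw [h14] at hK
    have a10 : s₁.arr 10 = s.arr 10 := hf₁.arr 10 (by decide)
    have a8 : s₁.arr 8 = s.arr 8 := hf₁.arr 8 (by decide)
    have g20 : s₁.var 20 = ρ := (hf₁.var 20 (by decide)).trans h20
    refine (Halts.of_wp ?_).mono (by simp [Cmd.size]) fun _ _ h => h
    simp only [Cmd.wp, Test.Holds, Test.holds_lt, WordExpr.val, Op.app, a10, a8, h13, g20,
      State.var_putVar, Nat.reduceEqDiff, if_true, if_false]
    constructor
    · exact fun hp => ⟨by omega, fun _ => ⟨hK, hp⟩⟩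
    · rintro hp ⟨k, hk, h⟩
      rcases Nat.lt_succ_iff_lt_or_eq.1 hk with hk | rfl
      · exact hI ⟨k, hk, h⟩
      · exact absurd h hp
  · intro s' _ _ _ hI
    rw [h14] at hI
    exact hI hex

/-- Following the parents yields the bits from last to first. The cells are therefore filled
backwards from the known depth `e`, and the invariant says that a suffix `q` of the path is stored.
-/
theorem pathLoop_halts {path : ℕ → List Bool} {m e : ℕ} {s : State} {i : ℕ}
    (h22 : s.var 22 = i) (h21 : s.var 21 = e)
    (hroot : path 1 = []) (hpar : ∀ i, 2 ≤ i → i ≤ m → 1 ≤ s.arr 12 i ∧ s.arr 12 i < i ∧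
      s.arr 13 i ≤ 1 ∧ path i = path (s.arr 12 i) ++ [decide (s.arr 13 i = 1)])
    (ha : 1 ≤ s.var 16) (ham : s.var 16 ≤ m) (he : (path (s.var 16)).length = e) :
    Halts b V pathLoop s (e * 6 + 1) fun s' => StoredAt (s'.arr 3) i (path (s.var 16)) ∧
      ∀ j < i, s'.arr 3 j = s.arr 3 j := by
  apply Halts.of_bounded
  intro hs
  refine Halts.loop (τ := 5) (m := e) (fun t s' => s'.var 21 = t ∧ 1 ≤ s'.var 16 ∧ s'.var 16 ≤ m ∧
    (path (s'.var 16)).length = t ∧ (∃ q, path (s.var 16) = path (s'.var 16) ++ q ∧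
      StoredAt (s'.arr 3) (i + t) q) ∧ ∀ j < i, s'.arr 3 j = s.arr 3 j) ?_ ?_ ?_
  · exact ⟨h21, ha, ham, he, ⟨[], by simp, StoredAt.nil _ _⟩, fun _ _ => rfl⟩
  · rintro t s₁ hf ⟨g21, g1, g2, g3, ⟨q, g4, g5⟩, g6⟩ hp
    simp only [Test.Holds, WordExpr.val, g21] at hp
    have a12 : s₁.arr 12 = s.arr 12 := hf.arr 12 (by decide)
    have a13 : s₁.arr 13 = s.arr 13 := hf.arr 13 (by decide)
    have g22 : s₁.var 22 = i := (hf.var 22 (by decide)).trans h22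
    generalize hx : s₁.var 16 = x at *
    have h2 : 2 ≤ x := by
      by_contra hlt
      obtain rfl : x = 1 := by omega
      rw [hroot] at g3
      simp at g3
      omega
    obtain ⟨k1, k2, k3, k4⟩ := hpar x h2 g2
    have hlen := congrArg List.length k4
    rw [List.length_append, List.length_singleton] at hlen
    have hb := hs.2 12 x
    have ht := hs.1 21
    have hte : t ≤ e := by
      have := congrArg List.length g4
      rw [List.length_append] at this
      omega
    refine ⟨t - 1, by omega, (Halts.of_wp ?_).mono (by simp [Cmd.size]) fun _ _ h => h⟩
    simp only [Cmd.wp, WordExpr.val, Op.app, a12, a13, hx, g21, g22, State.var_putVar,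
      State.var_putArr, State.arr_putVar, State.arr_putArr, Nat.reduceEqDiff, if_true, if_false]
    refine ⟨by omega, by omega, hb, trivial, k1, by omega, by omega,
      ⟨decide (s.arr 13 x = 1) :: q, by rw [g4, k4]; simp, StoredAt.cons ?_ ?_⟩, fun j hj => ?_⟩
    · rw [Function.update_self]
      rcases Nat.le_one_iff_eq_zero_or_eq_one.1 k3 with h | h <;> simp [h]
    · rw [add_assoc, Nat.sub_add_cancel hp]
      exact g5.congr fun j hj _ => Function.update_of_ne (by omega) _ _
    · rw [Function.update_of_ne (by omega), g6 j hj]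
  · rintro t s₁ hf ⟨g21, g1, g2, g3, ⟨q, g4, g5⟩, g6⟩ hp
    simp only [Test.Holds, WordExpr.val, g21] at hp
    obtain rfl : t = 0 := by omega
    rw [List.length_eq_zero_iff.1 g3, List.nil_append] at g4
    rw [g4]
    exact ⟨g5, g6⟩

theorem bitsLoop_halts {β o : ℕ} {s : State} {i : ℕ} (h22 : s.var 22 = i)
    (h21 : s.var 21 = β) (h20 : s.var 20 = o) :
    Halts b V bitsLoop s (β * 6 + 1) fun s' => StoredAt (s'.arr 3) i (bitsOf β o) ∧
      ∀ j < i, s'.arr 3 j = s.arr 3 j := by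
  apply Halts.of_bounded
  intro hs
  refine Halts.loop (τ := 5) (m := β) (fun t s' => s'.var 21 = t ∧ s'.var 20 ≤ o ∧
    (∃ q, bitsOf β o = bitsOf t (s'.var 20) ++ q ∧ StoredAt (s'.arr 3) (i + t) q) ∧
      ∀ j < i, s'.arr 3 j = s.arr 3 j) ?_ ?_ ?_
  · exact ⟨h21, h20.le, ⟨[], by simp [h20], StoredAt.nil _ _⟩, fun _ _ => rfl⟩
  · rintro t s₁ hf ⟨g21, g0, ⟨q, g4, g5⟩, g6⟩ hp
    simp only [Test.Holds, WordExpr.val, g21] at hp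
    have g22 : s₁.var 22 = i := (hf.var 22 (by decide)).trans h22
    generalize hx : s₁.var 20 = x at *
    obtain ⟨t, rfl⟩ := Nat.exists_eq_add_of_le' hp
    have h1 := hs.1 21
    have h2 := hs.1 20
    have hle := Nat.div_le_self x 2
    have h3 : t + 1 ≤ β := by
      have := congrArg List.length g4
      rw [List.length_append, length_bitsOf, length_bitsOf] at this
      omega
    -- The machine has no remainder operation, so the last bit is obtained from a division.
    have hmod : x - 2 * (x / 2) = x % 2 := by omega
    refine ⟨t, by omega, (Halts.of_wp ?_).mono (by simp [Cmd.size]) fun _ _ h => h⟩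
    simp only [Cmd.wp, WordExpr.val, Op.app, hx, g21, g22, State.var_putVar,
      State.var_putArr, State.arr_putVar, State.arr_putArr, Nat.reduceEqDiff, if_true, if_false,
      Nat.add_sub_cancel, hmod]
    refine ⟨by omega, by omega, by omega, trivial, by omega,
      ⟨decide (x % 2 = 1) :: q, by rw [g4, bitsOf]; simp, StoredAt.cons ?_ ?_⟩, fun j hj => ?_⟩
    · rw [Function.update_self]
      rcases Nat.mod_two_eq_zero_or_one x with h | h <;> simp [h]
    · exact g5.congr fun j hj _ => Function.update_of_ne (by omega) _ _
    · rw [Function.update_of_ne (by omega), g6 j hj]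
  · rintro t s₁ hf ⟨g21, g0, ⟨q, g4, g5⟩, g6⟩ hp
    simp only [Test.Holds, WordExpr.val, g21] at hp
    obtain rfl : t = 0 := by omega
    rw [bitsOf, List.nil_append] at g4
    rw [g4]
    exact ⟨g5, g6⟩

/-- The memory holds a finished tree, the blocks and the ranks. -/
structure CodeReady (n r : ℕ) (s : State) (path : ℕ → List Bool) (m : ℕ) : Prop where
  n_eq : s.var 1 = n
  r_eq : s.var 14 = r
  r_le : r ≤ n
  root : path 1 = []
  parent : ∀ i, 2 ≤ i → i ≤ m → 1 ≤ s.arr 12 i ∧ s.arr 12 i < i ∧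
    s.arr 13 i ≤ 1 ∧ path i = path (s.arr 12 i) ++ [decide (s.arr 13 i = 1)]
  leaf : ∀ k < r, 1 ≤ s.arr 11 k ∧ s.arr 11 k ≤ m ∧ (path (s.arr 11 k)).length = s.arr 7 k
  length_le : ∀ k < r, s.arr 7 k + s.arr 9 k ≤ n
  rank_lt : ∀ i < n, s.arr 4 i < n
  cover : ∀ ρ < n, ∃ k < r, s.arr 10 k ≤ ρ ∧ ρ < s.arr 10 k + s.arr 8 k

/-- The codeword of the symbol `i`, which belongs to the block `k`, is stored in `s'`; the blocks,
the leaves and the ranks are those of the state `s`. -/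
def WordStored (n : ℕ) (s s' : State) (path : ℕ → List Bool) (i k : ℕ) : Prop :=
  s.arr 10 k ≤ s.arr 4 i ∧ s.arr 4 i < s.arr 10 k + s.arr 8 k ∧
    s'.arr 2 i = s.arr 7 k + s.arr 9 k ∧
    StoredAt (s'.arr 3) (i * n) (path (s.arr 11 k) ++ bitsOf (s.arr 9 k) (s.arr 4 i - s.arr 10 k))

theorem wordProg_halts {n r m : ℕ} (hV : 4 * (n + 1) ^ 2 ≤ V) {s : State}
    {path : ℕ → List Bool} (h : CodeReady n r s path m) {i : ℕ} (hi : i < n) (h2 : s.var 2 = i) :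
    Halts b V wordProg s (n * 20 + 40) fun s' => (∃ k < r, WordStored n s s' path i k) ∧
      (∀ j, j ≠ i → s'.arr 2 j = s.arr 2 j) ∧ ∀ j < i * n, s'.arr 3 j = s.arr 3 j := by
  have hV' : 2 * n + 2 ≤ V := by nlinarith
  have hin : i * n + n ≤ V := by nlinarith
  have hρ := h.rank_lt i hi
  have h1 := h.n_eq
  have h14 := h.r_eq
  have hrn := h.r_le
  apply Halts.of_bounded
  intro hs
  refine ((Halts.of_wp (Q := fun s' => s'.var 20 = s.arr 4 i) ?_).seq (t' := n * 20 + 36)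
    ?_).mono (by simp [Cmd.size]; omega) fun _ _ h => h
  · simp only [Cmd.wp, WordExpr.val, h2, State.var_putVar, Nat.reduceEqDiff, if_true, if_false]
    exact ⟨by omega, by omega, trivial⟩
  intro s₁ hf₁ g20
  have e1 : ∀ a, s₁.arr a = s.arr a := fun a => hf₁.arr a (by simp [Cmd.arrs])
  refine ((locateBlock_halts (by omega) ((hf₁.var 14 (by decide)).trans h14) g20 ?_).seq
    (t' := n * 15 + 30) ?_).mono (by omega) fun _ _ h => h
  · rw [e1, e1]
    exact h.cover _ hρ
  intro s₂ hf₂ hk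
  have e2 : ∀ a, s₂.arr a = s.arr a := fun a => by
    rw [hf₂.arr a (by simp [locateBlock, Cmd.forVar, Cmd.arrs]), e1]
  rw [e1, e1] at hk
  generalize hk19 : s₂.var 19 = k at *
  obtain ⟨hkr, hk1, hk2⟩ := hk
  obtain ⟨l1, l2, l3⟩ := h.leaf k hkr
  have l4 := h.length_le k hkr
  have v2 : s₂.var 2 = i := by rw [hf₂.var 2 (by decide), hf₁.var 2 (by decide), h2]
  have v1 : s₂.var 1 = n := by rw [hf₂.var 1 (by decide), hf₁.var 1 (by decide), h1]
  have v20 : s₂.var 20 = s.arr 4 i := by rw [hf₂.var 20 (by decide), g20]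
  have b11 := hs.2 11 k
  have b7 := hs.2 7 k
  refine ((Halts.of_wp (Q := fun s' => s'.var 16 = s.arr 11 k ∧ s'.var 21 = s.arr 7 k ∧
    s'.var 22 = i * n ∧ s'.arr 2 = Function.update (s.arr 2) i (s.arr 7 k + s.arr 9 k)) ?_).seq
      (t' := n * 15 + 20) ?_).mono (by simp [Cmd.size]; omega) fun _ _ h => h
  · simp only [Cmd.wp, WordExpr.val, Op.app, e2, hk19, v1, v2, State.var_putVar, State.var_putArr,
      State.arr_putVar, State.arr_putArr, Nat.reduceEqDiff, if_true, if_false]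
    exact ⟨b11, b7, by omega, by omega, trivial, trivial, trivial, trivial⟩
  rintro s₃ hf₃ ⟨g16, g21, g22, a2⟩
  have e3 : ∀ a, a ≠ 2 → s₃.arr a = s.arr a := fun a ha => by
    rw [hf₃.arr a (by simp [Cmd.arrs, ha]), e2]
  refine ((pathLoop_halts (path := path) (m := m) g22 g21 h.root ?_ ?_ ?_ ?_).seq
    (t' := s.arr 9 k * 6 + 10) ?_).mono (by omega) fun _ _ h => h
  · rw [e3 12 (by decide), e3 13 (by decide)]
    exact h.parent
  · rw [g16]
    exact l1
  · rw [g16]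
    exact l2
  · rw [g16]
    exact l3
  rintro s₄ hf₄ ⟨hst, hold⟩
  rw [g16] at hst
  have e4 : ∀ a, a ≠ 2 → a ≠ 3 → s₄.arr a = s.arr a := fun a ha ha' => by
    rw [hf₄.arr a (by simp [pathLoop, Cmd.arrs, ha']), e3 a ha]
  have v19 : s₄.var 19 = k := by rw [hf₄.var 19 (by decide), hf₃.var 19 (by decide), hk19]
  have w1 : s₄.var 1 = n := by rw [hf₄.var 1 (by decide), hf₃.var 1 (by decide), v1]
  have w2 : s₄.var 2 = i := by rw [hf₄.var 2 (by decide), hf₃.var 2 (by decide), v2]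
  have w20 : s₄.var 20 = s.arr 4 i := by rw [hf₄.var 20 (by decide), hf₃.var 20 (by decide), v20]
  refine ((Halts.of_wp (Q := fun s' => s'.var 22 = i * n + s.arr 7 k ∧
    s'.var 20 = s.arr 4 i - s.arr 10 k ∧ s'.var 21 = s.arr 9 k) ?_).seq
      (t' := s.arr 9 k * 6 + 1) ?_).mono (by simp [Cmd.size]; omega) fun _ _ h => h
  · simp only [Cmd.wp, WordExpr.val, Op.app, e4 7 (by decide) (by decide),
      e4 9 (by decide) (by decide), e4 10 (by decide) (by decide), v19, w1, w2, w20,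
      State.var_putVar, State.arr_putVar, Nat.reduceEqDiff, if_true, if_false]
    exact ⟨by omega, by omega, by omega, trivial, trivial, trivial⟩
  rintro s₅ hf₅ ⟨g22', g20', g21'⟩
  have e5 : s₅.arr 3 = s₄.arr 3 := hf₅.arr 3 (by decide)
  refine (bitsLoop_halts g22' g21' g20').mono le_rfl ?_
  rintro s₆ hf₆ ⟨hst', hold'⟩
  rw [e5] at hold'
  have a2' : s₆.arr 2 = Function.update (s.arr 2) i (s.arr 7 k + s.arr 9 k) := by
    rw [hf₆.arr 2 (by decide), hf₅.arr 2 (by decide), hf₄.arr 2 (by decide), a2]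
  refine ⟨⟨k, hkr, hk1, hk2, by rw [a2', Function.update_self], StoredAt.append ?_ ?_⟩,
    fun j hj => by rw [a2', Function.update_of_ne hj], fun j hj => ?_⟩
  · refine hst.congr fun j _ hj => hold' j ?_
    rwa [l3] at hj
  · rw [l3]
    exact hst'
  · rw [hold' j (by omega), hold j hj, e3 3 (by decide)]

theorem codeProg_halts {n r m : ℕ} (hV : 4 * (n + 1) ^ 2 ≤ V) {s : State}
    {path : ℕ → List Bool} (h : CodeReady n r s path m) :
    Halts b V codeProg s (n * (n * 20 + 43) + 3) fun s' =>
      ∀ i < n, ∃ k < r, WordStored n s s' path i k := by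
  have h1 := h.n_eq
  refine (Halts.forVar (τ := n * 20 + 40) (fun i s' => ∀ i' < i, ∃ k < r, WordStored n s s' path i' k)
    (by decide) (by decide) (by decide) (by simp) ?_ ?_).mono (by rw [h1]) fun _ _ h => h
  · intro i hi s₁ hf hi₁ _ hI
    rw [h1] at hi
    have ea : ∀ a, a ≠ 2 → a ≠ 3 → s₁.arr a = s.arr a := fun a ha ha' =>
      hf.arr a (by simp [wordProg, locateBlock, pathLoop, bitsLoop, Cmd.forVar, Cmd.arrs, ha, ha'])
    have a4 := ea 4 (by decide) (by decide)
    have a7 := ea 7 (by decide) (by decide)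
    have a8 := ea 8 (by decide) (by decide)
    have a9 := ea 9 (by decide) (by decide)
    have a10 := ea 10 (by decide) (by decide)
    have a11 := ea 11 (by decide) (by decide)
    have a12 := ea 12 (by decide) (by decide)
    have a13 := ea 13 (by decide) (by decide)
    have h' : CodeReady n r s₁ path m :=
      ⟨by rw [hf.var 1 (by decide), h1], by rw [hf.var 14 (by decide), h.r_eq], h.r_le, h.root,
        by rw [a12, a13]; exact h.parent, by rw [a11, a7]; exact h.leaf,
        by rw [a7, a9]; exact h.length_le, by rw [a4]; exact h.rank_lt,
        by rw [a10, a8]; exact h.cover⟩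
    refine (wordProg_halts hV h' hi hi₁).mono le_rfl ?_
    rintro s₂ - ⟨⟨k, hk, hw⟩, h2, h3⟩ i' hi'
    rcases Nat.lt_succ_iff_lt_or_eq.1 hi' with hi' | rfl
    · obtain ⟨k', hk', w1, w2, w3, w4⟩ := hI i' hi'
      refine ⟨k', hk', w1, w2, ?_, ?_⟩
      · rw [State.arr_putVar, h2 i' hi'.ne, w3]
      · rw [State.arr_putVar]
        -- Codewords have at most `n` bits, so that of an earlier symbol `i'` ends before the cell
        -- `(i' + 1) * n` and is not overwritten.
        refine w4.congr fun j _ hj => h3 j (hj.trans_le ?_)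
        rw [List.length_append, length_bitsOf, (h.leaf k' hk').2.2]
        have := h.length_le k' hk'
        nlinarith
    · refine ⟨k, hk, ?_⟩
      unfold WordStored at hw ⊢
      rwa [a4, a7, a8, a9, a10, a11] at hw
  · intro s' _ _ _ hI
    rw [h1] at hI
    exact hI

end OptSkeleton

/-! ### The finished tree -/

namespace OptSkeleton

namespace TreeInv

variable {r : ℕ} {E : ℕ → ℕ} {ch : Bool → ℕ → ℕ} {leaf par bit : ℕ → ℕ} {path : ℕ → List Bool}
  {m : ℕ}

/-- When no node waits, the Kraft sum of the unassigned leaves is empty; its terms are positive, so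
there are none. -/
theorem leaf_ne_zero (h : TreeInv r E ch leaf par bit path (m + 1) m) {k : ℕ} (hk : k < r) :
    leaf k ≠ 0 := by
  intro h0
  have hs := h.kraft
  rw [Finset.Ico_self, Finset.sum_empty, eq_comm,
    Finset.sum_eq_zero_iff_of_nonneg fun _ _ => by positivity] at hs
  exact absurd (hs k (by simp [hk, h0])) (by positivity)

theorem one_le_size (h : TreeInv r E ch leaf par bit path (m + 1) m) : 1 ≤ m := by
  have := h.count
  rw [Finset.filter_false_of_mem fun k hk => h.leaf_ne_zero (Finset.mem_range.1 hk),
    Finset.card_empty] at this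
  omega

theorem leaf_mem (h : TreeInv r E ch leaf par bit path (m + 1) m) {k : ℕ} (hk : k < r) :
    1 ≤ leaf k ∧ leaf k ≤ m :=
  ⟨Nat.one_le_iff_ne_zero.2 (h.leaf_ne_zero hk),
    Nat.lt_succ_iff.1 (h.leaf_le k hk (h.leaf_ne_zero hk)).1⟩

theorem exists_path_eq_of_prefix {a : ℕ} (h : TreeInv r E ch leaf par bit path a m) :
    ∀ i, 1 ≤ i → i ≤ m → ∀ v, v <+: path i → ∃ j, 1 ≤ j ∧ j ≤ m ∧ path j = v := by
  intro i
  induction i using Nat.strong_induction_on with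
  | _ i ih =>
    intro hi hm v hv
    obtain rfl | hi2 := hi.eq_or_lt
    · rw [h.root, List.prefix_nil] at hv
      exact ⟨1, le_rfl, hm, by rw [hv, h.root]⟩
    · obtain ⟨hp, hpi, -, he⟩ := h.parent i hi2 hm
      rw [he, List.prefix_concat_iff] at hv
      rcases hv with rfl | hv
      · exact ⟨i, hi, hm, he⟩
      · exact ih _ hpi hp (hpi.le.trans hm) v hv

/-- Children have larger addresses than their parent, and addresses are at most `m`, so going to the
left child ends at a leaf. -/
theorem exists_prefix_leaf (h : TreeInv r E ch leaf par bit path (m + 1) m) {i : ℕ} (hi : 1 ≤ i)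
    (hm : i ≤ m) : ∃ k < r, path i <+: path (leaf k) := by
  induction hd : m - i using Nat.strong_induction_on generalizing i with
  | _ d ih =>
    rcases h.closed i hi (by omega) with ⟨k, hk, rfl⟩ | hc
    · exact ⟨k, hk, List.prefix_rfl⟩
    · obtain ⟨h1, h2, h3⟩ := hc false
      obtain ⟨k, hk, hp⟩ := ih (m - ch false i) (by omega) (by omega) h2 rfl
      exact ⟨k, hk, (List.prefix_append _ _).trans (h3 ▸ hp)⟩

theorem eq_of_leaf_prefix (h : TreeInv r E ch leaf par bit path (m + 1) m) {k : ℕ} (hk : k < r)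
    {i : ℕ} (hi : 1 ≤ i) (hm : i ≤ m) (hp : path (leaf k) <+: path i) :
    path (leaf k) = path i := by
  obtain ⟨v, hv⟩ := hp
  obtain _ | ⟨x, v⟩ := v
  · simpa using hv
  · obtain ⟨j, h1, h2, hj⟩ := h.exists_path_eq_of_prefix i hi hm (path (leaf k) ++ [x])
      ⟨v, by simpa using hv⟩
    exact absurd hj ((h.leaf_le k hk (h.leaf_ne_zero hk)).2.2.path j x h1 h2)

theorem injOn_leaf (h : TreeInv r E ch leaf par bit path (m + 1) m) :
    Set.InjOn (fun k => path (leaf k)) (Finset.range r : Set ℕ) := by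
  intro k hk k' hk' heq
  rw [Finset.coe_range, Set.mem_Iio] at hk hk'
  exact h.leaf_inj k hk k' hk' (h.leaf_ne_zero hk) (h.inj _ _ (h.leaf_mem hk).1 (h.leaf_mem hk).2
    (h.leaf_mem hk').1 (h.leaf_mem hk').2 heq)

theorem exists_fullTree (h : TreeInv r E ch leaf par bit path (m + 1) m) :
    ∃ t : FullTree, t.leaves = (Finset.range r).image (fun k => path (leaf k)) ∧
      t.leaves.card = r ∧ t.nodes = path '' Set.Icc 1 m := by
  have mem : ∀ u, u ∈ (Finset.range r).image (fun k => path (leaf k)) ↔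
      ∃ k < r, path (leaf k) = u := by simp
  have hS : ∃ t : FullTree, t.leaves = (Finset.range r).image (fun k => path (leaf k)) := by
    refine FullTree.exists_leaves_eq (((Finset.range r).image fun k => path (leaf k)).sup List.length)
      _ ?_ (fun u hu => Finset.le_sup (f := List.length) hu) ?_ ?_
    · obtain ⟨k, hk, -⟩ := h.exists_prefix_leaf le_rfl h.one_le_size
      exact ⟨_, (mem _).2 ⟨k, hk, rfl⟩⟩
    · intro u hu v hv huv
      obtain ⟨k, hk, rfl⟩ := (mem u).1 hu
      obtain ⟨k', hk', rfl⟩ := (mem v).1 hv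
      exact h.eq_of_leaf_prefix hk (h.leaf_mem hk').1 (h.leaf_mem hk').2 huv
    · rintro v x ⟨u, hu, hv⟩
      obtain ⟨k, hk, rfl⟩ := (mem u).1 hu
      have hprefix := h.exists_path_eq_of_prefix _ (h.leaf_mem hk).1 (h.leaf_mem hk).2
      obtain ⟨i, h1, h2, rfl⟩ := hprefix v ((List.prefix_append v [x]).trans hv)
      obtain ⟨j, h3, h4, hj⟩ := hprefix _ hv
      rcases h.closed i h1 (by omega) with ⟨k', hk', rfl⟩ | hc
      · exact absurd hj ((h.leaf_le k' hk' (h.leaf_ne_zero hk')).2.2.path j x h3 h4)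
      · obtain ⟨h5, h6, h7⟩ := hc (!x)
        obtain ⟨k', hk', hp⟩ := h.exists_prefix_leaf (by omega) h6
        exact ⟨_, (mem _).2 ⟨k', hk', rfl⟩, h7 ▸ hp⟩
  obtain ⟨t, ht⟩ := hS
  refine ⟨t, ht, by rw [ht, Finset.card_image_of_injOn h.injOn_leaf, Finset.card_range], ?_⟩
  ext v
  simp only [FullTree.nodes, ht, mem]
  constructor
  · rintro ⟨u, ⟨k, hk, rfl⟩, hv⟩
    obtain ⟨j, h1, h2, hj⟩ := h.exists_path_eq_of_prefix _ (h.leaf_mem hk).1 (h.leaf_mem hk).2 v hv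
    exact ⟨j, ⟨h1, h2⟩, hj⟩
  · rintro ⟨i, ⟨h1, h2⟩, rfl⟩
    obtain ⟨k, hk, hp⟩ := h.exists_prefix_leaf h1 h2
    exact ⟨_, ⟨k, hk, rfl⟩, hp⟩

end TreeInv

/-- Paths are distinct, so the inverse of `path` provides the addresses; they start at `1`, which
leaves zero free to mean a missing child. -/
theorem TreeInv.storesTree {r m : ℕ} {E leaf par bit : ℕ → ℕ} {path : ℕ → List Bool} {s : State}
    (h : TreeInv r E s.child leaf par bit path (m + 1) m) (h0 : s.var 0 = 1) :
    StoresTree s (path '' Set.Icc 1 m) := by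
  have inj : Set.InjOn path (Set.Icc 1 m) := fun i hi j hj => h.inj i j hi.1 hi.2 hj.1 hj.2
  have hone : 1 ∈ Set.Icc 1 m := ⟨le_rfl, h.one_le_size⟩
  have addr : ∀ i ∈ Set.Icc 1 m, Function.invFunOn path (Set.Icc 1 m) (path i) = i :=
    fun i hi => inj.leftInvOn_invFunOn hi
  refine ⟨Function.invFunOn path (Set.Icc 1 m), ?_, ?_, ⟨1, hone, h.root⟩, ?_, ?_⟩
  · rintro _ ⟨i, hi, rfl⟩ _ ⟨j, hj, rfl⟩ hij
    rw [addr i hi, addr j hj] at hij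
    rw [hij]
  · rintro _ ⟨i, hi, rfl⟩
    rw [addr i hi]
    exact Nat.one_le_iff_ne_zero.1 hi.1
  · rw [h0, ← h.root, addr 1 hone]
  · rintro _ ⟨i, hi, rfl⟩ x
    rw [addr i hi]
    rcases h.closed i hi.1 (Nat.lt_succ_of_le hi.2) with ⟨k, hk, rfl⟩ | hc
    · have hl := (h.leaf_le k hk (h.leaf_ne_zero hk)).2.2
      refine ⟨?_, fun _ => hl.child x⟩
      rintro ⟨j, hj, he⟩
      exact absurd he (hl.path j x hj.1 hj.2)
    · obtain ⟨h1, h2, h3⟩ := hc x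
      have hmem : s.child x i ∈ Set.Icc 1 m := ⟨hi.1.trans h1.le, h2⟩
      refine ⟨fun _ => ?_, fun hn => absurd ⟨_, hmem, h3⟩ hn⟩
      rw [← h3, addr _ hmem, State.child]

end OptSkeleton

/-! ### The algorithm -/

namespace OptSkeleton

variable {b V : ℕ}

theorem BlocksFrom.eq_of_mem {n x r d : ℕ} {E P B F L : ℕ → ℕ} (h : BlocksFrom n x r d E P B F L)
    {ρ k k' : ℕ} (hk : k < r) (hk' : k' < r) (h1 : F k ≤ ρ) (h2 : ρ < F k + P k)
    (h3 : F k' ≤ ρ) (h4 : ρ < F k' + P k') : k = k' := by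
  rcases lt_trichotomy k k' with hlt | heq | hlt
  · have := h.disjoint k k' hlt hk'
    omega
  · exact heq
  · have := h.disjoint k' k hlt hk
    omega

/-- The codewords that result from hanging below every leaf `u k` of a tree a perfect tree for the
ranks of the block `k` form a prefix-free code, and its tree is an expansion of that tree. -/
theorem BlocksFrom.expand {n r d : ℕ} {E P B F L : ℕ → ℕ} (h : BlocksFrom n 0 r d E P B F L)
    {t : FullTree} {u : ℕ → List Bool} (hu : Set.InjOn u (Finset.range r : Set ℕ))
    (ht : t.leaves = (Finset.range r).image u) {ω : ℕ → ℝ} {κ : Fin n → ℕ}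
    (hκ : ∀ i : Fin n, κ i < r ∧ F (κ i) ≤ rank n ω i ∧ rank n ω i < F (κ i) + P (κ i))
    {c : Fin n → List Bool}
    (hc : ∀ i, c i = u (κ i) ++ bitsOf (B (κ i)) (rank n ω i - F (κ i))) :
    IsPrefixFree c ∧ ∃ η, (t.expand η).leaves = Finset.univ.image c := by
  have mem : ∀ v, v ∈ t.leaves ↔ ∃ k < r, u k = v := by simp [ht]
  have heq : ∀ i j, c i = c j → i = j := by
    intro i j hij
    obtain ⟨hi, hi1, hi2⟩ := hκ i
    obtain ⟨hj, hj1, hj2⟩ := hκ j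
    rw [hc i, hc j] at hij
    -- Both block roots are prefixes of the same codeword, hence comparable, and comparable leaves
    -- of `t` coincide.
    have hui : u (κ i) = u (κ j) := by
      rcases List.prefix_or_prefix_of_prefix (List.prefix_append (u (κ i)) _)
        (hij ▸ List.prefix_append (u (κ j)) _) with hp | hp
      · exact FullTree.eq_of_prefix ((mem _).2 ⟨_, hi, rfl⟩) ((mem _).2 ⟨_, hj, rfl⟩) hp
      · exact (FullTree.eq_of_prefix ((mem _).2 ⟨_, hj, rfl⟩) ((mem _).2 ⟨_, hi, rfl⟩) hp).symm
    have hk : κ i = κ j := hu (by simpa using hi) (by simpa using hj) hui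
    rw [hk] at hi1 hi2 hij
    have hP := h.pow _ hj
    have := bitsOf_inj (by omega) (by omega) (List.append_cancel_left hij)
    exact Fin.ext (rank_injOn (n := n) (w := ω) (by simp) (by simp) (by omega))
  let η : List Bool → ℕ := fun v => B (Function.invFunOn u (Finset.range r : Set ℕ) v)
  have hη : ∀ k < r, η (u k) = B k := fun k hk =>
    congrArg B (hu.leftInvOn_invFunOn (by simpa using hk))
  have hleaves : (t.expand η).leaves = Finset.univ.image c := by
    ext v
    rw [FullTree.mem_leaves_expand]
    simp only [mem, Finset.mem_image, Finset.mem_univ, true_and]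
    constructor
    · rintro ⟨_, ⟨k, hk, rfl⟩, β, hβ, rfl⟩
      rw [hη k hk] at hβ
      obtain ⟨o, ho, hob⟩ := exists_bitsOf_eq β
      rw [hβ] at ho hob
      have hP := h.pow k hk
      have hF := h.top k hk
      obtain ⟨i, hi, hr⟩ := exists_rank_eq (n := n) (w := ω) (ρ := F k + o) (by omega)
      obtain ⟨h1, h2, h3⟩ := hκ ⟨i, hi⟩
      -- The blocks have disjoint intervals of ranks, so the block selected by `κ` is `k`.
      have hk' := h.eq_of_mem h1 hk h2 h3 (ρ := rank n ω i) (by omega) (by omega)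
      refine ⟨⟨i, hi⟩, ?_⟩
      rw [hc, hk', hr, Nat.add_sub_cancel_left, hob]
    · rintro ⟨i, rfl⟩
      exact ⟨_, ⟨κ i, (hκ i).1, rfl⟩, _, by rw [hη _ (hκ i).1, length_bitsOf], hc i⟩
  refine ⟨fun i j hne hp => hne (heq i j ?_), η, hleaves⟩
  exact FullTree.eq_of_prefix (t := t.expand η) (hleaves ▸ Finset.mem_image_of_mem c (Finset.mem_univ i))
    (hleaves ▸ Finset.mem_image_of_mem c (Finset.mem_univ j)) hp

theorem inputState_wt {n : ℕ} (w : Fin n → ℝ) (i : Fin n) : (inputState w).wt 0 i = w i := by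
  simp [inputState]

theorem smallSum_inputState_le {n : ℕ} (w : Fin n → ℝ) (S : Finset (Fin n)) :
    smallSum n ((inputState w).wt 0) S.card ≤ ∑ i ∈ S, w i := by
  have := smallSum_card_le (n := n) (w := (inputState w).wt 0) (S := S.map Fin.valEmbedding)
    fun i hi => by
      obtain ⟨j, -, rfl⟩ := Finset.mem_map.1 hi
      simp
  rw [Finset.card_map, Finset.sum_map] at this
  exact this.trans_eq (Finset.sum_congr rfl fun i _ => inputState_wt w i)

theorem smallSum_inputState_nonneg {n : ℕ} {w : Fin n → ℝ} (hw : ∀ i, 0 < w i) (x : ℕ) :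
    0 ≤ smallSum n ((inputState w).wt 0) x := by
  refine Finset.sum_nonneg fun i hi => ?_
  have hi : i < n := by simpa using (Finset.mem_filter.1 hi).1
  exact ((hw ⟨i, hi⟩).trans_eq (inputState_wt w ⟨i, hi⟩).symm).le

/-- The whole algorithm. -/
def mainProg : Cmd :=
  .seq (.seq (.setVar 1 (.var 0)) (.setVar 5 (.op .add (.var 1) (.const 1))))
    (.seq rankProg (.seq sumProg (.seq tableProg (.seq blockProg (.seq treeProg
      (.seq codeProg (.setVar 0 (.const 1))))))))

/-- The memory holds an optimal skeleton tree and an optimal code that induces it. -/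
def Solved {n : ℕ} (w : Fin n → ℝ) (s : State) : Prop :=
  ∃ c : Fin n → List Bool, InducesOptimalSkeleton w c ∧
    StoresTree s (skeleton (codeTree c)) ∧ StoresCode s c

/-- The cost of the stored code and its number of blocks are the two entries of the cell `(n, 1)`,
which are lexicographically at most those of every plan; `inducesOptimalSkeleton` applies. -/
theorem solved_of_stored {n : ℕ} (hn : 1 ≤ n) {w : Fin n → ℝ} (hw : ∀ i, 0 < w i)
    {s₁ s₂ s₃ : State} {r d m : ℕ} {L : ℕ → ℕ} {path : ℕ → List Bool}
    (ht : TableOk n (smallSum n ((inputState w).wt 0)) s₁ (n + 1) 0)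
    (hb : BlocksFrom n 0 r d (s₂.arr 7) (s₂.arr 8) (s₂.arr 9) (s₂.arr 10) L)
    (hcost : s₁.wt 2 (cellIx n n 1) =
      ∑ i ∈ Finset.range n, (L (rank n ((inputState w).wt 0) i) : ℝ) * (inputState w).wt 0 i)
    (hcount : s₁.arr 5 (cellIx n n 1) = r)
    (htree : TreeInv r (s₂.arr 7) s₃.child (s₂.arr 11) (s₂.arr 12) (s₂.arr 13) path (m + 1) m)
    (hrank : ∀ i < n, s₂.arr 4 i = rank n ((inputState w).wt 0) i)
    (hword : ∀ i < n, ∃ k < r, WordStored n s₂ s₃ path i k) (h0 : s₃.var 0 = 1) :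
    Solved w s₃ := by
  obtain ⟨t, t1, t2, t3⟩ := htree.exists_fullTree
  choose! κ hκ hw' using hword
  let c : Fin n → List Bool := fun i => path (s₂.arr 11 (κ i)) ++
    bitsOf (s₂.arr 9 (κ i)) (rank n ((inputState w).wt 0) i - s₂.arr 10 (κ i))
  have hκ' : ∀ i : Fin n, κ i < r ∧ s₂.arr 10 (κ i) ≤ rank n ((inputState w).wt 0) i ∧
      rank n ((inputState w).wt 0) i < s₂.arr 10 (κ i) + s₂.arr 8 (κ i) := fun i => by
    obtain ⟨h1, h2, -⟩ := hw' i i.2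
    rw [hrank i i.2] at h1 h2
    exact ⟨hκ i i.2, h1, h2⟩
  have hlen : ∀ i : Fin n, (c i).length = s₂.arr 7 (κ i) + s₂.arr 9 (κ i) := fun i => by
    simp only [c, List.length_append, length_bitsOf]
    rw [(htree.leaf_le _ (hκ' i).1 (htree.leaf_ne_zero (hκ' i).1)).2.1]
  obtain ⟨hpf, η, hη⟩ := hb.expand htree.injOn_leaf t1 hκ' (c := c) fun i => rfl
  have hcode : codeCost w c = s₁.wt 2 (cellIx n n 1) := by
    rw [hcost, Finset.sum_range]
    refine Finset.sum_congr rfl fun i _ => ?_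
    rw [inputState_wt, hlen, hb.depth _ (hκ' i).1 _ (hκ' i).2.1 (hκ' i).2.2]
  obtain ⟨hopt, hskel⟩ := inducesOptimalSkeleton hn hw (smallSum_inputState_le w) hpf hη
    fun C k hp => by
      rw [hcode, t2, ← hcount]
      exact ht.lower (smallSum_inputState_nonneg hw) hp le_rfl (by omega)
  refine ⟨c, hopt, ?_, fun i => ⟨?_, ?_, fun j hj => ?_⟩⟩
  · rw [hskel, t3]
    exact htree.storesTree h0
  · rw [hlen, (hw' i i.2).2.2.1]
  · rw [hlen]
    exact hb.length_le _ (hκ' i).1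
  · have := (hw' i i.2).2.2.2
    rw [hrank i i.2] at this
    exact this j hj

theorem mainProg_halts {n : ℕ} (hn : 1 ≤ n) (hV : 4 * (n + 1) ^ 2 ≤ V) {w : Fin n → ℝ}
    (hw : ∀ i, 0 < w i) :
    Halts b V mainProg (inputState w) (1000 * (n ^ 2 * (Nat.log 2 n + 1))) (Solved w) := by
  have hV' : 2 * n + 2 ≤ V := by nlinarith
  have init := Halts.of_wp (b := b) (V := V) (s := inputState w)
    (c := .seq (.setVar 1 (.var 0)) (.setVar 5 (.op .add (.var 1) (.const 1))))
    (Q := fun s => s.var 1 = n ∧ s.var 5 = n + 1) (by simp [inputState, Op.app]; omega)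
  -- `T₁`, …, `T₆` are the times that remain from each of the six phases on.
  obtain ⟨T₆, e₆⟩ : ∃ T, T = n * (n * 20 + 43) + 3 + (Cmd.setVar 0 (.const 1)).size + 1 := ⟨_, rfl⟩
  obtain ⟨T₅, e₅⟩ : ∃ T, T = 2 * n * (n * 5 + 30) + 5 + T₆ + 1 := ⟨_, rfl⟩
  obtain ⟨T₄, e₄⟩ : ∃ T, T = n * 60 + 9 + T₅ + 1 := ⟨_, rfl⟩
  obtain ⟨T₃, e₃⟩ : ∃ T, T = (n + 1) * (n * ((Nat.log 2 n + 1) * 20 + 23) + 6) + 3 + T₄ + 1 :=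
    ⟨_, rfl⟩
  obtain ⟨T₂, e₂⟩ : ∃ T, T = (n + 1) * (n * 5 + 6) + 3 + T₃ + 1 := ⟨_, rfl⟩
  obtain ⟨T₁, e₁⟩ : ∃ T, T = n * (n * 5 + 11) + 3 + T₂ + 1 := ⟨_, rfl⟩
  refine (init.seq (t' := T₁) ?_).mono ?_ fun _ _ h => h
  swap
  · have hl : 1 ≤ Nat.log 2 n + 1 := by omega
    generalize Nat.log 2 n + 1 = l at *
    have a1 : n * l ≤ n ^ 2 * l := Nat.mul_le_mul_right _ (Nat.le_self_pow two_ne_zero n)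
    have a2 : n ^ 2 * 1 ≤ n ^ 2 * l := Nat.mul_le_mul_left _ hl
    have a3 : n ≤ n ^ 2 := Nat.le_self_pow two_ne_zero n
    simp only [Cmd.size] at e₆ ⊢
    nlinarith
  rintro s₁ f₁ ⟨h1, h5⟩
  have w₁ : s₁.wt 0 = (inputState w).wt 0 := f₁.wt 0 (by decide)
  rw [e₁]
  refine (rankProg_halts (by omega) h1).seq fun s₂ f₂ h4 => ?_
  rw [w₁] at h4
  have w₂ : s₂.wt 0 = (inputState w).wt 0 := (f₂.wt 0 (by decide)).trans w₁
  have h1₂ : s₂.var 1 = n := (f₂.var 1 (by decide)).trans h1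
  have h5₂ : s₂.var 5 = n + 1 := (f₂.var 5 (by decide)).trans h5
  rw [e₂]
  refine (sumProg_halts h1₂ h5₂ (w₂ ▸ h4) ?_).seq fun s₃ f₃ hs => ?_
  · rw [f₂.wt 1 (by decide), f₁.wt 1 (by decide)]
    funext i
    simp [inputState]
  rw [w₂] at hs
  have h1₃ : s₃.var 1 = n := (f₃.var 1 (by decide)).trans h1₂
  have h5₃ : s₃.var 5 = n + 1 := (f₃.var 5 (by decide)).trans h5₂
  have h4₃ : s₃.arr 4 = s₂.arr 4 := f₃.arr 4 (by decide)
  rw [e₃]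
  refine (tableProg_halts hV (smallSum_inputState_nonneg hw) h5₃ hs ?_ ?_).seq fun s₄ f₄ ht => ?_
  · rw [f₃.wt 2 (by decide), f₂.wt 2 (by decide), f₁.wt 2 (by decide)]
    simp [inputState]
  · rw [f₃.arr 5 (by decide), f₂.arr 5 (by decide), f₁.arr 5 (by decide)]
    rfl
  have h1₄ : s₄.var 1 = n := (f₄.var 1 (by decide)).trans h1₃
  have h5₄ : s₄.var 5 = n + 1 := (f₄.var 5 (by decide)).trans h5₃
  have h4₄ : s₄.arr 4 = s₂.arr 4 := (f₄.arr 4 (by decide)).trans h4₃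
  rw [e₄]
  refine (blockProg_halts hn hV ht h1₄ h5₄).seq
    fun s₅ f₅ ⟨r, d, L, h14, hr, hb, hkraft, hcost, hcount⟩ => ?_
  have h1₅ : s₅.var 1 = n := (f₅.var 1 (by decide)).trans h1₄
  have h4₅ : s₅.arr 4 = s₂.arr 4 := (f₅.arr 4 (by decide)).trans h4₄
  rw [e₅]
  refine (treeProg_halts hr hV' h14 rfl (fun k hk => by have := hb.length_le k hk; omega) hkraft
    fun a ha => ?_).seq fun s₆ f₆ ⟨path, m, hT, _⟩ => ?_
  · rw [f₅.arr a (by fin_cases ha <;> decide), f₄.arr a (by fin_cases ha <;> decide),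
      f₃.arr a (by fin_cases ha <;> decide), f₂.arr a (by fin_cases ha <;> decide),
      f₁.arr a (by fin_cases ha <;> decide)]
    rfl
  have h7 : s₆.arr 7 = s₅.arr 7 := f₆.arr 7 (by decide)
  rw [← f₆.arr 7 (by decide), ← f₆.arr 8 (by decide), ← f₆.arr 9 (by decide),
    ← f₆.arr 10 (by decide)] at hb
  rw [← h7] at hT
  have h4₆ : ∀ i < n, s₆.arr 4 i = rank n ((inputState w).wt 0) i := by
    rwa [f₆.arr 4 (by decide), h4₅]
  rw [e₆]
  refine (codeProg_halts (m := m) (path := path) hV ⟨(f₆.var 1 (by decide)).trans h1₅,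
    (f₆.var 14 (by decide)).trans h14, hr, hT.root, hT.parent, fun k hk =>
      ⟨(hT.leaf_mem hk).1, (hT.leaf_mem hk).2, (hT.leaf_le k hk (hT.leaf_ne_zero hk)).2.1⟩,
    hb.length_le, fun i hi => (h4₆ i hi).trans_lt (rank_lt hi),
    fun ρ hρ => hb.cover ρ (Nat.zero_le _) hρ⟩).seq fun s₇ f₇ hword => ?_
  refine (Halts.of_wp (Q := fun s => s.var 0 = 1 ∧ s.arr = s₇.arr) ?_).mono le_rfl
    fun s₈ _ ⟨h0, ha⟩ => ?_
  · simp
    omega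
  have hchild : s₈.child = s₆.child := by
    funext x
    rw [State.child, ha]
    cases x
    exacts [f₇.arr 0 (by decide), f₇.arr 1 (by decide)]
  refine solved_of_stored hn hw ht hb hcost hcount (hchild ▸ hT) h4₆ (fun i hi => ?_) h0
  unfold WordStored
  rw [ha]
  exact hword i hi

theorem bounded_inputState {n : ℕ} (hV : 4 * (n + 1) ^ 2 ≤ V) (w : Fin n → ℝ) :
    (inputState w).Bounded V := by
  refine ⟨fun x => ?_, fun _ _ => Nat.zero_le _⟩
  simp only [inputState]
  split_ifs
  · nlinarith
  · exact Nat.zero_le _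

/-- With `p = 2 ^ (Nat.log 2 n + 1)`, which is at least `n + 1` and at least `2`, the base is at
most `6 * p ^ 2 ≤ p ^ 5`. The exponent `5 * exprBound = 200` is raised to `201` for strictness. -/
theorem words_large_enough (n : ℕ) :
    (4 * (n + 1) ^ 2 + 2) ^ exprBound < 2 ^ (201 * (Nat.log 2 n + 1)) := by
  have h1 : n + 1 ≤ 2 ^ (Nat.log 2 n + 1) := Nat.lt_pow_succ_log_self one_lt_two n
  have h2 : 1 ≤ Nat.log 2 n + 1 := by omega
  generalize Nat.log 2 n + 1 = l at *
  have h3 : 2 ≤ 2 ^ l := Nat.le_self_pow (by omega) 2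
  have h4 : 4 * (n + 1) ^ 2 + 2 ≤ (2 ^ l) ^ 5 := by
    generalize 2 ^ l = p at *
    calc 4 * (n + 1) ^ 2 + 2 ≤ 4 * p ^ 2 + p ^ 2 * 2 := by nlinarith
      _ = p ^ 2 * 6 := by ring
      _ ≤ p ^ 2 * p ^ 3 := Nat.mul_le_mul_left _ (by nlinarith [Nat.pow_le_pow_left h3 3])
      _ = p ^ 5 := by ring
  calc _ ≤ ((2 ^ l) ^ 5) ^ exprBound := Nat.pow_le_pow_left h4 _
    _ = 2 ^ (200 * l) := by rw [exprBound, ← pow_mul, ← pow_mul]; ring_nf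
    _ < _ := Nat.pow_lt_pow_right one_lt_two (by omega)

end OptSkeleton

/-- There are one program and constants `k`, `C` such that, for all positive weights, the program,
run with words of `k (⌊log₂ n⌋ + 1)` bits, halts within `C n² (⌊log₂ n⌋ + 1)` time units and leaves
in memory an optimal skeleton tree and an optimal code whose tree induces it. -/
theorem theorem2 :
    ∃ (P : OptSkeleton.Cmd) (k C : ℕ), ∀ (n : ℕ), 1 ≤ n → ∀ (w : Fin n → ℝ), (∀ i, 0 < w i) →
      ∃ (t : ℕ) (s : OptSkeleton.State),
        OptSkeleton.Run (k * (Nat.log 2 n + 1)) P (OptSkeleton.inputState w) t s ∧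
        t ≤ C * (n ^ 2 * (Nat.log 2 n + 1)) ∧
        ∃ c : Fin n → List Bool,
          OptSkeleton.InducesOptimalSkeleton w c ∧
          OptSkeleton.StoresTree s (OptSkeleton.skeleton (OptSkeleton.codeTree c)) ∧
          OptSkeleton.StoresCode s c := by
  -- The factor `exprBound` converts the steps counted by `Halts` into time units.
  refine ⟨OptSkeleton.mainProg, 201, OptSkeleton.exprBound * 1000, fun n hn w hw => ?_⟩
  obtain ⟨t, s, hr, ht, -, -, hs⟩ := OptSkeleton.mainProg_halts hn le_rfl hw
    (OptSkeleton.words_large_enough n) (by decide) (OptSkeleton.bounded_inputState le_rfl w)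
  exact ⟨t, s, hr, by rwa [Nat.mul_assoc], hs⟩
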